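/- **Setting.** Let $\Omega\subset\mathbb R^2$ be a bounded convex polygonal domain. Let $\varepsilon\in L^\infty(\Omega)$ with $\varepsilon\ge\varepsilon_0>0$, $\boldsymbol\zeta\in[W^{1,\infty}(\Omega)]^2$, $\gamma\in W^{1,\infty}(\Omega)$ with $\gamma\ge 0$, and assume $\gamma-\tfrac12\nabla\cdot\boldsymbol\zeta\ge\gamma_0>0$. Let $y_d\in L^2(\Omega)$ and write $$a(y,v)=\int_\Omega(\varepsilon\nabla y+\boldsymbol\zeta y)\cdot\nabla v\,dx+\int_\Omega\gamma yv\,dx .$$ Let $(\bar p,\bar y)\in H^1_0(\Omega)\times H^1_0(\Omega)$ be the solution of $$a(q,\bar p)-(\bar y,q)_{L^2(\Omega)}-(\bar p,z)_{L^2(\Omega)}-a(\bar y,z)=-(y_d,q)_{L^2(\Omega)}\qquad\forall (q,z)\in H^1_0(\Omega)\times H^1_0(\Omega).$$ **Discretization.** Let $\mathcal T_h$ be a conforming triangulation of $\Omega$ with mesh size $h=\max_{T}h_T$, where $h_T=\operatorname{diam}T$, such that $\varepsilon\in W^{1,\infty}(T)$ for all $T\in\mathcal T_h$. It is shape regular with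 constant $\sigma$ if every $T\in\mathcal T_h$ contains a disc of diameter $\rho>0$ with $h_T\le\sigma\rho$. Let $V_h\subset H^1_0(\Omega)$ be the space of continuous functions that are affine on each $T\in\mathcal T_h$ and vanish on $\partial\Omega$. For an edge $E$ of $T$ from $\mathbf x_i$ to $\mathbf x_j$ put $\boldsymbol\tau_E=\mathbf x_j-\mathbf x_i$, let $\psi_E$ be the function on $E$ (unique up to a constant) with $$\psi_E(\mathbf x_i+t\boldsymbol\tau_E)-\psi_E(\mathbf x_i)=\int_0^t(\varepsilon^{-1}\boldsymbol\zeta\cdot\boldsymbol\tau_E)(\mathbf x_i+s\boldsymbol\tau_E)\,ds ,$$ and let $\kappa_E=\varepsilon e^{-\psi_E}$, $H(\kappa_E)=\big(\tfrac1{|E|}\int_E\kappa_E^{-1}ds\big)^{-1}$, $\delta_E(w)=w(\mathbf x_j)-w(\mathbf x_i)$ and $\omega_E^T=-\int_T\nabla\lambda_i\cdot\nabla\lambda_j\,dx$, where $\lambda_1,\lambda_2,\lambda_3$ are the barycentric coordinates of $T$ and the values of $\varepsilon,\boldsymbol\zeta$ on $E$ are those of their continuous representatives on $T$. The edge-averaged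 finite element (EAFE) form is $$a_h(y_h,v_h)=\sum_{T\in\mathcal T_h}\sum_{E\subset\partial T}\omega_E^T\,H(\kappa_E)\,\delta_E(e^{\psi_E}y_h)\,\delta_E(v_h)+\int_\Omega\gamma y_hv_h\,dx ,$$ and the EAFE approximation is a pair $(\bar p_h,\bar y_h)\in V_h\times V_h$ with $$a_h(q_h,\bar p_h)-(\bar y_h,q_h)_{L^2(\Omega)}-(\bar p_h,z_h)_{L^2(\Omega)}-a_h(\bar y_h,z_h)=-(y_d,q_h)_{L^2(\Omega)}\qquad\forall (q_h,z_h)\in V_h\times V_h.$$ **Theorem.** Assume that $\bar p,\bar y\in H^2(\Omega)$, and let $\sigma$ be given. Then there are constants $h_0>0$ and $C>0$, depending on the data above and on $\sigma$ but not on the triangulation, such that for every conforming triangulation $\mathcal T_h$ as above that is shape regular with constant $\sigma$ and has $h\le h_0$, the EAFE approximation $(\bar p_h,\bar y_h)$ exists, is unique, and satisfies $$\|\bar y-\bar y_h\|_{H^1(\Omega)}+\|\bar p-\bar p_h\|_{H^1(\Omega)}\le C\,h .$$ -/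

import Mathlib

open scoped ContDiff

noncomputable section

namespace EAFE

open MeasureTheory Set

/-- The Euclidean plane. -/
abbrev Plane : Type := EuclideanSpace ℝ (Fin 2)

/-! ### Sobolev spaces through weak derivatives -/

/-- Smooth test functions with compact support in `U`. -/
def IsTest (U : Set Plane) (φ : Plane → ℝ) : Prop :=
  ContDiff ℝ ∞ φ ∧ HasCompactSupport φ ∧ tsupport φ ⊆ U

/-- `g` is a weak partial derivative of `f` on the open set `U` in the `i`-th coordinate. -/
def HasWeakPartial (U : Set Plane) (i : Fin 2) (f g : Plane → ℝ) : Prop :=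
  LocallyIntegrableOn f U ∧ LocallyIntegrableOn g U ∧
    ∀ φ : Plane → ℝ, IsTest U φ →
      ∫ x in U, f x * fderiv ℝ φ x (EuclideanSpace.single i 1) = -∫ x in U, g x * φ x

open Classical in
/-- The weak partial derivative (unique up to null subsets of `U`); `0` if there is none. -/
def weakPartial (U : Set Plane) (i : Fin 2) (f : Plane → ℝ) : Plane → ℝ :=
  if h : ∃ g, HasWeakPartial U i f g then h.choose else 0

/-- The weak gradient. -/
def weakGrad (U : Set Plane) (f : Plane → ℝ) (x : Plane) : Plane :=
  WithLp.toLp 2 (fun i => weakPartial U i f x)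

/-- The weak divergence of a vector field. -/
def weakDiv (U : Set Plane) (F : Plane → Plane) (x : Plane) : ℝ :=
  ∑ i : Fin 2, weakPartial U i (fun z => F z i) x

/-- Membership in `L²(U)`. -/
def MemL2 (U : Set Plane) (f : Plane → ℝ) : Prop := MemLp f 2 (volume.restrict U)

/-- Membership in `H¹(U)`. -/
def MemH1 (U : Set Plane) (f : Plane → ℝ) : Prop :=
  MemL2 U f ∧ ∀ i : Fin 2, (∃ g, HasWeakPartial U i f g) ∧ MemL2 U (weakPartial U i f)

/-- Membership in `H²(U)`. -/
def MemH2 (U : Set Plane) (f : Plane → ℝ) : Prop :=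
  MemH1 U f ∧ ∀ i : Fin 2, MemH1 U (weakPartial U i f)

/-- Membership in `W^{1,∞}(U)`. -/
def MemW1Inf (U : Set Plane) (f : Plane → ℝ) : Prop :=
  MemLp f ⊤ (volume.restrict U) ∧
    ∀ i : Fin 2, (∃ g, HasWeakPartial U i f g) ∧
      MemLp (weakPartial U i f) ⊤ (volume.restrict U)

/-- The norm of `H¹(U)`. -/
def normH1 (U : Set Plane) (f : Plane → ℝ) : ℝ :=
  Real.sqrt ((∫ x in U, f x ^ 2) + ∫ x in U, ‖weakGrad U f x‖ ^ 2)

/-- Membership in `H¹₀(U)`, the closure of the test functions in `H¹(U)`. -/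
def MemH10 (U : Set Plane) (f : Plane → ℝ) : Prop :=
  MemH1 U f ∧ ∃ φ : ℕ → Plane → ℝ, (∀ n, IsTest U (φ n)) ∧
    Filter.Tendsto (fun n => normH1 U (fun x => f x - φ n x)) Filter.atTop (nhds 0)

/-- The inner product of `L²(U)`. -/
def innerL2 (U : Set Plane) (f g : Plane → ℝ) : ℝ := ∫ x in U, f x * g x

open Classical in
/-- The continuous representative on `K` of a function given up to null sets, where there is one;
it supplies the values, on the edges of a closed triangle `K`, of a coefficient that is
`W^{1,∞}` inside. -/
def contRep {F : Type*} [TopologicalSpace F] (K : Set Plane) (f : Plane → F) : Plane → F :=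
  if h : ∃ g : Plane → F, ContinuousOn g K ∧ g =ᵐ[volume.restrict K] f then h.choose else f

/-! ### The continuous problem -/

/-- Bounded convex polygonal domains: nonempty interiors of convex hulls of finite sets. -/
def IsConvexPolygon (Ω : Set Plane) : Prop :=
  Ω.Nonempty ∧ ∃ s : Finset Plane, Ω = interior (convexHull ℝ (s : Set Plane))

/-- `a(y,v) = ∫ (ε ∇y + ζ y)·∇v + ∫ γ y v`. -/
def formA (Ω : Set Plane) (ε : Plane → ℝ) (ζ : Plane → Plane) (γ : Plane → ℝ)
    (y v : Plane → ℝ) : ℝ :=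
  (∫ x in Ω, inner ℝ (ε x • weakGrad Ω y x + y x • ζ x) (weakGrad Ω v x)) +
    ∫ x in Ω, γ x * y x * v x

/-- `𝓑((p,y),(q,z)) = a(q,p) - (y,q) - (p,z) - a(y,z)`, for a given form `a`. -/
def saddleForm (Ω : Set Plane) (a : (Plane → ℝ) → (Plane → ℝ) → ℝ) (p y q z : Plane → ℝ) : ℝ :=
  a q p - innerL2 Ω y q - innerL2 Ω p z - a y z

/-- `(p,y) ∈ H¹₀ × H¹₀` solves the saddle-point problem with desired state `yd`. -/
def IsSaddleSolution (Ω : Set Plane) (ε : Plane → ℝ) (ζ : Plane → Plane) (γ : Plane → ℝ)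
    (yd p y : Plane → ℝ) : Prop :=
  MemH10 Ω p ∧ MemH10 Ω y ∧ ∀ q z : Plane → ℝ, MemH10 Ω q → MemH10 Ω z →
    saddleForm Ω (formA Ω ε ζ γ) p y q z = -innerL2 Ω yd q

/-! ### Triangulations -/

/-- A nondegenerate triangle with numbered vertices. -/
abbrev Tri : Type := Affine.Triangle ℝ Plane

/-- The closed triangle as a set. -/
def Tri.carrier (T : Tri) : Set Plane := convexHull ℝ (range T.points)

theorem Tri.affineSpan_eq_top (T : Tri) : affineSpan ℝ (range T.points) = ⊤ := by
  rw [T.independent.affineSpan_eq_top_iff_card_eq_finrank_add_one]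
  simp

/-- The vertices of a triangle as an affine basis of the plane. -/
def Tri.basis (T : Tri) : AffineBasis (Fin 3) ℝ Plane :=
  ⟨T.points, T.independent, Tri.affineSpan_eq_top T⟩

/-- The barycentric coordinate of the `i`-th vertex. -/
def Tri.bary (T : Tri) (i : Fin 3) (x : Plane) : ℝ := (Tri.basis T).coord i x

/-- Conforming triangulations of `Ω`: finitely many closed triangles that cover `closure Ω`, any
two of which meet in the convex hull of their common vertices. -/
structure Triangulation (Ω : Set Plane) where
  elems : Finset Tri
  cover : ⋃ T ∈ elems, Tri.carrier T = closure Ω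
  conforming : ∀ T ∈ elems, ∀ T' ∈ elems, T ≠ T' →
    range T.points ≠ range T'.points ∧
    Tri.carrier T ∩ Tri.carrier T' = convexHull ℝ (range T.points ∩ range T'.points)

/-- The mesh size `h`, the largest diameter of a triangle. -/
def Triangulation.meshSize {Ω : Set Plane} (M : Triangulation Ω) : ℝ :=
  sSup ((fun T : Tri => Metric.diam (Tri.carrier T)) '' (M.elems : Set Tri))

/-- Shape regularity with constant `σ`: each triangle contains a disc of diameter `2 * r` with
`h_T ≤ σ * (2 * r)`. -/
def Triangulation.ShapeRegular {Ω : Set Plane} (M : Triangulation Ω) (σ : ℝ) : Prop :=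
  ∀ T ∈ M.elems, ∃ (c : Plane) (r : ℝ), 0 < r ∧ Metric.closedBall c r ⊆ Tri.carrier T ∧
    Metric.diam (Tri.carrier T) ≤ σ * (2 * r)

/-- The space `V_h` of continuous piecewise linear functions that vanish on the boundary, each
extended by zero outside `Ω`. -/
def Triangulation.MemV {Ω : Set Plane} (M : Triangulation Ω) (v : Plane → ℝ) : Prop :=
  Continuous v ∧ (∀ x, x ∉ Ω → v x = 0) ∧
    ∀ T ∈ M.elems, ∃ g : Plane →ᵃ[ℝ] ℝ, ∀ x ∈ Tri.carrier T, v x = g x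

/-! ### The edge-averaged scheme -/

/-- The edge potential on the segment from `a` to `b`, at `a + t (b - a)`, normalized to be `0` at
`a`: the integral of `ε⁻¹ ζ·τ` with `τ = b - a`. -/
def edgePotential (ε : Plane → ℝ) (ζ : Plane → Plane) (a b : Plane) (t : ℝ) : ℝ :=
  ∫ s in (0 : ℝ)..t,
    (ε (AffineMap.lineMap a b s))⁻¹ * inner ℝ (ζ (AffineMap.lineMap a b s)) (b - a)

/-- `κ_E = ε e^{-ψ_E}` at `a + t (b - a)`. -/
def edgeKappa (ε : Plane → ℝ) (ζ : Plane → Plane) (a b : Plane) (t : ℝ) : ℝ :=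
  ε (AffineMap.lineMap a b t) * Real.exp (-edgePotential ε ζ a b t)

/-- The harmonic average of `κ_E` over the edge. -/
def edgeHarmonic (ε : Plane → ℝ) (ζ : Plane → Plane) (a b : Plane) : ℝ :=
  (∫ t in (0 : ℝ)..1, (edgeKappa ε ζ a b t)⁻¹)⁻¹

/-- `δ_E(e^{ψ_E} y) = (e^{ψ_E} y)(b) - (e^{ψ_E} y)(a)`. -/
def edgeDelta (ε : Plane → ℝ) (ζ : Plane → Plane) (a b : Plane) (y : Plane → ℝ) : ℝ :=
  Real.exp (edgePotential ε ζ a b 1) * y b - Real.exp (edgePotential ε ζ a b 0) * y a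

/-- The edge weight `ω_E^T = -∫_T ∇λ_i·∇λ_j`. -/
def Tri.weight (T : Tri) (i j : Fin 3) : ℝ :=
  -∫ x in Tri.carrier T, inner ℝ (gradient (Tri.bary T i) x) (gradient (Tri.bary T j) x)

/-- The local form `∑_{E ⊂ ∂T} ω_E^T H(κ_E) δ_E(e^{ψ_E} y) δ_E(v)`; the three edges run from vertex
`i` to vertex `i + 1` (mod 3), and the coefficients are taken from the inside of `T`. -/
def localForm (ε : Plane → ℝ) (ζ : Plane → Plane) (T : Tri) (y v : Plane → ℝ) : ℝ :=
  let εT := contRep (Tri.carrier T) ε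
  let ζT := contRep (Tri.carrier T) ζ
  ∑ i : Fin 3, Tri.weight T i (i + 1) *
    edgeHarmonic εT ζT (T.points i) (T.points (i + 1)) *
    edgeDelta εT ζT (T.points i) (T.points (i + 1)) y *
    (v (T.points (i + 1)) - v (T.points i))

/-- The global form `a_h`: the edge-averaged form of the convection-diffusion part, and the
reaction term, which is integrated exactly. -/
def Triangulation.formAh {Ω : Set Plane} (M : Triangulation Ω) (ε : Plane → ℝ) (ζ : Plane → Plane)
    (γ : Plane → ℝ) (y v : Plane → ℝ) : ℝ :=
  (∑ T ∈ M.elems, localForm ε ζ T y v) + ∫ x in Ω, γ x * y x * v x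

/-- `(p,y) ∈ V_h × V_h` solves the discrete saddle-point problem. -/
def Triangulation.IsDiscreteSolution {Ω : Set Plane} (M : Triangulation Ω) (ε : Plane → ℝ)
    (ζ : Plane → Plane) (γ : Plane → ℝ) (yd p y : Plane → ℝ) : Prop :=
  M.MemV p ∧ M.MemV y ∧ ∀ q z : Plane → ℝ, M.MemV q → M.MemV z →
    saddleForm Ω (M.formAh ε ζ γ) p y q z = -innerL2 Ω yd q

end EAFE

end

/-! The proof tests the error equation with the pair `(p_h - P, Y - y_h)`, where `P` and `Y` are the
nodal interpolants of the exact solution. With the second component reversed in sign the indefinite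
saddle-point form becomes the sum of two diagonal terms `a_h(v, v)`, and the `L²` couplings cancel.
Coercivity, consistency and interpolation then give the rate `h`. Every bilinear term is bounded by
Young's inequality with a free parameter, so that the whole argument runs on squared norms.

Coercivity. On `H¹₀` one has `∫ v ζ·∇v = -½ ∫ (∇·ζ) v²` (`integral_convection_self`), so the form `a`
is coercive with constant `min ε₀ γ₀` (`formA_self_ge`); the form `a_h` inherits half of that for
small `h`, which also gives existence and uniqueness (`existsUnique_isDiscreteSolution`). The space
`V_h` lies in `H¹₀`: averages around slightly dilated points are test functions
(`memH10_of_support_subset`).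

Consistency. The edge quantity `H(κ_E) δ_E(e^ψ w)` is a weighted mean of the tangential component of
the flux `ε ∇w + ζ w` along the edge (`abs_edgeHarmonic_mul_edgeDelta_sub_le`), and the weights `ω_E`
turn the tangential components of a constant vector field `J` into `∫_T J·∇v` (`Tri.sum_weight_mul`).
As the flux of an affine function is Lipschitz on each triangle, `|a_h - a| ≤ C h` on `V_h`
(`exists_abs_formAh_sub_formA_le`). The Lipschitz constant of `ε` does not depend on the triangulation:
one triangulation to which `ε` is adapted bounds the gradient of `ε` almost everywhere in `Ω`.

Interpolation. A function in `H²` of a convex set is approximated in `H²` by functions that are smooth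
up to the boundary (`MemH2.exists_smooth_tendsto`), by averages around slightly contracted points. The
interpolation error of a smooth function is a combination of its Taylor remainders at the vertices,
and those are bounded in `L²` by the Hessian (`lintegral_taylorRem_sq_le`). The same bound on all of `Ω`
makes the approximations converge uniformly (`exists_tendstoUniformlyOn`), and a Poincaré inequality on
small discs near the boundary shows that the limit vanishes there (`MemH10.eq_zero_of_notMem`); so its
nodal interpolant lies in `V_h`, and the error bound passes to the limit
(`exists_interpolant_energy_le`). -/

open scoped ContDiff

noncomputable section

namespace EAFE

open MeasureTheory Set Filter Topology

/-! ### Square-integrable functions -/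

section SquareIntegrable

variable {X : Type*} [MeasurableSpace X] {μ : Measure X}
variable {E : Type*} [NormedAddCommGroup E]

theorem integrable_norm_sq {f : X → E} (hf : MemLp f 2 μ) :
    Integrable (fun x => ‖f x‖ ^ 2) μ :=
  hf.norm.integrable_sq

theorem eLpNorm_two_eq_sqrt {f : X → E} (hf : MemLp f 2 μ) :
    eLpNorm f 2 μ = ENNReal.ofReal (√(∫ x, ‖f x‖ ^ 2 ∂μ)) := by
  rw [hf.eLpNorm_eq_integral_rpow_norm (by norm_num) (by norm_num)]
  congr 1
  rw [Real.sqrt_eq_rpow]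
  norm_num

theorem tendsto_integral_sq_iff {f : ℕ → X → E} (hf : ∀ n, MemLp (f n) 2 μ) :
    Tendsto (fun n => ∫ x, ‖f n x‖ ^ 2 ∂μ) atTop (𝓝 0) ↔
      Tendsto (fun n => eLpNorm (f n) 2 μ) atTop (𝓝 0) := by
  constructor
  · intro h
    have h1 : Tendsto (fun n => ENNReal.ofReal (√(∫ x, ‖f n x‖ ^ 2 ∂μ))) atTop (𝓝 0) := by
      have := (ENNReal.continuous_ofReal.tendsto _).comp ((Real.continuous_sqrt.tendsto _).comp h)
      simpa [Function.comp_def] using this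
    exact h1.congr fun n => (eLpNorm_two_eq_sqrt (hf n)).symm
  · intro h
    have h1 := ((ENNReal.tendsto_toReal (by simp)).comp h).pow 2
    simp only [Function.comp_def, ENNReal.toReal_zero] at h1
    rw [zero_pow two_ne_zero] at h1
    refine h1.congr fun n => ?_
    have h0 : 0 ≤ ∫ x, ‖f n x‖ ^ 2 ∂μ := integral_nonneg fun x => by positivity
    rw [eLpNorm_two_eq_sqrt (hf n), ENNReal.toReal_ofReal (Real.sqrt_nonneg _), Real.sq_sqrt h0]

theorem integrable_mul_of_memLp_two {f g : X → ℝ} (hf : MemLp f 2 μ) (hg : MemLp g 2 μ) :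
    Integrable (fun x => f x * g x) μ :=
  hf.integrable_mul hg

theorem integrable_inner_of_memLp_two [InnerProductSpace ℝ E] {f g : X → E}
    (hf : MemLp f 2 μ) (hg : MemLp g 2 μ) : Integrable (fun x => inner ℝ (f x) (g x)) μ := by
  refine Integrable.mono' (integrable_mul_of_memLp_two hf.norm hg.norm)
    (hf.1.inner hg.1) (Eventually.of_forall fun x => ?_)
  exact norm_inner_le_norm _ _

theorem memLp_two_mul {f g : X → ℝ} (hf : MemLp f ⊤ μ) (hg : MemLp g 2 μ) :
    MemLp (fun x => f x * g x) 2 μ :=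
  hg.mul' hf

theorem memLp_two_smul [NormedSpace ℝ E] {f : X → ℝ} {g : X → E} (hf : MemLp f ⊤ μ)
    (hg : MemLp g 2 μ) : MemLp (fun x => f x • g x) 2 μ :=
  hg.smul hf

theorem memLp_two_smul_top [NormedSpace ℝ E] {f : X → ℝ} {g : X → E} (hf : MemLp f 2 μ)
    (hg : MemLp g ⊤ μ) : MemLp (fun x => f x • g x) 2 μ :=
  hg.smul hf

theorem exists_ae_norm_le {f : X → E} (hf : MemLp f ⊤ μ) :
    ∃ C : ℝ, 0 ≤ C ∧ ∀ᵐ x ∂μ, ‖f x‖ ≤ C := by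
  refine ⟨(eLpNormEssSup f μ).toReal, ENNReal.toReal_nonneg, ?_⟩
  have h := hf.2
  rw [eLpNorm_exponent_top] at h
  filter_upwards [ae_le_eLpNormEssSup (f := f) (μ := μ)] with x hx
  have := ENNReal.toReal_mono h.ne hx
  simpa using this

theorem integral_sq_add_le {f g : X → E} (hf : MemLp f 2 μ) (hg : MemLp g 2 μ) :
    ∫ x, ‖f x + g x‖ ^ 2 ∂μ ≤ 2 * (∫ x, ‖f x‖ ^ 2 ∂μ) + 2 * ∫ x, ‖g x‖ ^ 2 ∂μ := by
  rw [← integral_const_mul, ← integral_const_mul, ← integral_add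
    ((integrable_norm_sq hf).const_mul 2) ((integrable_norm_sq hg).const_mul 2)]
  refine integral_mono (integrable_norm_sq (hf.add hg))
    (((integrable_norm_sq hf).const_mul 2).add ((integrable_norm_sq hg).const_mul 2)) fun x => ?_
  have := norm_add_le (f x) (g x)
  have h2 := norm_nonneg (f x + g x)
  nlinarith [sq_nonneg (‖f x‖ - ‖g x‖)]

/-- The integral of a product of two functions, one of which tends to zero in `L²` while the other
stays bounded there, tends to zero. -/
theorem tendsto_integral_inner_zero [InnerProductSpace ℝ E] {f g : ℕ → X → E} {A : ℝ}
    (hf : ∀ n, MemLp (f n) 2 μ) (hg : ∀ n, MemLp (g n) 2 μ)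
    (hf0 : Tendsto (fun n => ∫ x, ‖f n x‖ ^ 2 ∂μ) atTop (𝓝 0))
    (hgA : ∀ n, ∫ x, ‖g n x‖ ^ 2 ∂μ ≤ A) :
    Tendsto (fun n => ∫ x, inner ℝ (f n x) (g n x) ∂μ) atTop (𝓝 0) := by
  have hA : 0 ≤ A := (integral_nonneg fun x => by positivity).trans (hgA 0)
  -- Young's inequality with a free parameter replaces the Cauchy-Schwarz inequality
  have key : ∀ n, ∀ t : ℝ, 0 < t → ‖∫ x, inner ℝ (f n x) (g n x) ∂μ‖ ≤
      t⁻¹ * (∫ x, ‖f n x‖ ^ 2 ∂μ) + t * A := by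
    intro n t ht
    calc ‖∫ x, inner ℝ (f n x) (g n x) ∂μ‖
        ≤ ∫ x, (t⁻¹ * ‖f n x‖ ^ 2 + t * ‖g n x‖ ^ 2) ∂μ := by
          refine norm_integral_le_of_norm_le (((integrable_norm_sq (hf n)).const_mul _).add
            ((integrable_norm_sq (hg n)).const_mul _)) (Eventually.of_forall fun x => ?_)
          have h1 : ‖inner ℝ (f n x) (g n x)‖ ≤ ‖f n x‖ * ‖g n x‖ := norm_inner_le_norm _ _
          have h2 : ‖f n x‖ * ‖g n x‖ ≤ t⁻¹ * ‖f n x‖ ^ 2 + t * ‖g n x‖ ^ 2 := by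
            have h3 : t⁻¹ * ‖f n x‖ ^ 2 + t * ‖g n x‖ ^ 2 - ‖f n x‖ * ‖g n x‖ =
              t⁻¹ * ((‖f n x‖ - t * ‖g n x‖ / 2) ^ 2 + 3 / 4 * (t * ‖g n x‖) ^ 2) := by
              field_simp
              ring
            have h4 : 0 ≤ t⁻¹ * ((‖f n x‖ - t * ‖g n x‖ / 2) ^ 2 + 3 / 4 * (t * ‖g n x‖) ^ 2) := by
              positivity
            linarith
          exact h1.trans h2
      _ = t⁻¹ * (∫ x, ‖f n x‖ ^ 2 ∂μ) + t * ∫ x, ‖g n x‖ ^ 2 ∂μ := by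
          rw [integral_add ((integrable_norm_sq (hf n)).const_mul _)
            ((integrable_norm_sq (hg n)).const_mul _), integral_const_mul, integral_const_mul]
      _ ≤ _ := by gcongr; exact hgA n
  rw [Metric.tendsto_atTop]
  intro e he
  have ht : 0 < e / (2 * (A + 1)) := by positivity
  set t := e / (2 * (A + 1)) with htdef
  have hev := (hf0.const_mul t⁻¹).eventually_lt_const (u := e / 2) (by simpa using he)
  obtain ⟨N, hN⟩ := eventually_atTop.1 hev
  refine ⟨N, fun n hn => ?_⟩
  rw [dist_zero_right]
  have h1 := key n t ht
  have h2 := hN n hn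
  have h3 : t * A ≤ e / 2 := by
    rw [htdef, div_mul_eq_mul_div, div_le_div_iff₀ (by positivity) (by norm_num)]
    nlinarith
  linarith

theorem tendsto_integral_inner [InnerProductSpace ℝ E] {f g : ℕ → X → E} {f' g' : X → E}
    (hf : ∀ n, MemLp (f n) 2 μ) (hg : ∀ n, MemLp (g n) 2 μ) (hf' : MemLp f' 2 μ)
    (hg' : MemLp g' 2 μ)
    (hft : Tendsto (fun n => ∫ x, ‖f n x - f' x‖ ^ 2 ∂μ) atTop (𝓝 0))
    (hgt : Tendsto (fun n => ∫ x, ‖g n x - g' x‖ ^ 2 ∂μ) atTop (𝓝 0)) :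
    Tendsto (fun n => ∫ x, inner ℝ (f n x) (g n x) ∂μ) atTop (𝓝 (∫ x, inner ℝ (f' x) (g' x) ∂μ)) := by
  have hfd : ∀ n, MemLp (fun x => f n x - f' x) 2 μ := fun n => (hf n).sub hf'
  have hgd : ∀ n, MemLp (fun x => g n x - g' x) 2 μ := fun n => (hg n).sub hg'
  obtain ⟨A, hA⟩ := hgt.bddAbove_range
  have h1 := tendsto_integral_inner_zero hfd hgd hft (A := A) fun n => hA ⟨n, rfl⟩
  have h2 := tendsto_integral_inner_zero hfd (fun _ => hg') hft fun _ => le_rfl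
  have h3 := tendsto_integral_inner_zero hgd (fun _ => hf') hgt fun _ => le_rfl
  have h4 := ((h1.add h2).add h3).add (tendsto_const_nhds (x := ∫ x, inner ℝ (f' x) (g' x) ∂μ))
  simp only [zero_add] at h4
  refine h4.congr fun n => ?_
  have i1 := integrable_inner_of_memLp_two (hfd n) (hgd n)
  have i2 := integrable_inner_of_memLp_two (hfd n) hg'
  have i3 := integrable_inner_of_memLp_two (hgd n) hf'
  have i4 := integrable_inner_of_memLp_two hf' hg'
  have e1 := integral_add i1 i2
  have e2 := integral_add (i1.add i2) i3
  have e3 := integral_add ((i1.add i2).add i3) i4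
  simp only [Pi.add_apply] at e2 e3
  rw [← e1, ← e2, ← e3]
  refine integral_congr_ae (Eventually.of_forall fun x => ?_)
  simp only [inner_sub_left, inner_sub_right]
  rw [real_inner_comm (f' x) (g n x), real_inner_comm (f' x) (g' x)]
  ring

end SquareIntegrable

/-! ### Weak derivatives -/

theorem gradient_apply {φ : Plane → ℝ} {x : Plane} (i : Fin 2) :
    gradient φ x i = fderiv ℝ φ x (EuclideanSpace.single i 1) := by
  have h : inner ℝ (gradient φ x) (EuclideanSpace.single i (1 : ℝ)) =
      fderiv ℝ φ x (EuclideanSpace.single i 1) := by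
    rw [gradient, InnerProductSpace.toDual_symm_apply]
  rw [← h, EuclideanSpace.inner_single_right]
  simp

theorem fderiv_eq_inner_gradient {φ : Plane → ℝ} {x : Plane} (v : Plane) :
    fderiv ℝ φ x v = inner ℝ (gradient φ x) v := by
  rw [gradient, InnerProductSpace.toDual_symm_apply]

theorem continuous_gradient {φ : Plane → ℝ} (hφ : ContDiff ℝ 1 φ) :
    Continuous (gradient φ) := by
  have := hφ.continuous_fderiv (by norm_num)
  exact (LinearIsometryEquiv.continuous _).comp this

theorem integrable_mul_of_tsupport_subset {U : Set Plane} {f φ : Plane → ℝ}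
    (hf : LocallyIntegrableOn f U) (hφ : Continuous φ) (hc : HasCompactSupport φ)
    (hs : tsupport φ ⊆ U) : Integrable (fun x => f x * φ x) (volume.restrict U) := by
  have h1 : IntegrableOn f (tsupport φ) := hf.integrableOn_compact_subset hs hc
  have h2 : IntegrableOn (fun x => f x * φ x) (tsupport φ) := by
    obtain ⟨C, hC⟩ := hφ.bounded_above_of_compact_support hc
    exact Integrable.mul_bdd h1 hφ.aestronglyMeasurable (Eventually.of_forall hC)
  have h3 : IntegrableOn (fun x => f x * φ x) U := by
    refine (integrableOn_iff_integrable_of_support_subset (s := tsupport φ) ?_).1 h2 |>.integrableOn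
    intro x hx
    exact subset_tsupport φ (by
      intro h0
      simp [h0] at hx)
  exact h3

theorem HasWeakPartial.ae_unique {U : Set Plane} (hU : IsOpen U) {i : Fin 2}
    {f g g' : Plane → ℝ} (h : HasWeakPartial U i f g) (h' : HasWeakPartial U i f g') :
    g =ᵐ[volume.restrict U] g' := by
  have h1 : ∀ᵐ x ∂(volume : Measure Plane), x ∈ U → (g - g') x = 0 := by
    refine hU.ae_eq_zero_of_integral_contDiff_smul_eq_zero (h.2.1.sub h'.2.1) ?_
    intro φ h1 h2 h3
    have e1 := h.2.2 φ ⟨h1, h2, h3⟩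
    have e2 := h'.2.2 φ ⟨h1, h2, h3⟩
    have e3 : ∫ x in U, g x * φ x = ∫ x in U, g' x * φ x := by linarith
    have i1 := integrable_mul_of_tsupport_subset h.2.1 h1.continuous h2 h3
    have i2 := integrable_mul_of_tsupport_subset h'.2.1 h1.continuous h2 h3
    have e4 : ∫ x in U, φ x • (g - g') x = 0 := by
      rw [← sub_eq_zero.2 e3, ← integral_sub i1 i2]
      congr 1
      ext x
      simp
      ring
    rw [← e4, setIntegral_eq_integral_of_forall_compl_eq_zero]
    intro x hx
    have : φ x = 0 := image_eq_zero_of_notMem_tsupport fun h => hx (h3 h)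
    simp [this]
  rw [EventuallyEq, ae_restrict_iff' hU.measurableSet]
  filter_upwards [h1] with x hx hxU
  have := hx hxU
  simp only [Pi.sub_apply] at this
  linarith

theorem weakPartial_spec {U : Set Plane} {i : Fin 2} {f : Plane → ℝ}
    (h : ∃ g, HasWeakPartial U i f g) : HasWeakPartial U i f (weakPartial U i f) := by
  rw [weakPartial, dif_pos h]
  exact h.choose_spec

theorem IsTest.continuous_fderiv_apply {φ : Plane → ℝ} (h : ContDiff ℝ ∞ φ) (v : Plane) :
    Continuous (fun x => fderiv ℝ φ x v) :=
  (h.continuous_fderiv (by norm_num)).clm_apply continuous_const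

theorem HasWeakPartial.integrable_mul_fderiv {U : Set Plane} {f φ : Plane → ℝ}
    (hf : LocallyIntegrableOn f U) (hφ : IsTest U φ) (v : Plane) :
    Integrable (fun x => f x * fderiv ℝ φ x v) (volume.restrict U) :=
  integrable_mul_of_tsupport_subset hf (IsTest.continuous_fderiv_apply hφ.1 v)
    (hφ.2.1.fderiv_apply ℝ v) ((tsupport_fderiv_apply_subset ℝ v).trans hφ.2.2)

theorem HasWeakPartial.add {U : Set Plane} {i : Fin 2} {f g f' g' : Plane → ℝ}
    (h : HasWeakPartial U i f g) (h' : HasWeakPartial U i f' g') :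
    HasWeakPartial U i (fun x => f x + f' x) (fun x => g x + g' x) := by
  refine ⟨h.1.add h'.1, h.2.1.add h'.2.1, fun φ hφ => ?_⟩
  simp only [add_mul]
  rw [integral_add (integrable_mul_fderiv h.1 hφ _) (integrable_mul_fderiv h'.1 hφ _),
    integral_add (integrable_mul_of_tsupport_subset h.2.1 hφ.1.continuous hφ.2.1 hφ.2.2)
      (integrable_mul_of_tsupport_subset h'.2.1 hφ.1.continuous hφ.2.1 hφ.2.2),
    h.2.2 φ hφ, h'.2.2 φ hφ]
  ring

theorem HasWeakPartial.const_mul {U : Set Plane} {i : Fin 2} {f g : Plane → ℝ} (c : ℝ)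
    (h : HasWeakPartial U i f g) :
    HasWeakPartial U i (fun x => c * f x) (fun x => c * g x) := by
  refine ⟨fun x hx => (h.1 x hx).smul c, fun x hx => (h.2.1 x hx).smul c, fun φ hφ => ?_⟩
  simp only [mul_assoc]
  rw [integral_const_mul, integral_const_mul, h.2.2 φ hφ]
  ring

theorem HasWeakPartial.sub {U : Set Plane} {i : Fin 2} {f g f' g' : Plane → ℝ}
    (h : HasWeakPartial U i f g) (h' : HasWeakPartial U i f' g') :
    HasWeakPartial U i (fun x => f x - f' x) (fun x => g x - g' x) := by
  have := h.add (h'.const_mul (-1))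
  simpa [sub_eq_add_neg] using this

theorem HasWeakPartial.mono {U V : Set Plane} (hVU : V ⊆ U)
    {i : Fin 2} {f g : Plane → ℝ} (h : HasWeakPartial U i f g) : HasWeakPartial V i f g := by
  refine ⟨h.1.mono_set hVU, h.2.1.mono_set hVU, fun φ hφ => ?_⟩
  have e := h.2.2 φ ⟨hφ.1, hφ.2.1, hφ.2.2.trans hVU⟩
  have key : ∀ F : Plane → ℝ, (∀ x, x ∉ tsupport φ → F x = 0) →
      ∫ x in V, F x = ∫ x in U, F x := by
    intro F hF
    rw [setIntegral_eq_integral_of_forall_compl_eq_zero,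
      setIntegral_eq_integral_of_forall_compl_eq_zero]
    · exact fun x hx => hF x fun h => hx (hVU (hφ.2.2 h))
    · exact fun x hx => hF x fun h => hx (hφ.2.2 h)
  rw [key, key, e]
  · intro x hx
    rw [image_eq_zero_of_notMem_tsupport hx, mul_zero]
  · intro x hx
    have : x ∉ tsupport (fun y => fderiv ℝ φ y (EuclideanSpace.single i 1)) :=
      fun h => hx (tsupport_fderiv_apply_subset ℝ _ h)
    rw [image_eq_zero_of_notMem_tsupport this, mul_zero]

/-- `f` belongs to `H¹(U)` with weak gradient `G`. -/
def IsH1 (U : Set Plane) (f : Plane → ℝ) (G : Plane → Plane) : Prop :=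
  MemLp f 2 (volume.restrict U) ∧ MemLp G 2 (volume.restrict U) ∧
    ∀ i, HasWeakPartial U i f (fun x => G x i)

/-- The square of the `H¹` norm of a function `f` with gradient `G`. -/
def energy (U : Set Plane) (f : Plane → ℝ) (G : Plane → Plane) : ℝ :=
  (∫ x in U, f x ^ 2) + ∫ x in U, ‖G x‖ ^ 2

theorem energy_nonneg (U : Set Plane) (f : Plane → ℝ) (G : Plane → Plane) :
    0 ≤ energy U f G :=
  add_nonneg (integral_nonneg fun _ => sq_nonneg _) (integral_nonneg fun _ => sq_nonneg _)

theorem MemH1.isH1 {U : Set Plane} {f : Plane → ℝ} (h : MemH1 U f) : IsH1 U f (weakGrad U f) :=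
  ⟨h.1, MemLp.of_eval_piLp fun i => (h.2 i).2, fun i => weakPartial_spec (h.2 i).1⟩

section H1

variable {U : Set Plane} {f f' : Plane → ℝ} {G G' : Plane → Plane}

theorem IsH1.weakGrad_ae (hU : IsOpen U) (h : IsH1 U f G) :
    weakGrad U f =ᵐ[volume.restrict U] G := by
  have h1 : ∀ i, weakPartial U i f =ᵐ[volume.restrict U] fun x => G x i := fun i =>
    (weakPartial_spec ⟨_, h.2.2 i⟩).ae_unique hU (h.2.2 i)
  filter_upwards [h1 0, h1 1] with x h0 h1
  ext i
  fin_cases i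
  · exact h0
  · exact h1

theorem IsH1.memH1 (hU : IsOpen U) (h : IsH1 U f G) : MemH1 U f := by
  refine ⟨h.1, fun i => ⟨⟨_, h.2.2 i⟩, ?_⟩⟩
  have h1 : weakPartial U i f =ᵐ[volume.restrict U] fun x => G x i :=
    (weakPartial_spec ⟨_, h.2.2 i⟩).ae_unique hU (h.2.2 i)
  exact (memLp_congr_ae h1).2 (h.2.1.eval_piLp i)

theorem IsH1.normH1_eq (hU : IsOpen U) (h : IsH1 U f G) : normH1 U f = √(energy U f G) := by
  rw [normH1, energy]
  congr 2
  refine integral_congr_ae ?_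
  filter_upwards [h.weakGrad_ae hU] with x hx
  rw [hx]

theorem IsH1.add (h : IsH1 U f G) (h' : IsH1 U f' G') :
    IsH1 U (fun x => f x + f' x) (fun x => G x + G' x) :=
  ⟨h.1.add h'.1, h.2.1.add h'.2.1, fun i => (h.2.2 i).add (h'.2.2 i)⟩

theorem IsH1.sub (h : IsH1 U f G) (h' : IsH1 U f' G') :
    IsH1 U (fun x => f x - f' x) (fun x => G x - G' x) :=
  ⟨h.1.sub h'.1, h.2.1.sub h'.2.1, fun i => (h.2.2 i).sub (h'.2.2 i)⟩

theorem IsH1.const_mul (h : IsH1 U f G) (c : ℝ) :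
    IsH1 U (fun x => c * f x) (fun x => c • G x) :=
  ⟨h.1.const_mul c, h.2.1.const_smul c, fun i => (h.2.2 i).const_mul c⟩

theorem IsH1.energy_add_le (h : IsH1 U f G) (h' : IsH1 U f' G') :
    energy U (fun x => f x + f' x) (fun x => G x + G' x) ≤ 2 * energy U f G + 2 * energy U f' G' := by
  have h1 := integral_sq_add_le h.1 h'.1
  have h2 := integral_sq_add_le h.2.1 h'.2.1
  simp only [Real.norm_eq_abs, sq_abs] at h1
  simp only [energy]
  linarith

end H1

theorem memLp_two_of_continuous_of_bounded {U : Set Plane} (hUb : Bornology.IsBounded U)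
    {E : Type*} [NormedAddCommGroup E] [SecondCountableTopology E] [MeasurableSpace E]
    [BorelSpace E] {f : Plane → E} (hf : Continuous f) :
    MemLp f 2 (volume.restrict U) := by
  have hK : IsCompact (closure U) := hUb.isCompact_closure
  obtain ⟨C, hC⟩ := hK.exists_bound_of_continuousOn hf.continuousOn
  have h1 : MemLp f 2 (volume.restrict (closure U)) := by
    have : IsFiniteMeasure (volume.restrict (closure U)) :=
      ⟨by simpa using hK.measure_lt_top⟩
    refine MemLp.of_bound hf.aestronglyMeasurable C ?_
    exact (ae_restrict_iff' isClosed_closure.measurableSet).2 (Eventually.of_forall hC)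
  exact h1.mono_measure (Measure.restrict_mono_set _ subset_closure)

theorem integral_fderiv_mul_test {U : Set Plane} {f φ : Plane → ℝ}
    (hf : ContDiff ℝ 1 f) (hφ : IsTest U φ) (v : Plane) :
    ∫ x in U, f x * fderiv ℝ φ x v = -∫ x in U, fderiv ℝ f x v * φ x := by
  have hf' : Continuous (fun x => fderiv ℝ f x v) :=
    (hf.continuous_fderiv (by norm_num)).clm_apply continuous_const
  have hφ' : Continuous (fun x => fderiv ℝ φ x v) := IsTest.continuous_fderiv_apply hφ.1 v
  have key : ∀ F : Plane → ℝ, (∀ x, x ∉ tsupport φ → F x = 0) → ∫ x in U, F x = ∫ x, F x := by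
    intro F hF
    exact setIntegral_eq_integral_of_forall_compl_eq_zero fun x hx => hF x fun h => hx (hφ.2.2 h)
  rw [key, key]
  · refine integral_mul_fderiv_eq_neg_fderiv_mul_of_integrable ?_ ?_ ?_ ?_ ?_
    · exact (hf'.mul hφ.1.continuous).integrable_of_hasCompactSupport hφ.2.1.mul_left
    · exact (hf.continuous.mul hφ').integrable_of_hasCompactSupport
        (HasCompactSupport.mul_left (hφ.2.1.fderiv_apply ℝ v))
    · exact (hf.continuous.mul hφ.1.continuous).integrable_of_hasCompactSupport hφ.2.1.mul_left
    · exact fun x _ => hf.differentiable (by norm_num) x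
    · exact fun x _ => hφ.1.differentiable (by norm_num) x
  · intro x hx
    rw [image_eq_zero_of_notMem_tsupport hx, mul_zero]
  · intro x hx
    have : x ∉ tsupport (fun y => fderiv ℝ φ y v) :=
      fun h => hx (tsupport_fderiv_apply_subset ℝ _ h)
    rw [image_eq_zero_of_notMem_tsupport this, mul_zero]

theorem hasWeakPartial_of_contDiff {U : Set Plane} {f : Plane → ℝ}
    (hf : ContDiff ℝ 1 f) (i : Fin 2) :
    HasWeakPartial U i f (fun x => gradient f x i) := by
  refine ⟨hf.continuous.locallyIntegrable.locallyIntegrableOn U, ?_, fun φ hφ => ?_⟩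
  · have : Continuous fun x => gradient f x i :=
      (EuclideanSpace.proj i).continuous.comp (continuous_gradient hf)
    exact this.locallyIntegrable.locallyIntegrableOn U
  · simp only [gradient_apply]
    exact integral_fderiv_mul_test hf hφ _

theorem isH1_of_contDiff {U : Set Plane} (hUb : Bornology.IsBounded U)
    {f : Plane → ℝ} (hf : ContDiff ℝ 1 f) : IsH1 U f (gradient f) :=
  ⟨memLp_two_of_continuous_of_bounded hUb hf.continuous,
    memLp_two_of_continuous_of_bounded hUb (continuous_gradient hf),
    hasWeakPartial_of_contDiff hf⟩

theorem MemH10.exists_tendsto {U : Set Plane} (hU : IsOpen U) (hUb : Bornology.IsBounded U)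
    {f : Plane → ℝ} (h : MemH10 U f) :
    ∃ φ : ℕ → Plane → ℝ, (∀ n, IsTest U (φ n)) ∧
      Tendsto (fun n => ∫ x in U, ‖φ n x - f x‖ ^ 2) atTop (𝓝 0) ∧
      Tendsto (fun n => ∫ x in U, ‖gradient (φ n) x - weakGrad U f x‖ ^ 2) atTop (𝓝 0) := by
  obtain ⟨hf, φ, hφ, ht⟩ := h
  have hC1 : ∀ n, ContDiff ℝ 1 (φ n) := fun n => (hφ n).1.of_le (by norm_num)
  have hH : ∀ n, IsH1 U (fun x => f x - φ n x) (fun x => weakGrad U f x - gradient (φ n) x) :=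
    fun n => hf.isH1.sub (isH1_of_contDiff hUb (hC1 n))
  have ht2 := ht.pow 2
  rw [zero_pow two_ne_zero] at ht2
  have ht3 : Tendsto (fun n => energy U (fun x => f x - φ n x)
      (fun x => weakGrad U f x - gradient (φ n) x)) atTop (𝓝 0) := by
    refine ht2.congr fun n => ?_
    rw [(hH n).normH1_eq hU, Real.sq_sqrt (energy_nonneg _ _ _)]
  refine ⟨φ, hφ, ?_, ?_⟩
  · refine squeeze_zero (fun n => integral_nonneg fun _ => sq_nonneg _) (fun n => ?_) ht3
    rw [energy]
    have : ∫ x in U, ‖φ n x - f x‖ ^ 2 = ∫ x in U, (f x - φ n x) ^ 2 := by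
      congr 1
      ext x
      rw [Real.norm_eq_abs, sq_abs]
      ring
    rw [this]
    have h0 : 0 ≤ ∫ x in U, ‖weakGrad U f x - gradient (φ n) x‖ ^ 2 :=
      integral_nonneg fun _ => sq_nonneg _
    linarith
  · refine squeeze_zero (fun n => integral_nonneg fun _ => sq_nonneg _) (fun n => ?_) ht3
    rw [energy]
    simp only [norm_sub_rev (gradient (φ n) _)]
    have h0 : 0 ≤ ∫ x in U, (f x - φ n x) ^ 2 := integral_nonneg fun _ => sq_nonneg _
    linarith

/-! ### Averages over dilated neighbourhoods -/

theorem sq_lintegral_le {X : Type*} [MeasurableSpace X] (μ : Measure X) {g : X → ENNReal}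
    (hg : AEMeasurable g μ) : (∫⁻ x, g x ∂μ) ^ 2 ≤ μ univ * ∫⁻ x, g x ^ 2 ∂μ := by
  have h := ENNReal.lintegral_mul_le_Lp_mul_Lq μ Real.HolderConjugate.two_two hg
    (aemeasurable_const (b := (1 : ENNReal)))
  simp only [Pi.mul_apply, mul_one, ENNReal.one_rpow, lintegral_const, one_mul] at h
  calc (∫⁻ x, g x ∂μ) ^ 2
      ≤ ((∫⁻ x, g x ^ (2 : ℝ) ∂μ) ^ (1 / 2 : ℝ) * μ univ ^ (1 / 2 : ℝ)) ^ 2 := by gcongr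
    _ = μ univ * ∫⁻ x, g x ^ 2 ∂μ := by
        rw [mul_pow, ← ENNReal.rpow_natCast, ← ENNReal.rpow_natCast, ← ENNReal.rpow_mul,
          ← ENNReal.rpow_mul, mul_comm]
        norm_num

/-- A smooth probability density on the plane that vanishes outside the ball of radius `R`. -/
structure IsKernel (k : Plane → ℝ) (R : ℝ) : Prop where
  contDiff : ContDiff ℝ ∞ k
  nonneg : ∀ t, 0 ≤ k t
  integral_eq : ∫ t, k t = 1
  compact : HasCompactSupport k
  norm_le : ∀ t, k t ≠ 0 → ‖t‖ ≤ R

/-- The average of `f` with weight `k` around the dilated point `s • x`. -/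
def avg (k : Plane → ℝ) (s : ℝ) (f : Plane → ℝ) (x : Plane) : ℝ := ∫ v, k (s • x - v) * f v

section Kernel

variable {k : Plane → ℝ} {R s : ℝ}

theorem IsKernel.integrable_mul (hk : IsKernel k R) {f : Plane → ℝ} (hf : LocallyIntegrable f)
    (z : Plane) : Integrable (fun v => k (z - v) * f v) := by
  have h1 : Continuous fun v => k (z - v) := hk.contDiff.continuous.comp (by fun_prop)
  have h2 : HasCompactSupport fun v => k (z - v) :=
    hk.compact.comp_homeomorph (Homeomorph.subLeft z)
  exact hf.integrable_smul_left_of_hasCompactSupport h1 h2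

theorem IsKernel.integrable (hk : IsKernel k R) : Integrable k :=
  hk.contDiff.continuous.integrable_of_hasCompactSupport hk.compact

theorem IsKernel.lintegral_eq (hk : IsKernel k R) : ∫⁻ t, ENNReal.ofReal (k t) = 1 := by
  rw [← ofReal_integral_eq_lintegral_ofReal hk.integrable (Eventually.of_forall hk.nonneg),
    hk.integral_eq, ENNReal.ofReal_one]

theorem avg_sub (hk : IsKernel k R) {f g : Plane → ℝ} (hf : LocallyIntegrable f)
    (hg : LocallyIntegrable g) (x : Plane) :
    avg k s (fun v => f v - g v) x = avg k s f x - avg k s g x := by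
  simp only [avg, mul_sub]
  exact integral_sub (hk.integrable_mul hf _) (hk.integrable_mul hg _)

theorem lintegral_comp_smul_sub (F : Plane → ENNReal) (hF : Measurable F) (hs : s ≠ 0)
    (v : Plane) :
    ∫⁻ x : Plane, F (s • x - v) = ENNReal.ofReal ((s ^ 2)⁻¹) * ∫⁻ x, F x := by
  have h1 : ∫⁻ x : Plane, F (s • x - v) = ∫⁻ y, F (y - v) ∂(Measure.map (fun x => s • x) volume) := by
    rw [lintegral_map (f := fun y => F (y - v)) (hF.comp (measurable_id.sub_const v))
      (measurable_const_smul s)]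
  rw [h1, Measure.map_addHaar_smul volume hs, lintegral_smul_measure, lintegral_sub_right_eq_self]
  simp [abs_of_nonneg (sq_nonneg s)]

theorem lintegral_avg_sq_le (hk : IsKernel k R) (hs : s ≠ 0) {f : Plane → ℝ}
    (hf : AEStronglyMeasurable f) :
    ∫⁻ x, ‖avg k s f x‖ₑ ^ 2 ≤ ENNReal.ofReal ((s ^ 2)⁻¹) * ∫⁻ x, ‖f x‖ₑ ^ 2 := by
  have hkm : Measurable k := hk.contDiff.continuous.measurable
  have hkx : ∀ z : Plane, Measurable fun v => ENNReal.ofReal (k (z - v)) := fun z =>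
    (hkm.comp (measurable_const.sub measurable_id)).ennreal_ofReal
  have h1 : ∀ x, ‖avg k s f x‖ₑ ^ 2 ≤ ∫⁻ v, ENNReal.ofReal (k (s • x - v)) * ‖f v‖ₑ ^ 2 := by
    intro x
    have e1 : ‖avg k s f x‖ₑ ≤ ∫⁻ v, ENNReal.ofReal (k (s • x - v)) * ‖f v‖ₑ := by
      refine (enorm_integral_le_lintegral_enorm _).trans_eq ?_
      congr 1
      ext v
      rw [enorm_mul, Real.enorm_of_nonneg (hk.nonneg _)]
    have e2 := sq_lintegral_le (volume.withDensity fun v => ENNReal.ofReal (k (s • x - v)))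
      (g := fun v => ‖f v‖ₑ) (hf.enorm.mono_ac (withDensity_absolutelyContinuous _ _))
    rw [lintegral_withDensity_eq_lintegral_mul₀ (hkx _).aemeasurable hf.enorm,
      lintegral_withDensity_eq_lintegral_mul₀ (hkx _).aemeasurable (hf.enorm.pow_const 2),
      withDensity_apply _ MeasurableSet.univ, Measure.restrict_univ,
      lintegral_sub_left_eq_self (fun v => ENNReal.ofReal (k v)), hk.lintegral_eq, one_mul] at e2
    simp only [Pi.mul_apply] at e2
    exact (by gcongr : ‖avg k s f x‖ₑ ^ 2 ≤ _).trans e2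
  calc ∫⁻ x, ‖avg k s f x‖ₑ ^ 2
      ≤ ∫⁻ x, ∫⁻ v, ENNReal.ofReal (k (s • x - v)) * ‖f v‖ₑ ^ 2 := lintegral_mono h1
    _ = ∫⁻ v, ∫⁻ x, ENNReal.ofReal (k (s • x - v)) * ‖f v‖ₑ ^ 2 := by
        have m1 : AEMeasurable (fun p : Plane × Plane => ENNReal.ofReal (k (s • p.1 - p.2)))
            (volume.prod volume) :=
          (hkm.comp (by fun_prop : Measurable fun p : Plane × Plane =>
            s • p.1 - p.2)).ennreal_ofReal.aemeasurable
        have m2 : AEMeasurable (fun p : Plane × Plane => ‖f p.2‖ₑ ^ 2) (volume.prod volume) :=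
          (hf.enorm.pow_const 2).comp_quasiMeasurePreserving Measure.quasiMeasurePreserving_snd
        exact lintegral_lintegral_swap (m1.mul m2)
    _ = ∫⁻ v, ENNReal.ofReal ((s ^ 2)⁻¹) * ‖f v‖ₑ ^ 2 := by
        congr 1
        ext v
        rw [lintegral_mul_const' _ _ (by simp),
          lintegral_comp_smul_sub (fun t => ENNReal.ofReal (k t)) hkm.ennreal_ofReal hs v,
          hk.lintegral_eq, mul_one]
    _ = _ := lintegral_const_mul' _ _ (by simp)

theorem eLpNorm_two_sq {X : Type*} [MeasurableSpace X] (μ : Measure X) (f : X → ℝ) :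
    eLpNorm f 2 μ ^ 2 = ∫⁻ x, ‖f x‖ₑ ^ 2 ∂μ := by
  have := eLpNorm_nnreal_pow_eq_lintegral (f := f) (μ := μ) (p := 2) (by norm_num)
  simpa using this

theorem avg_eq_convolution (k : Plane → ℝ) (s : ℝ) (f : Plane → ℝ) :
    avg k s f = fun x => convolution k f (ContinuousLinearMap.mul ℝ ℝ) volume (s • x) := by
  ext x
  rw [convolution_eq_swap]
  rfl

theorem contDiff_avg (hk : IsKernel k R) {f : Plane → ℝ} (hf : LocallyIntegrable f) :
    ContDiff ℝ ∞ (avg k s f) := by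
  rw [avg_eq_convolution]
  exact (hk.compact.contDiff_convolution_left _ hk.contDiff hf).comp (contDiff_const_smul s)

theorem eLpNorm_avg_le (hk : IsKernel k R) (hs : 1 / 2 ≤ s) {f : Plane → ℝ}
    (hf : AEStronglyMeasurable f) : eLpNorm (avg k s f) 2 volume ≤ 2 * eLpNorm f 2 volume := by
  have h1 := lintegral_avg_sq_le (s := s) hk (by linarith) hf
  rw [← eLpNorm_two_sq, ← eLpNorm_two_sq] at h1
  have h2 : ENNReal.ofReal ((s ^ 2)⁻¹) ≤ 2 ^ 2 := by
    have : (s ^ 2)⁻¹ ≤ 4 := by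
      rw [inv_le_comm₀ (by positivity) (by norm_num)]
      nlinarith
    refine (ENNReal.ofReal_le_ofReal this).trans ?_
    norm_num
  have h3 : eLpNorm (avg k s f) 2 volume ^ 2 ≤ (2 * eLpNorm f 2 volume) ^ 2 := by
    rw [mul_pow]
    exact h1.trans (by gcongr)
  exact (ENNReal.pow_le_pow_left_iff two_ne_zero).1 h3

theorem avg_eq_integral_mul_sub (hk : IsKernel k R) {f : Plane → ℝ} (hf : LocallyIntegrable f)
    (x : Plane) : avg k s f x - f x = ∫ v, k (s • x - v) * (f v - f x) := by
  simp only [mul_sub]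
  rw [integral_sub (hk.integrable_mul hf _) (hk.integrable_mul (locallyIntegrable_const _) _),
    integral_mul_const, integral_sub_left_eq_self k, hk.integral_eq, one_mul, avg]

theorem abs_avg_sub_le (hk : IsKernel k R) {f : Plane → ℝ} (hf : LocallyIntegrable f)
    {x : Plane} {e : ℝ} (he : ∀ v, ‖s • x - v‖ ≤ R → |f v - f x| ≤ e) :
    |avg k s f x - f x| ≤ e := by
  rw [avg_eq_integral_mul_sub hk hf]
  have h1 : Integrable fun v => k (s • x - v) * e :=
    hk.integrable_mul (locallyIntegrable_const e) _
  rw [← Real.norm_eq_abs]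
  refine (norm_integral_le_of_norm_le h1 (Eventually.of_forall fun v => ?_)).trans_eq ?_
  · rw [norm_mul, Real.norm_of_nonneg (hk.nonneg _)]
    by_cases h0 : k (s • x - v) = 0
    · simp [h0]
    · exact mul_le_mul_of_nonneg_left (he v (hk.norm_le _ h0)) (hk.nonneg _)
  · rw [integral_mul_const, integral_sub_left_eq_self k, hk.integral_eq, one_mul]

end Kernel

theorem tendsto_eLpNorm_avg_sub_of_continuous {k : ℕ → Plane → ℝ} {R s : ℕ → ℝ}
    (hk : ∀ n, IsKernel (k n) (R n)) (hR : Tendsto R atTop (𝓝 0)) (hs : Tendsto s atTop (𝓝 1))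
    {g : Plane → ℝ} (hg : Continuous g) (hgc : HasCompactSupport g) :
    Tendsto (fun n => eLpNorm (avg (k n) (s n) g - g) 2 volume) atTop (𝓝 0) := by
  obtain ⟨r, hr0, hr⟩ : ∃ r : ℝ, 0 < r ∧ ∀ x, g x ≠ 0 → ‖x‖ ≤ r := by
    obtain ⟨r, hr⟩ := hgc.isBounded.subset_closedBall 0
    refine ⟨max r 1, by positivity, fun x hx => ?_⟩
    have := hr (subset_tsupport g hx)
    rw [mem_closedBall_zero_iff] at this
    exact this.trans (le_max_left _ _)
  set B : Set Plane := Metric.closedBall 0 (2 * (r + 1)) with hB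
  have hBfin : volume B ≠ ⊤ := (isCompact_closedBall _ _).measure_lt_top.ne
  have hloc : LocallyIntegrable g := hg.locallyIntegrable
  have key : ∀ e : ℝ, 0 < e → ∀ᶠ n in atTop,
      eLpNorm (avg (k n) (s n) g - g) 2 volume ≤ volume B ^ (1 / 2 : ℝ) * ENNReal.ofReal e := by
    intro e he
    obtain ⟨d, hd, hgd⟩ := Metric.uniformContinuous_iff.1
      (hgc.uniformContinuous_of_continuous hg) e he
    have hd' : 0 < d / (4 * (r + 1)) := by positivity
    have hm : 0 < min (d / (4 * (r + 1))) (1 / 2) := by positivity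
    filter_upwards [hR.eventually_lt_const (u := min (d / 2) 1) (by positivity),
      (Metric.tendsto_nhds.1 hs) _ hm] with n hn1 hn2
    have hR1 := hn1.trans_le (min_le_left _ _)
    have hR2 := hn1.trans_le (min_le_right _ _)
    rw [Real.dist_eq] at hn2
    have hs1 := hn2.trans_le (min_le_left _ _)
    have hs2 := hn2.trans_le (min_le_right _ _)
    rw [abs_lt] at hs2
    have hpt : ∀ x, ‖avg (k n) (s n) g x - g x‖ ≤ e := by
      intro x
      by_cases hx : x ∈ B
      · refine abs_avg_sub_le (hk n) hloc fun v hv => ?_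
        rw [← Real.dist_eq]
        refine (hgd ?_).le
        rw [hB, mem_closedBall_zero_iff] at hx
        have e1 : v - x = (s n - 1) • x - (s n • x - v) := by
          rw [sub_smul, one_smul]
          abel
        rw [dist_eq_norm, e1]
        refine (norm_sub_le _ _).trans_lt ?_
        rw [norm_smul, Real.norm_eq_abs]
        have : |s n - 1| * ‖x‖ ≤ d / (4 * (r + 1)) * (2 * (r + 1)) := by gcongr
        have e2 : d / (4 * (r + 1)) * (2 * (r + 1)) = d / 2 := by
          field_simp
          ring
        linarith
      · have hx' : 2 * (r + 1) < ‖x‖ := by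
          rw [hB, mem_closedBall_zero_iff] at hx
          linarith
        have h0 : g x = 0 := by
          by_contra h
          have := hr x h
          linarith
        refine abs_avg_sub_le (hk n) hloc fun v hv => ?_
        have : g v = 0 := by
          by_contra h
          have h1 := hr v h
          have h2 : ‖s n • x‖ ≤ ‖s n • x - v‖ + ‖v‖ := by
            have := norm_add_le (s n • x - v) v
            simpa using this
          rw [norm_smul, Real.norm_of_nonneg (by linarith)] at h2
          nlinarith
        rw [this, h0]
        simpa using he.le
    have hsupp : ∀ x, x ∉ B → (avg (k n) (s n) g - g) x = 0 := by
      intro x hx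
      have hx' : 2 * (r + 1) < ‖x‖ := by
        rw [hB, mem_closedBall_zero_iff] at hx
        linarith
      have h0 : g x = 0 := by
        by_contra h
        have := hr x h
        linarith
      have : |avg (k n) (s n) g x - g x| ≤ 0 := by
        refine abs_avg_sub_le (hk n) hloc fun v hv => ?_
        have : g v = 0 := by
          by_contra h
          have h1 := hr v h
          have h2 : ‖s n • x‖ ≤ ‖s n • x - v‖ + ‖v‖ := by
            have := norm_add_le (s n • x - v) v
            simpa using this
          rw [norm_smul, Real.norm_of_nonneg (by linarith)] at h2
          nlinarith
        rw [this, h0]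
        simp
      exact abs_nonpos_iff.1 this
    have e1 : eLpNorm (avg (k n) (s n) g - g) 2 volume =
        eLpNorm (avg (k n) (s n) g - g) 2 (volume.restrict B) := by
      rw [← eLpNorm_indicator_eq_eLpNorm_restrict Metric.isClosed_closedBall.measurableSet]
      congr 1
      symm
      rw [indicator_eq_self]
      intro x hx
      by_contra h
      exact hx (hsupp x h)
    rw [e1]
    refine (eLpNorm_le_of_ae_bound (Eventually.of_forall hpt)).trans_eq ?_
    simp
  rw [ENNReal.tendsto_nhds_zero]
  intro e he
  by_cases hetop : e = ⊤
  · simp [hetop]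
  have hVfin : volume B ^ (1 / 2 : ℝ) ≠ ⊤ := ENNReal.rpow_ne_top_of_nonneg (by norm_num) hBfin
  obtain ⟨e', he', hle⟩ : ∃ e' : ℝ, 0 < e' ∧ volume B ^ (1 / 2 : ℝ) * ENNReal.ofReal e' ≤ e := by
    set W := (volume B ^ (1 / 2 : ℝ)).toReal with hW
    have hW0 : 0 ≤ W := ENNReal.toReal_nonneg
    have her : 0 < e.toReal := ENNReal.toReal_pos he.ne' hetop
    refine ⟨e.toReal / (W + 1), by positivity, ?_⟩
    rw [← ENNReal.ofReal_toReal hVfin, ← hW, ← ENNReal.ofReal_mul hW0]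
    refine (ENNReal.ofReal_le_ofReal (?_ : _ ≤ e.toReal)).trans_eq (ENNReal.ofReal_toReal hetop)
    rw [mul_div_assoc', div_le_iff₀ (by positivity)]
    nlinarith
  filter_upwards [key e' he'] with n hn
  exact hn.trans hle

/-- Averages at vanishing scale converge in `L²`, by the density of continuous functions. -/
theorem tendsto_eLpNorm_avg_sub {k : ℕ → Plane → ℝ} {R s : ℕ → ℝ}
    (hk : ∀ n, IsKernel (k n) (R n)) (hR : Tendsto R atTop (𝓝 0)) (hs : Tendsto s atTop (𝓝 1))
    {f : Plane → ℝ} (hf : MemLp f 2 volume) :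
    Tendsto (fun n => eLpNorm (avg (k n) (s n) f - f) 2 volume) atTop (𝓝 0) := by
  rw [ENNReal.tendsto_nhds_zero]
  intro e he
  obtain ⟨g, hgc, hfg, hg, hgL⟩ := hf.exists_hasCompactSupport_eLpNorm_sub_le (p := 2)
    (by norm_num) (ε := e / 4) (ENNReal.div_pos he.ne' (by norm_num)).ne'
  have h1 := tendsto_eLpNorm_avg_sub_of_continuous hk hR hs hg hgc
  rw [ENNReal.tendsto_nhds_zero] at h1
  filter_upwards [h1 (e / 4) (ENNReal.div_pos he.ne' (by norm_num)),
    hs.eventually_const_le (u := (1 / 2 : ℝ)) (by norm_num)] with n hn hsn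
  have hfl := hf.locallyIntegrable (by norm_num)
  have hgl : LocallyIntegrable g := hg.locallyIntegrable
  have e1 : avg (k n) (s n) f - f =
      avg (k n) (s n) (f - g) + (avg (k n) (s n) g - g) + (g - f) := by
    ext x
    have := avg_sub (s := s n) (hk n) hfl hgl x
    simp only [Pi.sub_apply, Pi.add_apply]
    change _ = avg (k n) (s n) (fun v => f v - g v) x + _ + _
    rw [this]
    ring
  have m1 : AEStronglyMeasurable (avg (k n) (s n) (f - g)) volume :=
    (contDiff_avg (hk n) (hfl.sub hgl)).continuous.aestronglyMeasurable
  have m2 : AEStronglyMeasurable (avg (k n) (s n) g - g) volume :=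
    ((contDiff_avg (hk n) hgl).continuous.sub hg).aestronglyMeasurable
  have m3 : AEStronglyMeasurable (g - f) volume := hgL.1.sub hf.1
  rw [e1]
  calc _ ≤ eLpNorm (avg (k n) (s n) (f - g) + (avg (k n) (s n) g - g)) 2 volume
        + eLpNorm (g - f) 2 volume := eLpNorm_add_le (m1.add m2) m3 (by norm_num)
    _ ≤ eLpNorm (avg (k n) (s n) (f - g)) 2 volume + eLpNorm (avg (k n) (s n) g - g) 2 volume
        + eLpNorm (g - f) 2 volume := by
          gcongr
          exact eLpNorm_add_le m1 m2 (by norm_num)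
    _ ≤ 2 * (e / 4) + e / 4 + e / 4 := by
          gcongr
          · refine (eLpNorm_avg_le (hk n) hsn (hf.1.sub hgL.1)).trans ?_
            gcongr
          · rw [eLpNorm_sub_comm]
            exact hfg
    _ = 4 * (e / 4) := by ring
    _ = e := ENNReal.mul_div_cancel (by norm_num) (by norm_num)

theorem fderiv_avg {k : Plane → ℝ} {R s : ℝ} (hk : IsKernel k R) {f : Plane → ℝ}
    (hf : LocallyIntegrable f) (x e : Plane) :
    fderiv ℝ (avg k s f) x e = s * ∫ v, fderiv ℝ k (s • x - v) e * f v := by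
  rw [avg_eq_convolution]
  have h1 := hk.compact.hasFDerivAt_convolution_left (μ := volume) (ContinuousLinearMap.mul ℝ ℝ)
    (hk.contDiff.of_le (by norm_num)) hf (s • x)
  have h2 : HasFDerivAt (fun x : Plane => s • x) (s • ContinuousLinearMap.id ℝ Plane) x :=
    (hasFDerivAt_id x).const_smul s
  have h3 := (h1.comp x h2).fderiv
  have h4 : ((convolution (fderiv ℝ k) f (ContinuousLinearMap.precompL Plane
      (ContinuousLinearMap.mul ℝ ℝ)) volume) (s • x)) e = ∫ v, fderiv ℝ k (s • x - v) e * f v := by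
    rw [convolution_eq_swap, ContinuousLinearMap.integral_apply]
    · rfl
    · have hc : Continuous (fun v => fderiv ℝ k (s • x - v)) :=
        (hk.contDiff.continuous_fderiv (by norm_num)).comp (by fun_prop)
      have hcs : HasCompactSupport (fun v => fderiv ℝ k (s • x - v)) :=
        (hk.compact.fderiv ℝ).comp_homeomorph (Homeomorph.subLeft (s • x))
      have := (hk.compact.fderiv ℝ).convolutionExists_left (μ := volume)
        (ContinuousLinearMap.precompL Plane (ContinuousLinearMap.mul ℝ ℝ))
        (hk.contDiff.continuous_fderiv (by norm_num)) hf (s • x)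
      exact this.integrable_swap
  have h5 : (fun x => convolution k f (ContinuousLinearMap.mul ℝ ℝ) volume (s • x)) =
      (convolution k f (ContinuousLinearMap.mul ℝ ℝ) volume) ∘ fun x => s • x := rfl
  rw [h5, h3]
  simp only [ContinuousLinearMap.comp_apply, _root_.smul_apply,
    ContinuousLinearMap.id_apply, map_smul, smul_eq_mul]
  rw [h4]

/-- Averages of a function differentiate to averages of its weak derivative, wherever the
average only sees points of the open set on which the weak derivative lives. -/
theorem fderiv_avg_indicator {k : Plane → ℝ} {R s : ℝ} (hk : IsKernel k R) {U : Set Plane}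
    (hU : IsOpen U) {f g : Plane → ℝ} {i : Fin 2} (h : HasWeakPartial U i f g)
    (hf : LocallyIntegrable (U.indicator f)) {x : Plane}
    (hx : ∀ v, s • x - v ∈ tsupport k → v ∈ U) :
    fderiv ℝ (avg k s (U.indicator f)) x (EuclideanSpace.single i 1) =
      s * avg k s (U.indicator g) x := by
  have hd : Differentiable ℝ k := hk.contDiff.differentiable (by norm_num)
  have htest : IsTest U fun v => k (s • x - v) := by
    refine ⟨hk.contDiff.comp (contDiff_const.sub contDiff_id),
      hk.compact.comp_homeomorph (Homeomorph.subLeft (s • x)), fun v hv => hx v ?_⟩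
    exact tsupport_comp_subset_preimage k (f := fun v => s • x - v) (by fun_prop) hv
  have hw := h.2.2 _ htest
  have hder : ∀ v, fderiv ℝ (fun v => k (s • x - v)) v (EuclideanSpace.single i 1) =
      -fderiv ℝ k (s • x - v) (EuclideanSpace.single i 1) := by
    intro v
    have h1 : HasFDerivAt (fun v : Plane => s • x - v) (-ContinuousLinearMap.id ℝ Plane) v :=
      (hasFDerivAt_id v).const_sub (s • x)
    have h2 := ((hd (s • x - v)).hasFDerivAt.comp v h1).fderiv
    have h3 : (fun v => k (s • x - v)) = k ∘ fun v => s • x - v := rfl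
    rw [h3, h2]
    simp
  have e1 : ∀ F G : Plane → ℝ, ∫ v, F v * U.indicator G v = ∫ v in U, G v * F v := by
    intro F G
    rw [← integral_indicator hU.measurableSet]
    congr 1
    ext v
    by_cases hv : v ∈ U <;> simp [hv, mul_comm]
  rw [fderiv_avg hk hf, avg, e1, e1]
  simp only [hder, mul_neg, integral_neg, neg_inj] at hw
  rw [hw]

/-- Near the scale `s`, a kernel around `(s - 1) x₀` of radius proportional to `|1 - s|`: its
averages at `s • x` see the points `s x + (1 - s) w` with `w` in the ball around `x₀`. -/
theorem exists_isKernel (x₀ : Plane) {r₀ : ℝ} (hr₀ : 0 < r₀) {s : ℝ} (hs : s ≠ 1) :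
    ∃ k : Plane → ℝ, IsKernel k (|1 - s| * (‖x₀‖ + r₀)) ∧
      ∀ z v : Plane, z - v ∈ tsupport k → ∃ w ∈ Metric.closedBall x₀ r₀, v = z + (1 - s) • w := by
  have h0 : 0 < |1 - s| := abs_pos.2 (sub_ne_zero.2 hs.symm)
  let b : ContDiffBump ((s - 1) • x₀) :=
    ⟨|1 - s| * r₀ / 2, |1 - s| * r₀, by positivity, by
      have : 0 < |1 - s| * r₀ := by positivity
      linarith⟩
  have hts : tsupport (b.normed volume) = Metric.closedBall ((s - 1) • x₀) (|1 - s| * r₀) :=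
    b.tsupport_normed_eq
  refine ⟨b.normed volume, ⟨b.contDiff_normed, b.nonneg_normed, b.integral_normed,
    b.hasCompactSupport_normed, fun t ht => ?_⟩, fun z v hv => ?_⟩
  · have := subset_tsupport _ ht
    rw [hts, Metric.mem_closedBall, dist_eq_norm] at this
    have h1 : ‖t‖ ≤ ‖t - (s - 1) • x₀‖ + ‖(s - 1) • x₀‖ := by
      have := norm_add_le (t - (s - 1) • x₀) ((s - 1) • x₀)
      simpa using this
    rw [norm_smul, Real.norm_eq_abs, abs_sub_comm] at h1
    linarith
  · rw [hts, Metric.mem_closedBall, dist_eq_norm] at hv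
    have h1 : (1 - s) ≠ 0 := sub_ne_zero.2 hs.symm
    refine ⟨(1 - s)⁻¹ • (v - z), ?_, ?_⟩
    · rw [Metric.mem_closedBall, dist_eq_norm]
      have e1 : (1 - s)⁻¹ • (v - z) - x₀ = (-(1 - s)⁻¹) • (z - v - (s - 1) • x₀) := by
        have : x₀ = (1 - s)⁻¹ • (1 - s) • x₀ := by rw [smul_smul, inv_mul_cancel₀ h1, one_smul]
        nth_rw 1 [this]
        rw [← smul_sub, neg_smul, ← smul_neg]
        congr 1
        module
      rw [e1, norm_smul, norm_neg, norm_inv, Real.norm_eq_abs]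
      rw [inv_mul_le_iff₀ h0]
      exact hv
    · rw [smul_smul, mul_inv_cancel₀ h1, one_smul]
      abel

/-! ### Smooth approximation, Lipschitz representatives and `H¹₀` -/

/-- The classical partial derivative. -/
def pd (i : Fin 2) (φ : Plane → ℝ) (x : Plane) : ℝ := fderiv ℝ φ x (EuclideanSpace.single i 1)

theorem contDiff_pd {φ : Plane → ℝ} (hφ : ContDiff ℝ ∞ φ) (i : Fin 2) : ContDiff ℝ ∞ (pd i φ) :=
  (hφ.fderiv_right (m := ∞) (by norm_num)).clm_apply contDiff_const

theorem tendsto_eLpNorm_const_mul_sub {X : Type*} [MeasurableSpace X] {μ : Measure X}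
    {F : ℕ → X → ℝ} {f : X → ℝ} {c : ℕ → ℝ} (hF : ∀ n, AEStronglyMeasurable (F n) μ)
    (hf : MemLp f 2 μ) (hc : Tendsto c atTop (𝓝 1))
    (h : Tendsto (fun n => eLpNorm (fun x => F n x - f x) 2 μ) atTop (𝓝 0)) :
    Tendsto (fun n => eLpNorm (fun x => c n * F n x - f x) 2 μ) atTop (𝓝 0) := by
  have h1 : ∀ n, eLpNorm (fun x => c n * F n x - f x) 2 μ ≤
      ‖c n‖ₑ * eLpNorm (fun x => F n x - f x) 2 μ + ‖c n - 1‖ₑ * eLpNorm f 2 μ := by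
    intro n
    have e1 : (fun x => c n * F n x - f x) =
        (c n • fun x => F n x - f x) + (c n - 1) • f := by
      ext x
      simp only [Pi.add_apply, Pi.smul_apply, smul_eq_mul]
      ring
    rw [e1]
    refine (eLpNorm_add_le (((hF n).sub hf.1).const_smul _) (hf.1.const_smul _)
      (by norm_num)).trans ?_
    rw [eLpNorm_const_smul, eLpNorm_const_smul]
    exact le_rfl
  have h2 : Tendsto (fun n => ‖c n‖ₑ * eLpNorm (fun x => F n x - f x) 2 μ +
      ‖c n - 1‖ₑ * eLpNorm f 2 μ) atTop (𝓝 (‖(1 : ℝ)‖ₑ * 0 + ‖(1 : ℝ) - 1‖ₑ * eLpNorm f 2 μ)) := by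
    refine Tendsto.add (ENNReal.Tendsto.mul hc.enorm (Or.inr (by simp)) h (Or.inr (by simp))) ?_
    exact ENNReal.Tendsto.mul_const (hc.sub_const 1).enorm (Or.inr hf.2.ne)
  rw [sub_self, enorm_zero, zero_mul, mul_zero, zero_add] at h2
  exact tendsto_of_tendsto_of_tendsto_of_le_of_le tendsto_const_nhds h2 (fun _ => zero_le) h1

/-- On a convex open set there are averaging kernels, at scales tending to `1` from below, whose
averages only see points of that set. -/
theorem exists_kernels_of_convex {U : Set Plane} (hU : IsOpen U) (hc : Convex ℝ U)
    (hne : U.Nonempty) :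
    ∃ (k : ℕ → Plane → ℝ) (R s : ℕ → ℝ), (∀ n, IsKernel (k n) (R n)) ∧
      Tendsto R atTop (𝓝 0) ∧ Tendsto s atTop (𝓝 1) ∧ (∀ n, 0 ≤ s n ∧ s n ≤ 1) ∧
      ∀ n, ∀ x ∈ U, ∀ v, s n • x - v ∈ tsupport (k n) → v ∈ U := by
  obtain ⟨x₀, hx₀⟩ := hne
  obtain ⟨r₀, hr₀, hball⟩ := Metric.nhds_basis_closedBall.mem_iff.1 (hU.mem_nhds hx₀)
  set s : ℕ → ℝ := fun n => 1 - 1 / ((n : ℝ) + 1) with hs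
  have hs1 : ∀ n, s n ≠ 1 := fun n => by
    have : (0 : ℝ) < 1 / ((n : ℝ) + 1) := Nat.one_div_pos_of_nat
    simp only [hs]
    linarith
  have hst : Tendsto s atTop (𝓝 1) := by
    have := (tendsto_const_nhds (x := (1 : ℝ))).sub
      (tendsto_one_div_add_atTop_nhds_zero_nat (𝕜 := ℝ))
    simpa [hs] using this
  have hs01 : ∀ n, 0 ≤ s n ∧ s n ≤ 1 := fun n => by
    have h1 : (0 : ℝ) < 1 / ((n : ℝ) + 1) := Nat.one_div_pos_of_nat
    have h2 : 1 / ((n : ℝ) + 1) ≤ 1 := by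
      rw [div_le_one (by positivity)]
      linarith [n.cast_nonneg (α := ℝ)]
    simp only [hs]
    constructor <;> linarith
  choose k hk hkv using fun n => exists_isKernel x₀ hr₀ (hs1 n)
  refine ⟨k, _, s, hk, ?_, hst, hs01, fun n x hx v hv => ?_⟩
  · have : Tendsto (fun n => |1 - s n| * (‖x₀‖ + r₀)) atTop (𝓝 (|1 - 1| * (‖x₀‖ + r₀))) :=
      ((tendsto_const_nhds.sub hst).abs).mul_const _
    simpa using this
  · obtain ⟨w, hw, rfl⟩ := hkv n _ _ hv
    exact hc hx (hball hw) (hs01 n).1 (by linarith [(hs01 n).2]) (by ring)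

section Convex

variable {U : Set Plane}

theorem memLp_indicator (hU : IsOpen U) {f : Plane → ℝ} (hf : MemLp f 2 (volume.restrict U)) :
    MemLp (U.indicator f) 2 volume :=
  (memLp_indicator_iff_restrict hU.measurableSet).2 hf

theorem tendsto_eLpNorm_avg_indicator_sub (hU : IsOpen U) {k : ℕ → Plane → ℝ} {R s : ℕ → ℝ}
    (hk : ∀ n, IsKernel (k n) (R n)) (hR : Tendsto R atTop (𝓝 0)) (hs : Tendsto s atTop (𝓝 1))
    {f : Plane → ℝ} (hf : MemLp f 2 (volume.restrict U)) :
    Tendsto (fun n => eLpNorm (fun x => avg (k n) (s n) (U.indicator f) x - f x) 2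
      (volume.restrict U)) atTop (𝓝 0) := by
  have h1 := tendsto_eLpNorm_avg_sub hk hR hs (memLp_indicator hU hf)
  refine tendsto_of_tendsto_of_tendsto_of_le_of_le tendsto_const_nhds h1 (fun _ => zero_le)
    fun n => ?_
  refine le_trans (le_of_eq ?_) (eLpNorm_restrict_le _ 2 volume U)
  refine eLpNorm_congr_ae ?_
  filter_upwards [ae_restrict_mem hU.measurableSet] with x hx
  simp [hx]

/-- Functions in `H²` of a convex open set are limits, in `H²`, of functions that are smooth on the
whole plane. -/
theorem MemH2.exists_smooth_tendsto (hU : IsOpen U) (hc : Convex ℝ U) (hb : Bornology.IsBounded U)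
    (hne : U.Nonempty) {u : Plane → ℝ} (hu : MemH2 U u) :
    ∃ φ : ℕ → Plane → ℝ, (∀ n, ContDiff ℝ ∞ (φ n)) ∧
      Tendsto (fun n => ∫ x in U, ‖φ n x - u x‖ ^ 2) atTop (𝓝 0) ∧
      (∀ i, Tendsto (fun n => ∫ x in U, ‖pd i (φ n) x - weakPartial U i u x‖ ^ 2) atTop (𝓝 0)) ∧
      ∀ i j, Tendsto (fun n => ∫ x in U, ‖pd j (pd i (φ n)) x -
        weakPartial U j (weakPartial U i u) x‖ ^ 2) atTop (𝓝 0) := by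
  obtain ⟨k, R, s, hk, hR, hs, hs01, hsupp⟩ := exists_kernels_of_convex hU hc hne
  set φ : ℕ → Plane → ℝ := fun n => avg (k n) (s n) (U.indicator u) with hφ
  have hl : ∀ {f : Plane → ℝ}, MemLp f 2 (volume.restrict U) → LocallyIntegrable (U.indicator f) :=
    fun hf => (memLp_indicator hU hf).locallyIntegrable (by norm_num)
  have hL0 : MemLp u 2 (volume.restrict U) := hu.1.1
  have hL1 : ∀ i, MemLp (weakPartial U i u) 2 (volume.restrict U) := fun i => (hu.1.2 i).2
  have hL2 : ∀ i j, MemLp (weakPartial U j (weakPartial U i u)) 2 (volume.restrict U) :=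
    fun i j => ((hu.2 i).2 j).2
  have hsm : ∀ n, ContDiff ℝ ∞ (φ n) := fun n => contDiff_avg (hk n) (hl hL0)
  have hpd : ∀ n i, ∀ x ∈ U, pd i (φ n) x =
      s n * avg (k n) (s n) (U.indicator (weakPartial U i u)) x := fun n i x hx =>
    fderiv_avg_indicator (hk n) hU (weakPartial_spec (hu.1.2 i).1) (hl hL0) (hsupp n x hx)
  have hpd2 : ∀ n i j, ∀ x ∈ U, pd j (pd i (φ n)) x =
      s n ^ 2 * avg (k n) (s n) (U.indicator (weakPartial U j (weakPartial U i u))) x := by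
    intro n i j x hx
    have e1 : pd i (φ n) =ᶠ[𝓝 x]
        fun x => s n * avg (k n) (s n) (U.indicator (weakPartial U i u)) x := by
      filter_upwards [hU.mem_nhds hx] with z hz using hpd n i z hz
    have e2 := fderiv_avg_indicator (hk n) hU (weakPartial_spec ((hu.2 i).2 j).1) (hl (hL1 i))
      (hsupp n x hx)
    rw [pd, e1.fderiv_eq, fderiv_const_mul]
    · simp only [_root_.smul_apply, smul_eq_mul]
      rw [e2]
      ring
    · exact (contDiff_avg (hk n) (hl (hL1 i))).differentiable (by norm_num) x
  have hmeas : ∀ {f : Plane → ℝ}, MemLp f 2 (volume.restrict U) → ∀ n, AEStronglyMeasurable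
      (avg (k n) (s n) (U.indicator f)) (volume.restrict U) := fun hf n =>
    (contDiff_avg (hk n) (hl hf)).continuous.aestronglyMeasurable
  have hs2 : Tendsto (fun n => s n ^ 2) atTop (𝓝 1) := by simpa using hs.pow 2
  refine ⟨φ, hsm, ?_, fun i => ?_, fun i j => ?_⟩
  · rw [tendsto_integral_sq_iff]
    · exact tendsto_eLpNorm_avg_indicator_sub hU hk hR hs hL0
    · exact fun n => (memLp_two_of_continuous_of_bounded hb (hsm n).continuous).sub hL0
  · rw [tendsto_integral_sq_iff]
    · refine (tendsto_eLpNorm_const_mul_sub (hmeas (hL1 i)) (hL1 i) hs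
        (tendsto_eLpNorm_avg_indicator_sub hU hk hR hs (hL1 i))).congr fun n => ?_
      refine eLpNorm_congr_ae ?_
      filter_upwards [ae_restrict_mem hU.measurableSet] with x hx
      rw [hpd n i x hx]
    · exact fun n => (memLp_two_of_continuous_of_bounded hb
        (contDiff_pd (hsm n) i).continuous).sub (hL1 i)
  · rw [tendsto_integral_sq_iff]
    · refine (tendsto_eLpNorm_const_mul_sub (hmeas (hL2 i j)) (hL2 i j) hs2
        (tendsto_eLpNorm_avg_indicator_sub hU hk hR hs (hL2 i j))).congr fun n => ?_
      refine eLpNorm_congr_ae ?_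
      filter_upwards [ae_restrict_mem hU.measurableSet] with x hx
      rw [hpd2 n i j x hx]
    · exact fun n => (memLp_two_of_continuous_of_bounded hb
        (contDiff_pd (contDiff_pd (hsm n) i) j).continuous).sub (hL2 i j)

theorem abs_avg_indicator_le {k : Plane → ℝ} {R s : ℝ} (hk : IsKernel k R) (hU : IsOpen U)
    {f : Plane → ℝ} {L : ℝ} (hL : 0 ≤ L) (hf : ∀ᵐ x ∂(volume.restrict U), |f x| ≤ L) (x : Plane) :
    |avg k s (U.indicator f) x| ≤ L := by
  have h1 : Integrable fun v => k (s • x - v) * L := hk.integrable_mul (locallyIntegrable_const L) _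
  rw [avg, ← Real.norm_eq_abs]
  have hf' : ∀ᵐ v ∂(volume : Measure Plane), |U.indicator f v| ≤ L := by
    rw [ae_restrict_iff' hU.measurableSet] at hf
    filter_upwards [hf] with v hv
    by_cases h : v ∈ U
    · simpa [h] using hv h
    · simpa [h] using hL
  refine (norm_integral_le_of_norm_le h1 ?_).trans_eq ?_
  · filter_upwards [hf'] with v hv
    rw [norm_mul, Real.norm_of_nonneg (hk.nonneg _)]
    exact mul_le_mul_of_nonneg_left hv (hk.nonneg _)
  · rw [integral_mul_const, integral_sub_left_eq_self k, hk.integral_eq, one_mul]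

theorem norm_fderiv_le_of_pd_le {φ : Plane → ℝ} {x : Plane} {L : ℝ}
    (h : ∀ i, |pd i φ x| ≤ L) : ‖fderiv ℝ φ x‖ ≤ 2 * L := by
  have hL : 0 ≤ L := (abs_nonneg _).trans (h 0)
  refine ContinuousLinearMap.opNorm_le_bound _ (by positivity) fun v => ?_
  have e : v = v 0 • EuclideanSpace.single 0 (1 : ℝ) + v 1 • EuclideanSpace.single 1 (1 : ℝ) := by
    ext i
    fin_cases i <;> simp
  have hv : ∀ i, |v i| ≤ ‖v‖ := fun i => by
    simpa using PiLp.norm_apply_le v i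
  have e2 : fderiv ℝ φ x v = v 0 * pd 0 φ x + v 1 * pd 1 φ x := by
    conv_lhs => rw [e]
    simp [pd]
  rw [e2, Real.norm_eq_abs]
  refine (abs_add_le _ _).trans ?_
  rw [abs_mul, abs_mul]
  have h1 : |v 0| * |pd 0 φ x| ≤ ‖v‖ * L := mul_le_mul (hv 0) (h 0) (abs_nonneg _) (norm_nonneg _)
  have h2 : |v 1| * |pd 1 φ x| ≤ ‖v‖ * L := mul_le_mul (hv 1) (h 1) (abs_nonneg _) (norm_nonneg _)
  linarith

/-- A function on a bounded convex open set whose weak gradient is bounded has a Lipschitz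
representative. -/
theorem exists_lipschitz_representative (hU : IsOpen U) (hc : Convex ℝ U)
    (hb : Bornology.IsBounded U) (hne : U.Nonempty) {f : Plane → ℝ} {g : Fin 2 → Plane → ℝ}
    (hf : MemLp f ⊤ (volume.restrict U)) (hg : ∀ i, HasWeakPartial U i f (g i)) {L : NNReal}
    (hL : ∀ i, ∀ᵐ x ∂(volume.restrict U), |g i x| ≤ L) :
    ∃ F : Plane → ℝ, LipschitzWith (2 * L) F ∧ F =ᵐ[volume.restrict U] f := by
  have : IsFiniteMeasure (volume.restrict U) := ⟨by simpa using hb.measure_lt_top⟩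
  have hf2 : MemLp f 2 (volume.restrict U) := hf.mono_exponent le_top
  obtain ⟨k, R, s, hk, hR, hs, hs01, hsupp⟩ := exists_kernels_of_convex hU hc hne
  have hl : LocallyIntegrable (U.indicator f) :=
    (memLp_indicator hU hf2).locallyIntegrable (by norm_num)
  set φ : ℕ → Plane → ℝ := fun n => avg (k n) (s n) (U.indicator f) with hφ
  have hsm : ∀ n, ContDiff ℝ ∞ (φ n) := fun n => contDiff_avg (hk n) hl
  have hlip : ∀ n, LipschitzOnWith (2 * L) (φ n) U := by
    intro n
    refine hc.lipschitzOnWith_of_nnnorm_fderiv_le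
      (fun x _ => (hsm n).differentiable (by norm_num) x) fun x hx => ?_
    rw [← NNReal.coe_le_coe]
    push_cast
    refine norm_fderiv_le_of_pd_le fun i => ?_
    rw [pd, fderiv_avg_indicator (hk n) hU (hg i) hl (hsupp n x hx), abs_mul,
      abs_of_nonneg (hs01 n).1]
    calc _ ≤ 1 * (L : ℝ) := mul_le_mul (hs01 n).2
          (abs_avg_indicator_le (hk n) hU L.2 (hL i) x) (abs_nonneg _) zero_le_one
      _ = L := one_mul _
  have hconv := tendsto_eLpNorm_avg_indicator_sub hU hk hR hs hf2
  have hmeas := tendstoInMeasure_of_tendsto_eLpNorm (by norm_num)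
    (fun n => (hsm n).continuous.aestronglyMeasurable) hf2.1 hconv
  obtain ⟨ns, -, hae⟩ := hmeas.exists_seq_tendsto_ae
  -- the uniform Lipschitz bound passes to the limit where the averages converge
  set S : Set Plane := {x | x ∈ U ∧ Tendsto (fun n => φ (ns n) x) atTop (𝓝 (f x))} with hS
  have hfS : LipschitzOnWith (2 * L) f S := by
    refine LipschitzOnWith.of_dist_le_mul fun x hx z hz => ?_
    refine le_of_tendsto (hx.2.dist hz.2) (Eventually.of_forall fun n => ?_)
    exact (hlip _).dist_le_mul x hx.1 z hz.1
  obtain ⟨F, hF, hFS⟩ := hfS.extend_real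
  refine ⟨F, hF, ?_⟩
  filter_upwards [hae, ae_restrict_mem hU.measurableSet] with x h1 h2
  exact (hFS ⟨h2, h1⟩).symm

/-- Any continuous representative agrees with `contRep` on a set contained in the closure of its interior,
where null sets cannot hide an open piece. -/
theorem contRep_eqOn {F : Type*} [TopologicalSpace F] [T2Space F] {K : Set Plane}
    (hK : K ⊆ closure (interior K)) {f g : Plane → F} (hg : ContinuousOn g K)
    (hgf : g =ᵐ[volume.restrict K] f) : EqOn (contRep K f) g K := by
  have hex : ∃ g : Plane → F, ContinuousOn g K ∧ g =ᵐ[volume.restrict K] f := ⟨g, hg, hgf⟩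
  have hsp := hex.choose_spec
  rw [contRep, dif_pos hex]
  exact Measure.eqOn_of_ae_eq (hsp.2.trans hgf.symm) hsp.1 hg hK

/-- A function in `H¹` of the whole plane that vanishes outside the closure of a bounded convex open
set belongs to `H¹₀` of that set: averages at scales above `1` have compact support in it. -/
theorem memH10_of_support_subset (hU : IsOpen U) (hc : Convex ℝ U) (hb : Bornology.IsBounded U)
    (hne : U.Nonempty) {f : Plane → ℝ} {G : Plane → Plane} (hf : MemLp f 2 volume)
    (hG : MemLp G 2 volume) (hfG : ∀ i, HasWeakPartial univ i f (fun x => G x i))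
    (hf0 : ∀ x, x ∉ closure U → f x = 0) : MemH10 U f := by
  have hH1 : IsH1 U f G := ⟨hf.restrict U, hG.restrict U, fun i => (hfG i).mono (subset_univ _)⟩
  refine ⟨hH1.memH1 hU, ?_⟩
  obtain ⟨x₀, hx₀⟩ := hne
  obtain ⟨r₀, hr₀, hball⟩ := Metric.nhds_basis_closedBall.mem_iff.1 (hU.mem_nhds hx₀)
  set s : ℕ → ℝ := fun n => 1 + 1 / ((n : ℝ) + 1) with hs
  have hs1 : ∀ n, 1 < s n := fun n => by
    have : (0 : ℝ) < 1 / ((n : ℝ) + 1) := Nat.one_div_pos_of_nat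
    simp only [hs]
    linarith
  have hst : Tendsto s atTop (𝓝 1) := by
    have := (tendsto_const_nhds (x := (1 : ℝ))).add
      (tendsto_one_div_add_atTop_nhds_zero_nat (𝕜 := ℝ))
    simpa [hs] using this
  choose k hk hkv using fun n => exists_isKernel x₀ hr₀ (hs1 n).ne'
  have hR : Tendsto (fun n => |1 - s n| * (‖x₀‖ + r₀)) atTop (𝓝 0) := by
    have : Tendsto (fun n => |1 - s n| * (‖x₀‖ + r₀)) atTop (𝓝 (|1 - 1| * (‖x₀‖ + r₀))) :=
      ((tendsto_const_nhds.sub hst).abs).mul_const _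
    simpa using this
  have hfl : LocallyIntegrable f := hf.locallyIntegrable (by norm_num)
  have hGi : ∀ i, MemLp (fun x => G x i) 2 volume := fun i => hG.eval_piLp i
  have hGl : ∀ i, LocallyIntegrable fun x => G x i := fun i =>
    (hGi i).locallyIntegrable (by norm_num)
  set φ : ℕ → Plane → ℝ := fun n => avg (k n) (s n) f with hφ
  have hsm : ∀ n, ContDiff ℝ ∞ (φ n) := fun n => contDiff_avg (hk n) hfl
  have hpd : ∀ n i x, pd i (φ n) x = s n * avg (k n) (s n) (fun x => G x i) x := by
    intro n i x
    have := fderiv_avg_indicator (s := s n) (hk n) isOpen_univ (hfG i) (by simpa using hfl)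
      (x := x) (by simp)
    simpa [pd, hφ] using this
  have htest : ∀ n, IsTest U (φ n) := by
    intro n
    have hs0 : 0 < s n := zero_lt_one.trans (hs1 n)
    -- a point that sees `v` in the closure of `U` is a convex combination of `v` and some `w` near `x₀`
    set K : Set Plane := (fun p : Plane × Plane => (s n)⁻¹ • p.1 + (1 - (s n)⁻¹) • p.2) ''
      (closure U ×ˢ Metric.closedBall x₀ r₀) with hK
    have hKc : IsCompact K := (hb.isCompact_closure.prod (isCompact_closedBall _ _)).image
      (by fun_prop)
    have hKU : K ⊆ U := by
      rintro _ ⟨⟨v, w⟩, ⟨hv, hw⟩, rfl⟩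
      have := hc.combo_closure_interior_mem_interior hv (y := w)
        (by rw [hU.interior_eq]; exact hball hw)
        (inv_pos.2 hs0).le (sub_pos.2 (inv_lt_one_of_one_lt₀ (hs1 n))) (by ring)
      rwa [hU.interior_eq] at this
    have hsub : Function.support (φ n) ⊆ K := by
      intro x hx
      by_contra hxK
      refine hx ?_
      simp only [hφ, avg]
      refine integral_eq_zero_of_ae (Eventually.of_forall fun v => ?_)
      simp only [Pi.zero_apply, mul_eq_zero]
      by_contra! h
      obtain ⟨w, hw, hvw⟩ := hkv n _ _ (subset_tsupport _ h.1)
      have hv : v ∈ closure U := by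
        by_contra h'
        exact h.2 (hf0 v h')
      refine hxK ⟨(v, w), ⟨hv, hw⟩, ?_⟩
      simp only
      rw [hvw, smul_add, smul_smul, smul_smul, inv_mul_cancel₀ hs0.ne', one_smul, add_assoc,
        ← add_smul]
      have : (s n)⁻¹ * (1 - s n) + (1 - (s n)⁻¹) = 0 := by
        field_simp
        ring
      rw [this, zero_smul, add_zero]
    have hts : tsupport (φ n) ⊆ K := closure_minimal hsub hKc.isClosed
    exact ⟨hsm n, hKc.of_isClosed_subset (isClosed_tsupport _) hts, hts.trans hKU⟩
  refine ⟨φ, htest, ?_⟩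
  have hC1 : ∀ n, ContDiff ℝ 1 (φ n) := fun n => (hsm n).of_le (by norm_num)
  have hH : ∀ n, IsH1 U (fun x => f x - φ n x) (fun x => G x - gradient (φ n) x) :=
    fun n => hH1.sub (isH1_of_contDiff hb (hC1 n))
  have hφm : ∀ n, MemLp (φ n) 2 (volume.restrict U) := fun n =>
    memLp_two_of_continuous_of_bounded hb (hsm n).continuous
  have hpm : ∀ n i, MemLp (pd i (φ n)) 2 (volume.restrict U) := fun n i =>
    memLp_two_of_continuous_of_bounded hb (contDiff_pd (hsm n) i).continuous
  have t0 : Tendsto (fun n => ∫ x in U, ‖φ n x - f x‖ ^ 2) atTop (𝓝 0) := by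
    rw [tendsto_integral_sq_iff]
    · refine tendsto_of_tendsto_of_tendsto_of_le_of_le tendsto_const_nhds
        (tendsto_eLpNorm_avg_sub hk hR hst hf) (fun _ => zero_le) fun n => ?_
      exact eLpNorm_restrict_le _ 2 volume U
    · exact fun n => (hφm n).sub hH1.1
  have t1 : ∀ i, Tendsto (fun n => ∫ x in U, ‖pd i (φ n) x - G x i‖ ^ 2) atTop (𝓝 0) := by
    intro i
    rw [tendsto_integral_sq_iff]
    · have := tendsto_eLpNorm_const_mul_sub
        (fun n => (contDiff_avg (s := s n) (hk n) (hGl i)).continuous.aestronglyMeasurable)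
        (hGi i) hst (tendsto_eLpNorm_avg_sub hk hR hst (hGi i))
      refine tendsto_of_tendsto_of_tendsto_of_le_of_le tendsto_const_nhds
        this (fun _ => zero_le) fun n => ?_
      simp only [hpd]
      exact eLpNorm_restrict_le _ 2 volume U
    · exact fun n => (hpm n i).sub (hH1.2.1.eval_piLp i)
  have t2 := (t0.add ((t1 0).add (t1 1)))
  simp only [add_zero] at t2
  have t3 := (Real.continuous_sqrt.tendsto 0).comp t2
  rw [Real.sqrt_zero] at t3
  refine t3.congr fun n => ?_
  rw [(hH n).normH1_eq hU, energy, Function.comp]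
  congr 2
  · congr 1
    ext x
    rw [Real.norm_eq_abs, sq_abs]
    ring
  · rw [← integral_add]
    · congr 1
      ext x
      rw [EuclideanSpace.norm_sq_eq, Fin.sum_univ_two]
      simp only [PiLp.sub_apply, gradient_apply, pd]
      rw [norm_sub_rev, norm_sub_rev (G x 1)]
    · exact integrable_norm_sq ((hpm n 0).sub (hH1.2.1.eval_piLp 0))
    · exact integrable_norm_sq ((hpm n 1).sub (hH1.2.1.eval_piLp 1))

end Convex

/-! ### Affine functions and triangles -/

/-- The constant gradient of an affine function. -/
def affGrad (g : Plane →ᵃ[ℝ] ℝ) : Plane :=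
  (InnerProductSpace.toDual ℝ Plane).symm (LinearMap.toContinuousLinearMap g.linear)

theorem affine_sub_eq (g : Plane →ᵃ[ℝ] ℝ) (x y : Plane) : g x - g y = inner ℝ (affGrad g) (x - y) := by
  rw [affGrad, InnerProductSpace.toDual_symm_apply, LinearMap.coe_toContinuousLinearMap']
  have := g.linearMap_vsub x y
  simpa using this.symm

theorem hasGradientAt_affine (g : Plane →ᵃ[ℝ] ℝ) (x : Plane) : HasGradientAt g (affGrad g) x := by
  rw [hasGradientAt_iff_hasFDerivAt]
  have h1 : (g : Plane → ℝ) = fun z => (InnerProductSpace.toDual ℝ Plane (affGrad g)) z + g 0 := by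
    ext z
    have := affine_sub_eq g z 0
    rw [sub_zero] at this
    rw [InnerProductSpace.toDual_apply_apply, ← this]
    ring
  rw [h1]
  exact (ContinuousLinearMap.hasFDerivAt _).add_const _

theorem gradient_affine (g : Plane →ᵃ[ℝ] ℝ) (x : Plane) : gradient g x = affGrad g :=
  (hasGradientAt_affine g x).gradient

theorem continuous_affine (g : Plane →ᵃ[ℝ] ℝ) : Continuous g :=
  g.continuous_of_finiteDimensional

theorem abs_affine_sub_le (g : Plane →ᵃ[ℝ] ℝ) (x y : Plane) :
    |g x - g y| ≤ ‖affGrad g‖ * ‖x - y‖ := by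
  rw [affine_sub_eq]
  exact abs_real_inner_le_norm _ _

namespace Tri

variable (T : Tri)

/-- The barycentric coordinates as affine maps. -/
def coord (i : Fin 3) : Plane →ᵃ[ℝ] ℝ := (Tri.basis T).coord i

theorem bary_eq_coord (i : Fin 3) : Tri.bary T i = coord T i := rfl

theorem basis_apply (i : Fin 3) : Tri.basis T i = T.points i := rfl

theorem coord_points (i j : Fin 3) : coord T i (T.points j) = if i = j then 1 else 0 := by
  rw [coord, ← basis_apply, AffineBasis.coord_apply]

theorem sum_coord (x : Plane) : ∑ i, coord T i x = 1 :=
  (Tri.basis T).sum_coord_apply_eq_one x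

theorem sum_coord_smul (x : Plane) : ∑ i : Fin 3, coord T i x • T.points i = x :=
  (Tri.basis T).linear_combination_coord_eq_self x

theorem affine_eq_sum (g : Plane →ᵃ[ℝ] ℝ) (x : Plane) :
    g x = ∑ i : Fin 3, coord T i x * g (T.points i) := by
  have h : ∀ z, g z = g 0 + inner ℝ (affGrad g) z := fun z => by
    have := affine_sub_eq g z 0
    rw [sub_zero] at this
    linarith
  have h1 : ∑ i : Fin 3, coord T i x * g (T.points i) =
      (∑ i, coord T i x) * g 0 + inner ℝ (affGrad g) (∑ i : Fin 3, coord T i x • T.points i) := by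
    rw [inner_sum, Finset.sum_mul, ← Finset.sum_add_distrib]
    refine Finset.sum_congr rfl fun i _ => ?_
    rw [h (T.points i), real_inner_smul_right]
    ring
  rw [h1, sum_coord, sum_coord_smul, one_mul, ← h]

/-- The gradients of the barycentric coordinates. -/
def bgrad (i : Fin 3) : Plane := affGrad (coord T i)

theorem affGrad_eq_sum (g : Plane →ᵃ[ℝ] ℝ) :
    affGrad g = ∑ i : Fin 3, g (T.points i) • bgrad T i := by
  refine ext_inner_right ℝ fun v => ?_
  have h1 : g v - g 0 = inner ℝ (affGrad g) v := by
    have := affine_sub_eq g v 0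
    rwa [sub_zero] at this
  rw [← h1, affine_eq_sum T g v, affine_eq_sum T g 0, ← Finset.sum_sub_distrib, sum_inner]
  refine Finset.sum_congr rfl fun i _ => ?_
  rw [real_inner_smul_left, bgrad]
  have := affine_sub_eq (coord T i) v 0
  rw [sub_zero] at this
  rw [← this]
  ring

theorem sum_bgrad : ∑ i, bgrad T i = 0 := by
  have h := affGrad_eq_sum T (AffineMap.const ℝ Plane (1 : ℝ))
  simp only [AffineMap.const_apply, one_smul] at h
  rw [← h, affGrad]
  simp

theorem sum_inner_points_smul_bgrad (J : Plane) :
    ∑ i : Fin 3, (inner ℝ J (T.points i) : ℝ) • bgrad T i = J := by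
  have h := affGrad_eq_sum T (innerSL ℝ J).toLinearMap.toAffineMap
  have h2 : affGrad (innerSL ℝ J).toLinearMap.toAffineMap = J := by
    refine ext_inner_right ℝ fun v => ?_
    have := affine_sub_eq (innerSL ℝ J).toLinearMap.toAffineMap v 0
    rw [sub_zero] at this
    rw [← this]
    simp
  rw [h2] at h
  simpa using h.symm

theorem isCompact_carrier : IsCompact (carrier T) :=
  (finite_range _).isCompact_convexHull ℝ

theorem isClosed_carrier : IsClosed (carrier T) := (isCompact_carrier T).isClosed

theorem convex_carrier : Convex ℝ (carrier T) := convex_convexHull ℝ _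

theorem points_mem_carrier (i : Fin 3) : T.points i ∈ carrier T :=
  subset_convexHull ℝ _ (mem_range_self i)

theorem mem_carrier_iff {x : Plane} : x ∈ carrier T ↔ ∀ i, 0 ≤ coord T i x := by
  have : carrier T = convexHull ℝ (range (Tri.basis T)) := rfl
  rw [this, AffineBasis.convexHull_eq_nonneg_coord]
  rfl

theorem mem_interior_carrier_iff {x : Plane} : x ∈ interior (carrier T) ↔ ∀ i, 0 < coord T i x := by
  have : carrier T = convexHull ℝ (range (Tri.basis T)) := rfl
  rw [this, AffineBasis.interior_convexHull]
  rfl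

theorem coord_le_one {x : Plane} (hx : x ∈ carrier T) (i : Fin 3) : coord T i x ≤ 1 := by
  rw [← sum_coord T x]
  exact Finset.single_le_sum (f := fun i => coord T i x)
    (fun j _ => (mem_carrier_iff T).1 hx j) (Finset.mem_univ i)

theorem interior_carrier_nonempty : (interior (carrier T)).Nonempty :=
  ⟨_, (Tri.basis T).centroid_mem_interior_convexHull⟩

theorem carrier_subset_closure_interior : carrier T ⊆ closure (interior (carrier T)) := by
  rw [(convex_carrier T).closure_interior_eq_closure_of_nonempty_interior
    (interior_carrier_nonempty T)]
  exact subset_closure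

theorem measurableSet_carrier : MeasurableSet (carrier T) := (isClosed_carrier T).measurableSet

theorem interior_carrier_ae_eq : (interior (carrier T) : Set Plane) =ᵐ[volume] carrier T :=
  interior_ae_eq_of_null_frontier ((convex_carrier T).addHaar_frontier volume)

theorem restrict_interior_carrier :
    (volume : Measure Plane).restrict (interior (carrier T)) = volume.restrict (carrier T) :=
  Measure.restrict_congr_set (interior_carrier_ae_eq T)

theorem norm_sub_le_diam {x y : Plane} (hx : x ∈ carrier T) (hy : y ∈ carrier T) :
    ‖x - y‖ ≤ Metric.diam (carrier T) := by
  rw [← dist_eq_norm]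
  exact Metric.dist_le_diam_of_mem (isCompact_carrier T).isBounded hx hy

/-- A barycentric coordinate runs through at most `[0, 1]` along a diameter of an inscribed disc. -/
theorem norm_bgrad_le {c : Plane} {r : ℝ} (hr : 0 < r) (hball : Metric.closedBall c r ⊆ carrier T)
    (i : Fin 3) : ‖bgrad T i‖ ≤ 1 / (2 * r) := by
  by_cases h0 : bgrad T i = 0
  · rw [h0, norm_zero]
    positivity
  have hn : 0 < ‖bgrad T i‖ := norm_pos_iff.2 h0
  set w : Plane := (r / ‖bgrad T i‖) • bgrad T i with hw
  have hwn : ‖w‖ = r := by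
    rw [hw, norm_smul, Real.norm_of_nonneg (by positivity)]
    field_simp
  have h1 : c + w ∈ carrier T := hball (by simp [hwn])
  have h2 : c - w ∈ carrier T := hball (by simp [hwn])
  have h3 := affine_sub_eq (coord T i) (c + w) (c - w)
  have h4 : (c + w) - (c - w) = (2 : ℝ) • w := by module
  have h5 : (inner ℝ (affGrad (coord T i)) ((2 : ℝ) • w) : ℝ) = 2 * r * ‖bgrad T i‖ := by
    change (inner ℝ (bgrad T i) ((2 : ℝ) • w) : ℝ) = _
    rw [real_inner_smul_right, hw, real_inner_smul_right, real_inner_self_eq_norm_sq]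
    field_simp
  rw [h4, h5] at h3
  have h6 := coord_le_one T h1 i
  have h7 := (mem_carrier_iff T).1 h2 i
  rw [le_div_iff₀ (by positivity)]
  linarith

theorem weight_eq (i j : Fin 3) :
    weight T i j = -(volume.real (carrier T) * inner ℝ (bgrad T i) (bgrad T j)) := by
  rw [weight]
  simp only [bary_eq_coord, gradient_affine]
  rw [setIntegral_const, smul_eq_mul]
  rfl

/-- The edge weights reproduce the integral of a product of two constant gradients. -/
theorem sum_weight_mul (J : Plane) (v : Plane →ᵃ[ℝ] ℝ) :
    ∑ i : Fin 3, weight T i (i + 1) * inner ℝ J (T.points (i + 1) - T.points i) *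
      (v (T.points (i + 1)) - v (T.points i)) = volume.real (carrier T) * inner ℝ J (affGrad v) := by
  have hJ := sum_inner_points_smul_bgrad T J
  have hv := affGrad_eq_sum T v
  have h0 := sum_bgrad T
  simp only [Fin.sum_univ_three] at hJ hv h0
  have hrow : ∀ w : Plane, inner ℝ w (bgrad T 0) + inner ℝ w (bgrad T 1) + inner ℝ w (bgrad T 2)
      = (0 : ℝ) := fun w => by
    rw [← inner_add_right, ← inner_add_right, h0, inner_zero_right]
  have r0 := hrow (bgrad T 0)
  have r1 := hrow (bgrad T 1)
  have r2 := hrow (bgrad T 2)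
  have c01 := real_inner_comm (bgrad T 0) (bgrad T 1)
  have c02 := real_inner_comm (bgrad T 0) (bgrad T 2)
  have c12 := real_inner_comm (bgrad T 1) (bgrad T 2)
  have hJg : ∀ w : Plane, (inner ℝ J w : ℝ) = inner ℝ J (T.points 0) * inner ℝ (bgrad T 0) w +
      inner ℝ J (T.points 1) * inner ℝ (bgrad T 1) w +
      inner ℝ J (T.points 2) * inner ℝ (bgrad T 2) w := fun w => by
    rw [← real_inner_smul_left, ← real_inner_smul_left, ← real_inner_smul_left, ← inner_add_left,
      ← inner_add_left, hJ]
  have g0 := hJg (bgrad T 0)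
  have g1 := hJg (bgrad T 1)
  have g2 := hJg (bgrad T 2)
  rw [hv]
  simp only [Fin.sum_univ_three, weight_eq, inner_add_right, inner_sub_right,
    real_inner_smul_right, zero_add, Fin.reduceAdd, g0, g1, g2]
  rw [c01] at r1
  rw [c02, c12] at r2
  rw [c01, c02, c12]
  set a := volume.real (carrier T)
  set A := (inner ℝ (bgrad T 0) (bgrad T 1) : ℝ)
  set B := (inner ℝ (bgrad T 0) (bgrad T 2) : ℝ)
  set C := (inner ℝ (bgrad T 1) (bgrad T 2) : ℝ)
  set v0 := v (T.points 0)
  set v1 := v (T.points 1)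
  set v2 := v (T.points 2)
  set j0 := (inner ℝ J (T.points 0) : ℝ)
  set j1 := (inner ℝ J (T.points 1) : ℝ)
  set j2 := (inner ℝ J (T.points 2) : ℝ)
  have e0 : (inner ℝ (bgrad T 0) (bgrad T 0) : ℝ) = -A - B := by linarith
  have e1 : (inner ℝ (bgrad T 1) (bgrad T 1) : ℝ) = -A - C := by linarith
  have e2 : (inner ℝ (bgrad T 2) (bgrad T 2) : ℝ) = -B - C := by linarith
  rw [e0, e1, e2]
  ring

end Tri

/-! ### Triangulations of convex domains -/

theorem IsConvexPolygon.isOpen {Ω : Set Plane} (h : IsConvexPolygon Ω) : IsOpen Ω := by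
  obtain ⟨-, s, rfl⟩ := h
  exact isOpen_interior

theorem IsConvexPolygon.convex {Ω : Set Plane} (h : IsConvexPolygon Ω) : Convex ℝ Ω := by
  obtain ⟨-, s, rfl⟩ := h
  exact (convex_convexHull ℝ _).interior

theorem IsConvexPolygon.isBounded {Ω : Set Plane} (h : IsConvexPolygon Ω) :
    Bornology.IsBounded Ω := by
  obtain ⟨-, s, rfl⟩ := h
  exact ((s.finite_toSet.isCompact_convexHull ℝ).isBounded).subset interior_subset

namespace Triangulation

variable {Ω : Set Plane} (M : Triangulation Ω)

theorem carrier_subset {T : Tri} (hT : T ∈ M.elems) : Tri.carrier T ⊆ closure Ω := by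
  rw [← M.cover]
  exact subset_biUnion_of_mem (u := fun T => Tri.carrier T) hT

theorem interior_carrier_subset (hΩ : IsConvexPolygon Ω) {T : Tri} (hT : T ∈ M.elems) :
    interior (Tri.carrier T) ⊆ Ω := by
  have h := interior_mono (M.carrier_subset hT)
  rwa [hΩ.convex.interior_closure_eq_interior_of_nonempty_interior
    (by rw [hΩ.isOpen.interior_eq]; exact hΩ.1), hΩ.isOpen.interior_eq] at h

theorem diam_le_meshSize {T : Tri} (hT : T ∈ M.elems) :
    Metric.diam (Tri.carrier T) ≤ M.meshSize :=
  le_csSup ((M.elems.finite_toSet.image _).bddAbove) (mem_image_of_mem _ hT)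

theorem meshSize_nonneg : 0 ≤ M.meshSize := by
  refine Real.sSup_nonneg ?_
  rintro _ ⟨T, -, rfl⟩
  exact Metric.diam_nonneg

theorem disjoint_interior_aux {T T' : Tri} (hT : T ∈ M.elems) (hT' : T' ∈ M.elems) (hne : T ≠ T')
    {i : Fin 3} (hi : T.points i ∉ range T'.points) :
    Disjoint (interior (Tri.carrier T)) (Tri.carrier T') := by
  rw [Set.disjoint_left]
  intro x hx hx'
  have h1 : x ∈ convexHull ℝ (range T.points ∩ range T'.points) := by
    rw [← (M.conforming T hT T' hT' hne).2]
    exact ⟨interior_subset hx, hx'⟩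
  have h2 : convexHull ℝ (range T.points ∩ range T'.points) ⊆ {z | Tri.coord T i z = 0} := by
    refine convexHull_min ?_ ?_
    · rintro _ ⟨⟨j, rfl⟩, hj⟩
      have hij : i ≠ j := fun h => hi (h ▸ hj)
      simp [Tri.coord_points, hij]
    · have : {z | Tri.coord T i z = 0} = (Tri.coord T i) ⁻¹' {0} := rfl
      rw [this]
      exact (convex_singleton _).affine_preimage _
  have h3 := (Tri.mem_interior_carrier_iff T).1 hx i
  have h4 : Tri.coord T i x = 0 := h2 h1
  linarith

/-- Two different triangles of a triangulation have disjoint interiors: one of them has a vertex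
that the other lacks, and the intersection lies in the opposite edge. -/
theorem disjoint_interior {T T' : Tri} (hT : T ∈ M.elems) (hT' : T' ∈ M.elems) (hne : T ≠ T') :
    Disjoint (interior (Tri.carrier T)) (interior (Tri.carrier T')) := by
  by_cases h : range T.points ⊆ range T'.points
  · have h' : ¬ range T'.points ⊆ range T.points := fun h' =>
      (M.conforming T hT T' hT' hne).1 (h.antisymm h')
    obtain ⟨_, ⟨i, rfl⟩, hi⟩ := not_subset.1 h'
    exact ((M.disjoint_interior_aux hT' hT hne.symm hi).mono_right interior_subset).symm
  · obtain ⟨_, ⟨i, rfl⟩, hi⟩ := not_subset.1 h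
    exact (M.disjoint_interior_aux hT hT' hne hi).mono_right interior_subset

theorem iUnion_interior_ae_eq (hΩ : IsConvexPolygon Ω) :
    (⋃ T ∈ M.elems, interior (Tri.carrier T) : Set Plane) =ᵐ[volume] Ω := by
  have h1 : (Ω : Set Plane) =ᵐ[volume] closure Ω :=
    (closure_ae_eq_of_null_frontier (hΩ.convex.addHaar_frontier volume)).symm
  refine EventuallyEq.trans ?_ h1.symm
  rw [← M.cover]
  exact Filter.EventuallyEq.biUnion (ι := Tri) M.elems.finite_toSet
    fun T _ => Tri.interior_carrier_ae_eq T

theorem ae_exists_mem_interior (hΩ : IsConvexPolygon Ω) :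
    ∀ᵐ x ∂(volume.restrict Ω), ∃ T ∈ M.elems, x ∈ interior (Tri.carrier T) := by
  rw [← Measure.restrict_congr_set (M.iUnion_interior_ae_eq hΩ)]
  have hm : MeasurableSet (⋃ T ∈ M.elems, interior (Tri.carrier T)) :=
    M.elems.measurableSet_biUnion fun T _ => isOpen_interior.measurableSet
  filter_upwards [ae_restrict_mem hm] with x hx
  simpa using hx

theorem setIntegral_eq_sum (hΩ : IsConvexPolygon Ω) {f : Plane → ℝ} (hf : IntegrableOn f Ω) :
    ∫ x in Ω, f x = ∑ T ∈ M.elems, ∫ x in Tri.carrier T, f x := by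
  rw [← setIntegral_congr_set (M.iUnion_interior_ae_eq hΩ), integral_biUnion_finset]
  · refine Finset.sum_congr rfl fun T _ => ?_
    rw [Tri.restrict_interior_carrier]
  · exact fun T _ => isOpen_interior.measurableSet
  · exact fun T hT T' hT' hne => M.disjoint_interior hT hT' hne
  · exact fun T hT => hf.mono_set (M.interior_carrier_subset hΩ hT)

theorem integrableOn_carrier (hΩ : IsConvexPolygon Ω) {T : Tri} (hT : T ∈ M.elems) {f : Plane → ℝ}
    (hf : IntegrableOn f Ω) : IntegrableOn f (Tri.carrier T) := by
  rw [IntegrableOn, ← Tri.restrict_interior_carrier]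
  exact hf.mono_set (M.interior_carrier_subset hΩ hT)

theorem ae_carrier_of_ae (hΩ : IsConvexPolygon Ω) {T : Tri} (hT : T ∈ M.elems) {P : Plane → Prop}
    (h : ∀ᵐ x ∂(volume.restrict Ω), P x) : ∀ᵐ x ∂(volume.restrict (Tri.carrier T)), P x := by
  rw [← Tri.restrict_interior_carrier]
  exact ae_restrict_of_ae_restrict_of_subset (M.interior_carrier_subset hΩ hT) h

end Triangulation

/-! ### The edge averages and local consistency -/

theorem edgePotential_congr {K : Set Plane} (hK : Convex ℝ K) {a b : Plane} (ha : a ∈ K) (hb : b ∈ K)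
    {e e' : Plane → ℝ} {z z' : Plane → Plane} (he : EqOn e e' K) (hz : EqOn z z' K) {t : ℝ}
    (ht : t ∈ Icc (0 : ℝ) 1) : edgePotential e z a b t = edgePotential e' z' a b t := by
  refine intervalIntegral.integral_congr fun s hs => ?_
  rw [uIcc_of_le ht.1] at hs
  have hm : AffineMap.lineMap a b s ∈ K :=
    hK.lineMap_mem ha hb ⟨hs.1, hs.2.trans ht.2⟩
  simp only [he hm, hz hm]

theorem edgeHarmonic_congr {K : Set Plane} (hK : Convex ℝ K) {a b : Plane} (ha : a ∈ K) (hb : b ∈ K)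
    {e e' : Plane → ℝ} {z z' : Plane → Plane} (he : EqOn e e' K) (hz : EqOn z z' K) :
    edgeHarmonic e z a b = edgeHarmonic e' z' a b := by
  rw [edgeHarmonic, edgeHarmonic]
  congr 1
  refine intervalIntegral.integral_congr fun s hs => ?_
  rw [uIcc_of_le zero_le_one] at hs
  simp only [edgeKappa, edgePotential_congr hK ha hb he hz hs, he (hK.lineMap_mem ha hb hs)]

theorem edgeDelta_congr {K : Set Plane} (hK : Convex ℝ K) {a b : Plane} (ha : a ∈ K) (hb : b ∈ K)
    {e e' : Plane → ℝ} {z z' : Plane → Plane} (he : EqOn e e' K) (hz : EqOn z z' K)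
    (y : Plane → ℝ) : edgeDelta e z a b y = edgeDelta e' z' a b y := by
  rw [edgeDelta, edgeDelta, edgePotential_congr hK ha hb he hz (by simp),
    edgePotential_congr hK ha hb he hz (by simp)]

/-- The edge quantity `H(κ_E) δ_E(e^ψ w)` is the average, with weight `κ_E⁻¹`, of the tangential
component of the flux `ε ∇w + ζ w` along the edge; so it is as close to a constant as the flux is. -/
theorem abs_edgeHarmonic_mul_edgeDelta_sub_le {e : Plane → ℝ} {z : Plane → Plane}
    (he : Continuous e) (hz : Continuous z) (hpos : ∀ x, 0 < e x) (a b : Plane) {w : Plane →ᵃ[ℝ] ℝ}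
    {y : Plane → ℝ} (hya : y a = w a) (hyb : y b = w b) {c B : ℝ}
    (hB : ∀ t ∈ Icc (0 : ℝ) 1, |e (AffineMap.lineMap a b t) * (w b - w a) +
      inner ℝ (z (AffineMap.lineMap a b t)) (b - a) * w (AffineMap.lineMap a b t) - c| ≤ B) :
    |edgeHarmonic e z a b * edgeDelta e z a b y - c| ≤ B := by
  have hline : Continuous fun t : ℝ => (AffineMap.lineMap a b t : Plane) :=
    AffineMap.lineMap_continuous
  have hf : Continuous fun s : ℝ =>
      (e (AffineMap.lineMap a b s))⁻¹ * inner ℝ (z (AffineMap.lineMap a b s)) (b - a) :=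
    ((he.comp hline).inv₀ fun s => (hpos _).ne').mul ((hz.comp hline).inner continuous_const)
  set ψ : ℝ → ℝ := edgePotential e z a b with hψ
  have hψd : ∀ t, HasDerivAt ψ ((e (AffineMap.lineMap a b t))⁻¹ *
      inner ℝ (z (AffineMap.lineMap a b t)) (b - a)) t := fun t =>
    (hf.integral_hasStrictDerivAt 0 t).hasDerivAt
  have hψc : Continuous ψ := continuous_iff_continuousAt.2 fun t => (hψd t).continuousAt
  set q : ℝ → ℝ := fun t => (edgeKappa e z a b t)⁻¹ with hq
  have hqe : ∀ t, q t = (e (AffineMap.lineMap a b t))⁻¹ * Real.exp (ψ t) := fun t => by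
    simp only [hq, edgeKappa]
    rw [mul_inv, ← Real.exp_neg, neg_neg]
  have hqpos : ∀ t, 0 < q t := fun t => by
    rw [hqe]
    exact mul_pos (inv_pos.2 (hpos _)) (Real.exp_pos _)
  have hqc : Continuous q := by
    have : q = fun t => (e (AffineMap.lineMap a b t))⁻¹ * Real.exp (ψ t) := funext hqe
    rw [this]
    exact ((he.comp hline).inv₀ fun s => (hpos _).ne').mul (Real.continuous_exp.comp hψc)
  set J : ℝ → ℝ := fun t => e (AffineMap.lineMap a b t) * (w b - w a) +
      inner ℝ (z (AffineMap.lineMap a b t)) (b - a) * w (AffineMap.lineMap a b t) with hJ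
  have hJc : Continuous J := ((he.comp hline).mul continuous_const).add
    (((hz.comp hline).inner continuous_const).mul ((continuous_affine w).comp hline))
  have hw : ∀ t : ℝ, w (AffineMap.lineMap a b t) = w a + t * (w b - w a) := fun t => by
    rw [AffineMap.apply_lineMap, AffineMap.lineMap_apply, vsub_eq_sub, vadd_eq_add, smul_eq_mul]
    ring
  -- up to the weight `q`, the flux is the derivative of `e^ψ w`
  have hNd : ∀ t, HasDerivAt (fun t => Real.exp (ψ t) * w (AffineMap.lineMap a b t))
      (q t * J t) t := by
    intro t
    have h1 : HasDerivAt (fun t : ℝ => w (AffineMap.lineMap a b t)) (w b - w a) t := by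
      have : (fun t : ℝ => w (AffineMap.lineMap a b t)) = fun t => w a + t * (w b - w a) :=
        funext hw
      rw [this]
      simpa using ((hasDerivAt_id t).mul_const (w b - w a)).const_add (w a)
    refine ((hψd t).exp.mul h1).congr_deriv ?_
    have := (hpos (AffineMap.lineMap a b t)).ne'
    rw [hqe]
    simp only [hJ]
    field_simp
    ring
  have hFTC : ∫ t in (0 : ℝ)..1, q t * J t = edgeDelta e z a b y := by
    rw [intervalIntegral.integral_eq_sub_of_hasDerivAt (fun t _ => hNd t)
      ((hqc.mul hJc).intervalIntegrable 0 1), edgeDelta, hya, hyb]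
    simp [hψ]
  have hQpos : 0 < ∫ t in (0 : ℝ)..1, q t :=
    intervalIntegral.intervalIntegral_pos_of_pos (hqc.intervalIntegrable 0 1) hqpos zero_lt_one
  have hH : edgeHarmonic e z a b = (∫ t in (0 : ℝ)..1, q t)⁻¹ := rfl
  have e1 : edgeHarmonic e z a b * edgeDelta e z a b y - c =
      (∫ t in (0 : ℝ)..1, q t)⁻¹ * ∫ t in (0 : ℝ)..1, q t * (J t - c) := by
    have h2 : ∫ t in (0 : ℝ)..1, q t * (J t - c) =
        (∫ t in (0 : ℝ)..1, q t * J t) - (∫ t in (0 : ℝ)..1, q t) * c := by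
      have h3 := intervalIntegral.integral_sub (μ := volume) (f := fun t => q t * J t)
        (g := fun t => q t * c) ((hqc.mul hJc).intervalIntegrable 0 1)
        ((hqc.mul continuous_const).intervalIntegrable 0 1)
      rw [← intervalIntegral.integral_mul_const, ← h3]
      congr 1
      ext t
      ring
    rw [h2, hH, ← hFTC]
    field_simp
  rw [e1, abs_mul, abs_of_pos (inv_pos.2 hQpos), inv_mul_le_iff₀ hQpos,
    ← intervalIntegral.integral_mul_const, ← Real.norm_eq_abs]
  refine intervalIntegral.norm_integral_le_of_norm_le zero_le_one (Eventually.of_forall ?_)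
    ((hqc.mul continuous_const).intervalIntegrable 0 1)
  intro t ht
  rw [Real.norm_eq_abs, abs_mul, abs_of_pos (hqpos t)]
  exact mul_le_mul_of_nonneg_left (hB t (Ioc_subset_Icc_self ht)) (hqpos t).le

/-- On one triangle, the edge-averaged form differs from the exact flux integral by one power of the
mesh size. -/
theorem abs_localForm_sub_le {ε e : Plane → ℝ} {ζ z : Plane → Plane} {T : Tri} {σ r Le Lz Z : ℝ}
    {c : Plane} (hr : 0 < r) (hball : Metric.closedBall c r ⊆ Tri.carrier T)
    (hσ : Metric.diam (Tri.carrier T) ≤ σ * (2 * r))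
    (hLe : 0 ≤ Le) (hLz : 0 ≤ Lz) (hZ : ∀ x ∈ Tri.carrier T, ‖z x‖ ≤ Z)
    (hεe : EqOn (contRep (Tri.carrier T) ε) e (Tri.carrier T))
    (hζz : EqOn (contRep (Tri.carrier T) ζ) z (Tri.carrier T))
    (he : Continuous e) (hz : Continuous z) (hpos : ∀ x, 0 < e x)
    (heL : ∀ x y, |e x - e y| ≤ Le * ‖x - y‖) (hzL : ∀ x y, ‖z x - z y‖ ≤ Lz * ‖x - y‖)
    {w v : Plane →ᵃ[ℝ] ℝ} {y y' : Plane → ℝ} (hy : ∀ x ∈ Tri.carrier T, y x = w x)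
    (hy' : ∀ x ∈ Tri.carrier T, y' x = v x) :
    |localForm ε ζ T y y' - ∫ x in Tri.carrier T, inner ℝ (e x • affGrad w + w x • z x) (affGrad v)| ≤
      ∫ x in Tri.carrier T, 3 * σ ^ 2 * Metric.diam (Tri.carrier T) * (‖affGrad v‖ *
        ((Le + Z) * ‖affGrad w‖ + Lz * |w x|)) := by
  set K := Tri.carrier T with hK
  set h := Metric.diam K with hh
  set D := volume.real K with hD
  have hh0 : 0 ≤ h := Metric.diam_nonneg
  have hcK : Convex ℝ K := Tri.convex_carrier T
  have hpt : ∀ i, T.points i ∈ K := Tri.points_mem_carrier T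
  have hZ0 : 0 ≤ Z := (norm_nonneg _).trans (hZ _ (hpt 0))
  have hDpos : 0 < D := by
    have h1 : volume K ≠ 0 := fun h0 => (isOpen_interior.measure_pos volume
      (Tri.interior_carrier_nonempty T)).ne' (measure_mono_null interior_subset h0)
    exact ENNReal.toReal_pos h1 (Tri.isCompact_carrier T).measure_lt_top.ne
  have hσ0 : 0 ≤ σ := by
    by_contra hn
    have : σ * (2 * r) < 0 := mul_neg_of_neg_of_pos (not_le.1 hn) (by positivity)
    linarith
  -- the contribution of one edge, before the weight
  set HD : Fin 3 → ℝ := fun i => edgeHarmonic e z (T.points i) (T.points (i + 1)) *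
    edgeDelta e z (T.points i) (T.points (i + 1)) y with hHD
  have hloc : localForm ε ζ T y y' = ∑ i : Fin 3, Tri.weight T i (i + 1) * HD i *
      (v (T.points (i + 1)) - v (T.points i)) := by
    simp only [localForm, hHD]
    refine Finset.sum_congr rfl fun i _ => ?_
    rw [edgeHarmonic_congr hcK (hpt i) (hpt (i + 1)) hεe hζz,
      edgeDelta_congr hcK (hpt i) (hpt (i + 1)) hεe hζz, hy' _ (hpt i), hy' _ (hpt (i + 1))]
    ring
  have hflux : ∀ x ∈ K, ∀ i : Fin 3,
      |HD i - inner ℝ (e x • affGrad w + w x • z x) (T.points (i + 1) - T.points i)| ≤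
        h ^ 2 * ((Le + Z) * ‖affGrad w‖ + Lz * |w x|) := by
    intro x hx i
    refine abs_edgeHarmonic_mul_edgeDelta_sub_le he hz hpos _ _ (w := w) (hy _ (hpt i))
      (hy _ (hpt (i + 1))) fun t ht => ?_
    set τ := T.points (i + 1) - T.points i with hτ
    have hxt : AffineMap.lineMap (T.points i) (T.points (i + 1)) t ∈ K :=
      hcK.lineMap_mem (hpt i) (hpt (i + 1)) ht
    set xt : Plane := AffineMap.lineMap (T.points i) (T.points (i + 1)) t with hxtdef
    have hτn : ‖τ‖ ≤ h := Tri.norm_sub_le_diam T (hpt _) (hpt _)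
    have hxn : ‖xt - x‖ ≤ h := Tri.norm_sub_le_diam T hxt hx
    -- between `x` and a point of the edge, the flux changes through `ε`, `w` and `ζ`
    have e1 : e xt * (w (T.points (i + 1)) - w (T.points i)) + inner ℝ (z xt) τ * w xt -
        inner ℝ (e x • affGrad w + w x • z x) τ =
        (e xt - e x) * inner ℝ (affGrad w) τ + (w xt - w x) * inner ℝ (z xt) τ +
          w x * inner ℝ (z xt - z x) τ := by
      rw [affine_sub_eq w, ← hτ, inner_add_left, real_inner_smul_left, real_inner_smul_left,
        inner_sub_left]
      ring
    rw [e1]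
    have b1 : |(e xt - e x) * inner ℝ (affGrad w) τ| ≤ (Le * h) * (‖affGrad w‖ * h) := by
      rw [abs_mul]
      refine mul_le_mul ((heL _ _).trans (by gcongr)) ((abs_real_inner_le_norm _ _).trans
        (by gcongr)) (abs_nonneg _) (by positivity)
    have b2 : |(w xt - w x) * inner ℝ (z xt) τ| ≤ (‖affGrad w‖ * h) * (Z * h) := by
      rw [abs_mul]
      refine mul_le_mul ((abs_affine_sub_le w _ _).trans (by gcongr))
        ((abs_real_inner_le_norm _ _).trans ?_) (abs_nonneg _) (by positivity)
      exact mul_le_mul (hZ _ hxt) hτn (norm_nonneg _) hZ0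
    have b3 : |w x * inner ℝ (z xt - z x) τ| ≤ |w x| * ((Lz * h) * h) := by
      rw [abs_mul]
      refine mul_le_mul_of_nonneg_left ((abs_real_inner_le_norm _ _).trans ?_) (abs_nonneg _)
      exact mul_le_mul ((hzL _ _).trans (by gcongr)) hτn (norm_nonneg _) (by positivity)
    refine (abs_add_three _ _ _).trans ?_
    have : (Le * h) * (‖affGrad w‖ * h) + (‖affGrad w‖ * h) * (Z * h) + |w x| * ((Lz * h) * h) =
      h ^ 2 * ((Le + Z) * ‖affGrad w‖ + Lz * |w x|) := by ring
    linarith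
  have hbg : ∀ i, ‖Tri.bgrad T i‖ * h ≤ σ := by
    intro i
    have h1 := Tri.norm_bgrad_le T hr hball i
    calc ‖Tri.bgrad T i‖ * h ≤ 1 / (2 * r) * (σ * (2 * r)) :=
          mul_le_mul h1 hσ hh0 (by positivity)
      _ = σ := by field_simp
  -- compare with the flux frozen at `x`, for which the weights are exact, and average over `x` below
  have hpoint : ∀ x ∈ K, |localForm ε ζ T y y' / D - inner ℝ (e x • affGrad w + w x • z x) (affGrad v)|
      ≤ 3 * σ ^ 2 * h * (‖affGrad v‖ * ((Le + Z) * ‖affGrad w‖ + Lz * |w x|)) := by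
    intro x hx
    have hQ0 : 0 ≤ (Le + Z) * ‖affGrad w‖ + Lz * |w x| := by positivity
    set Q := (Le + Z) * ‖affGrad w‖ + Lz * |w x| with hQ
    have h1 := Tri.sum_weight_mul T (e x • affGrad w + w x • z x) v
    have h2 : inner ℝ (e x • affGrad w + w x • z x) (affGrad v) = (∑ i : Fin 3,
        Tri.weight T i (i + 1) * inner ℝ (e x • affGrad w + w x • z x)
          (T.points (i + 1) - T.points i) * (v (T.points (i + 1)) - v (T.points i))) / D := by
      rw [h1]
      field_simp
      rfl
    rw [h2, hloc, ← sub_div, ← Finset.sum_sub_distrib, abs_div, abs_of_pos hDpos,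
      div_le_iff₀ hDpos]
    refine (Finset.abs_sum_le_sum_abs _ _).trans ?_
    have hterm : ∀ i : Fin 3, |Tri.weight T i (i + 1) * HD i * (v (T.points (i + 1)) - v (T.points i)) -
        Tri.weight T i (i + 1) * inner ℝ (e x • affGrad w + w x • z x)
          (T.points (i + 1) - T.points i) * (v (T.points (i + 1)) - v (T.points i))| ≤
        D * (σ ^ 2 * h * (‖affGrad v‖ * Q)) := by
      intro i
      have e1 : Tri.weight T i (i + 1) * HD i * (v (T.points (i + 1)) - v (T.points i)) -
          Tri.weight T i (i + 1) * inner ℝ (e x • affGrad w + w x • z x)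
            (T.points (i + 1) - T.points i) * (v (T.points (i + 1)) - v (T.points i)) =
          Tri.weight T i (i + 1) * ((HD i - inner ℝ (e x • affGrad w + w x • z x)
            (T.points (i + 1) - T.points i)) * (v (T.points (i + 1)) - v (T.points i))) := by ring
      rw [e1, abs_mul, abs_mul]
      have b1 : |Tri.weight T i (i + 1)| ≤ D * (‖Tri.bgrad T i‖ * ‖Tri.bgrad T (i + 1)‖) := by
        rw [Tri.weight_eq, abs_neg, abs_mul, abs_of_pos hDpos]
        exact mul_le_mul_of_nonneg_left (abs_real_inner_le_norm _ _) hDpos.le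
      have b2 : |v (T.points (i + 1)) - v (T.points i)| ≤ ‖affGrad v‖ * h :=
        (abs_affine_sub_le v _ _).trans
          (mul_le_mul_of_nonneg_left (Tri.norm_sub_le_diam T (hpt _) (hpt _)) (norm_nonneg _))
      calc _ ≤ (D * (‖Tri.bgrad T i‖ * ‖Tri.bgrad T (i + 1)‖)) *
            ((h ^ 2 * Q) * (‖affGrad v‖ * h)) := by
            refine mul_le_mul b1 (mul_le_mul (hflux x hx i) b2 (abs_nonneg _) (by positivity))
              (by positivity) (by positivity)
        _ = D * ((‖Tri.bgrad T i‖ * h) * (‖Tri.bgrad T (i + 1)‖ * h) * (h * (‖affGrad v‖ * Q))) := by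
            ring
        _ ≤ D * (σ * σ * (h * (‖affGrad v‖ * Q))) := by
            gcongr
            · exact hbg i
            · exact hbg (i + 1)
        _ = _ := by ring
    calc _ ≤ ∑ i : Fin 3, D * (σ ^ 2 * h * (‖affGrad v‖ * Q)) :=
          Finset.sum_le_sum fun i _ => hterm i
      _ = 3 * σ ^ 2 * h * (‖affGrad v‖ * Q) * D := by
          rw [Finset.sum_const, Finset.card_univ, Fintype.card_fin]
          ring
  have hKc : IsCompact K := Tri.isCompact_carrier T
  have hint1 : IntegrableOn (fun x => inner ℝ (e x • affGrad w + w x • z x) (affGrad v)) K := by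
    refine (Continuous.continuousOn ?_).integrableOn_compact hKc
    exact ((he.smul continuous_const).add ((continuous_affine w).smul hz)).inner continuous_const
  have hint0 : IntegrableOn (fun _ : Plane => localForm ε ζ T y y' / D) K :=
    continuous_const.continuousOn.integrableOn_compact hKc
  have hint2 : IntegrableOn (fun x => 3 * σ ^ 2 * h * (‖affGrad v‖ *
        ((Le + Z) * ‖affGrad w‖ + Lz * |w x|))) K := by
    refine (Continuous.continuousOn ?_).integrableOn_compact hKc
    have := (continuous_affine w).abs
    fun_prop
  have e3 : localForm ε ζ T y y' = ∫ x in K, localForm ε ζ T y y' / D := by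
    rw [setIntegral_const, smul_eq_mul]
    field_simp
    rfl
  rw [e3, ← integral_sub hint0 hint1, ← Real.norm_eq_abs]
  refine norm_integral_le_of_norm_le hint2 ?_
  filter_upwards [ae_restrict_mem hKc.measurableSet] with x hx
  exact hpoint x hx

/-! ### The finite element space -/

/-- A function on an interval that is `L`-Lipschitz on each of finitely many closed sets covering the
interval satisfies the Lipschitz bound between the end points: follow the first set up to its last
point, from where on the remaining sets cover. -/
theorem abs_sub_le_of_closed_cover {ι : Type*} [DecidableEq ι] {f : ℝ → ℝ} {L b : ℝ}
    {A : ι → Set ℝ} (hA : ∀ i, IsClosed (A i)) (s : Finset ι) :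
    ∀ a ≤ b, Icc a b ⊆ ⋃ i ∈ s, A i →
      (∀ i ∈ s, ∀ x ∈ A i ∩ Icc a b, ∀ y ∈ A i ∩ Icc a b, |f x - f y| ≤ L * |x - y|) →
      |f b - f a| ≤ L * (b - a) := by
  induction s using Finset.strongInduction with
  | H s ih =>
    intro a hab hcov hlip
    obtain ⟨k, hk, hak⟩ := mem_iUnion₂.1 (hcov (left_mem_Icc.2 hab))
    have hcomp : IsCompact (A k ∩ Icc a b) := isCompact_Icc.inter_left (hA k)
    obtain ⟨c, hc, hcmax⟩ := hcomp.exists_isGreatest ⟨a, hak, left_mem_Icc.2 hab⟩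
    have h1 := hlip k hk c hc a ⟨hak, left_mem_Icc.2 hab⟩
    rw [abs_of_nonneg (a := c - a) (by linarith [hc.2.1])] at h1
    rcases hc.2.2.eq_or_lt with hcb | hcb
    · rwa [hcb] at h1
    have hcov' : Icc c b ⊆ ⋃ i ∈ s.erase k, A i := by
      rw [← closure_Ioc hcb.ne]
      refine closure_minimal ?_ ((s.erase k).finite_toSet.isClosed_biUnion fun i _ => hA i)
      intro x hx
      have hxab : x ∈ Icc a b := ⟨hc.2.1.trans hx.1.le, hx.2⟩
      obtain ⟨i, hi, hxi⟩ := mem_iUnion₂.1 (hcov hxab)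
      refine mem_iUnion₂.2 ⟨i, ?_, hxi⟩
      refine Finset.mem_coe.2 (Finset.mem_erase.2 ⟨?_, hi⟩)
      rintro rfl
      exact absurd (hcmax ⟨hxi, hxab⟩) (not_le.2 hx.1)
    have h2 := ih (s.erase k) (Finset.erase_ssubset hk) c hcb.le hcov' (by
      intro i hi x hx y hy
      have hsub : Icc c b ⊆ Icc a b := Icc_subset_Icc_left hc.2.1
      exact hlip i (Finset.mem_of_mem_erase hi) x ⟨hx.1, hsub hx.2⟩ y ⟨hy.1, hsub hy.2⟩)
    have h3 : |f b - f a| ≤ |f b - f c| + |f c - f a| := abs_sub_le _ _ _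
    linarith

theorem lipschitzWith_of_closed_cover {ι : Type*} [Fintype ι] [DecidableEq ι] {f : Plane → ℝ}
    {L : NNReal} {A : ι → Set Plane} (hA : ∀ i, IsClosed (A i)) (hcov : ⋃ i, A i = univ)
    (hf : ∀ i, LipschitzOnWith L f (A i)) : LipschitzWith L f := by
  refine LipschitzWith.of_dist_le_mul fun y x => ?_
  have hline : Continuous fun t : ℝ => (AffineMap.lineMap x y t : Plane) :=
    AffineMap.lineMap_continuous
  have h := abs_sub_le_of_closed_cover (f := fun t => f (AffineMap.lineMap x y t))
    (L := L * dist x y) (b := 1) (A := fun i => (fun t : ℝ => (AffineMap.lineMap x y t : Plane)) ⁻¹' A i)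
    (fun i => (hA i).preimage hline) Finset.univ 0 zero_le_one (by
      intro t _
      have : AffineMap.lineMap x y t ∈ ⋃ i, A i := by
        rw [hcov]
        trivial
      obtain ⟨i, hi⟩ := mem_iUnion.1 this
      exact mem_iUnion₂.2 ⟨i, Finset.mem_univ i, hi⟩) (by
      intro i _ t ht t' ht'
      have := (hf i).dist_le_mul _ ht.1 _ ht'.1
      rw [Real.dist_eq, dist_lineMap_lineMap, Real.dist_eq] at this
      linarith)
  simp only [AffineMap.lineMap_apply_one, AffineMap.lineMap_apply_zero] at h
  rw [Real.dist_eq, dist_comm y x]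
  linarith

theorem hasWeakPartial_of_lipschitz {v : Plane → ℝ} {L : NNReal} (hv : LipschitzWith L v)
    (i : Fin 2) : HasWeakPartial univ i v (fun x => gradient v x i) := by
  have hm : Measurable fun x => fderiv ℝ v x (EuclideanSpace.single i 1) :=
    measurable_fderiv_apply_const ℝ v _
  refine ⟨hv.continuous.locallyIntegrable.locallyIntegrableOn _, ?_, fun φ hφ => ?_⟩
  · refine LocallyIntegrable.locallyIntegrableOn ?_ _
    simp only [gradient_apply]
    refine (locallyIntegrable_const (L : ℝ)).mono hm.aestronglyMeasurable
      (Eventually.of_forall fun x => ?_)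
    have h1 := (fderiv ℝ v x).le_opNorm (EuclideanSpace.single i 1)
    have h2 := norm_fderiv_le_of_lipschitz ℝ hv (x₀ := x)
    have h3 : ‖(EuclideanSpace.single i (1 : ℝ) : Plane)‖ = 1 := by simp
    rw [h3, mul_one] at h1
    exact (h1.trans h2).trans (le_abs_self _)
  · obtain ⟨D, hD⟩ := hφ.1.lipschitzWith_of_hasCompactSupport hφ.2.1 (by norm_num)
    have h := hv.integral_lineDeriv_mul_eq (μ := volume) hD hφ.2.1 (EuclideanSpace.single i 1)
    rw [Measure.restrict_univ]
    have e1 : ∫ x, lineDeriv ℝ v x (EuclideanSpace.single i 1) * φ x = ∫ x, gradient v x i * φ x := by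
      refine integral_congr_ae ?_
      filter_upwards [hv.ae_differentiableAt (μ := volume)] with x hx
      rw [hx.lineDeriv_eq_fderiv, gradient_apply]
    have e2 : ∫ x, lineDeriv ℝ φ x (-EuclideanSpace.single i 1) * v x =
        -∫ x, v x * fderiv ℝ φ x (EuclideanSpace.single i 1) := by
      rw [← integral_neg]
      congr 1
      ext x
      rw [(hφ.1.differentiable (by norm_num) x).lineDeriv_eq_fderiv, map_neg]
      ring
    rw [e1, e2] at h
    linarith

namespace Triangulation

variable {Ω : Set Plane} {M : Triangulation Ω}

theorem iUnion_option_eq_univ :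
    ⋃ o : Option M.elems, (o.elim Ωᶜ fun T => Tri.carrier T.1) = univ := by
  refine eq_univ_of_forall fun x => ?_
  by_cases hx : x ∈ Ω
  · have h1 : x ∈ ⋃ T ∈ M.elems, Tri.carrier T := by
      rw [M.cover]
      exact subset_closure hx
    obtain ⟨T, hT, hxT⟩ := mem_iUnion₂.1 h1
    exact mem_iUnion.2 ⟨some ⟨T, hT⟩, hxT⟩
  · exact mem_iUnion.2 ⟨none, hx⟩

theorem isClosed_option (hΩ : IsConvexPolygon Ω) (o : Option M.elems) :
    IsClosed (o.elim Ωᶜ fun T => Tri.carrier T.1) := by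
  cases o with
  | none => exact hΩ.isOpen.isClosed_compl
  | some T => exact Tri.isClosed_carrier T.1

theorem MemV.exists_lipschitz (hΩ : IsConvexPolygon Ω) {v : Plane → ℝ} (hv : M.MemV v) :
    ∃ L : NNReal, LipschitzWith L v := by
  classical
  choose g hg using hv.2.2
  refine ⟨∑ T : M.elems, ‖affGrad (g T.1 T.2)‖₊, ?_⟩
  refine lipschitzWith_of_closed_cover (isClosed_option hΩ) (iUnion_option_eq_univ (M := M)) ?_
  intro o
  cases o with
  | none =>
    refine LipschitzOnWith.of_dist_le_mul fun x hx y hy => ?_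
    rw [hv.2.1 x hx, hv.2.1 y hy, dist_self]
    positivity
  | some T =>
    refine LipschitzOnWith.of_dist_le_mul fun x hx y hy => ?_
    rw [hg T.1 T.2 x hx, hg T.1 T.2 y hy, Real.dist_eq, dist_eq_norm]
    refine (abs_affine_sub_le _ _ _).trans ?_
    gcongr
    exact_mod_cast Finset.single_le_sum (f := fun T : M.elems => ‖affGrad (g T.1 T.2)‖₊)
      (fun _ _ => zero_le) (Finset.mem_univ T)

theorem MemV.gradient_eq {v : Plane → ℝ} {T : Tri} {g : Plane →ᵃ[ℝ] ℝ}
    (hg : ∀ x ∈ Tri.carrier T, v x = g x) {x : Plane} (hx : x ∈ interior (Tri.carrier T)) :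
    gradient v x = affGrad g := by
  have h1 : v =ᶠ[𝓝 x] g := by
    filter_upwards [isOpen_interior.mem_nhds hx] with z hz using hg z (interior_subset hz)
  rw [← gradient_affine g x, gradient, gradient, h1.fderiv_eq]

theorem MemV.memLp_gradient (hΩ : IsConvexPolygon Ω) {v : Plane → ℝ} (hv : M.MemV v) :
    MemLp (gradient v) 2 volume := by
  obtain ⟨L, hL⟩ := hv.exists_lipschitz hΩ
  have hm : Measurable (gradient v) :=
    (LinearIsometryEquiv.continuous _).measurable.comp (measurable_fderiv ℝ v)
  have hb : ∀ x, ‖gradient v x‖ ≤ L := fun x => by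
    rw [gradient, LinearIsometryEquiv.norm_map]
    exact norm_fderiv_le_of_lipschitz ℝ hL
  have h0 : ∀ x, x ∉ closure Ω → gradient v x = 0 := by
    intro x hx
    have h1 : v =ᶠ[𝓝 x] fun _ => 0 := by
      filter_upwards [isClosed_closure.isOpen_compl.mem_nhds hx] with z hz
      exact hv.2.1 z fun h => hz (subset_closure h)
    rw [gradient, h1.fderiv_eq]
    simp
  have h2 : MemLp (gradient v) 2 (volume.restrict (closure Ω)) := by
    have : IsFiniteMeasure (volume.restrict (closure Ω)) :=
      ⟨by simpa using hΩ.isBounded.isCompact_closure.measure_lt_top⟩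
    exact MemLp.of_bound hm.aestronglyMeasurable L (Eventually.of_forall hb)
  have h3 : (closure Ω).indicator (gradient v) = gradient v := by
    rw [indicator_eq_self]
    intro x hx
    by_contra h
    exact hx (h0 x h)
  rw [← h3]
  exact (memLp_indicator_iff_restrict isClosed_closure.measurableSet).2 h2

theorem MemV.memLp (hΩ : IsConvexPolygon Ω) {v : Plane → ℝ} (hv : M.MemV v) :
    MemLp v 2 volume := by
  refine hv.1.memLp_of_hasCompactSupport ?_
  refine HasCompactSupport.intro hΩ.isBounded.isCompact_closure fun x hx => ?_
  exact hv.2.1 x fun h => hx (subset_closure h)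

/-- The weak gradient of a finite element function is its pointwise gradient, which takes the junk
value `0` where the function is not differentiable, a null set. -/
theorem MemV.isH1 (hΩ : IsConvexPolygon Ω) {v : Plane → ℝ} (hv : M.MemV v) :
    IsH1 Ω v (gradient v) := by
  obtain ⟨L, hL⟩ := hv.exists_lipschitz hΩ
  exact ⟨(hv.memLp hΩ).restrict Ω, (hv.memLp_gradient hΩ).restrict Ω,
    fun i => (hasWeakPartial_of_lipschitz hL i).mono (subset_univ _)⟩

theorem MemV.memH10 (hΩ : IsConvexPolygon Ω) {v : Plane → ℝ} (hv : M.MemV v) : MemH10 Ω v := by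
  obtain ⟨L, hL⟩ := hv.exists_lipschitz hΩ
  exact memH10_of_support_subset hΩ.isOpen hΩ.convex hΩ.isBounded hΩ.1 (hv.memLp hΩ)
    (hv.memLp_gradient hΩ) (hasWeakPartial_of_lipschitz hL)
    fun x hx => hv.2.1 x fun h => hx (subset_closure h)

theorem MemV.eq_of_vertices {v w : Plane → ℝ} (hv : M.MemV v) (hw : M.MemV w)
    (h : ∀ T ∈ M.elems, ∀ i, v (T.points i) = w (T.points i)) : v = w := by
  ext x
  by_cases hx : x ∈ Ω
  · have h1 : x ∈ ⋃ T ∈ M.elems, Tri.carrier T := by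
      rw [M.cover]
      exact subset_closure hx
    obtain ⟨T, hT, hxT⟩ := mem_iUnion₂.1 h1
    obtain ⟨g, hg⟩ := hv.2.2 T hT
    obtain ⟨g', hg'⟩ := hw.2.2 T hT
    rw [hg x hxT, hg' x hxT, Tri.affine_eq_sum T g, Tri.affine_eq_sum T g']
    refine Finset.sum_congr rfl fun i _ => ?_
    rw [← hg _ (Tri.points_mem_carrier T i), ← hg' _ (Tri.points_mem_carrier T i), h T hT i]
  · rw [hv.2.1 x hx, hw.2.1 x hx]

variable (M) in
/-- The finite element space `V_h` as a vector space. -/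
def femSpace : Submodule ℝ (Plane → ℝ) where
  carrier := {v | M.MemV v}
  zero_mem' := ⟨continuous_const, fun _ _ => rfl, fun _ _ => ⟨AffineMap.const ℝ Plane 0, fun _ _ => rfl⟩⟩
  add_mem' := by
    rintro v w ⟨h1, h2, h3⟩ ⟨h1', h2', h3'⟩
    refine ⟨h1.add h1', fun x hx => by simp [h2 x hx, h2' x hx], fun T hT => ?_⟩
    obtain ⟨g, hg⟩ := h3 T hT
    obtain ⟨g', hg'⟩ := h3' T hT
    exact ⟨g + g', fun x hx => by simp [hg x hx, hg' x hx]⟩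
  smul_mem' := by
    rintro c v ⟨h1, h2, h3⟩
    refine ⟨h1.const_smul c, fun x hx => by simp [h2 x hx], fun T hT => ?_⟩
    obtain ⟨g, hg⟩ := h3 T hT
    exact ⟨c • g, fun x hx => by simp [hg x hx]⟩

theorem mem_femSpace {v : Plane → ℝ} : v ∈ M.femSpace ↔ M.MemV v := Iff.rfl

instance finiteDimensional_femSpace : FiniteDimensional ℝ M.femSpace := by
  let ev : M.femSpace →ₗ[ℝ] (M.elems × Fin 3 → ℝ) :=
    { toFun := fun v p => v.1 (p.1.1.points p.2)
      map_add' := fun _ _ => rfl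
      map_smul' := fun _ _ => rfl }
  refine FiniteDimensional.of_injective ev fun v w h => ?_
  refine Subtype.ext (MemV.eq_of_vertices v.2 w.2 fun T hT i => ?_)
  exact congrFun h (⟨T, hT⟩, i)

/-- The affine function on a triangle with prescribed values at its vertices. -/
def interp (T : Tri) (a : Plane → ℝ) : Plane →ᵃ[ℝ] ℝ :=
  a (T.points 0) • Tri.coord T 0 + a (T.points 1) • Tri.coord T 1 + a (T.points 2) • Tri.coord T 2

theorem interp_apply (T : Tri) (a : Plane → ℝ) (x : Plane) :
    interp T a x = ∑ i : Fin 3, Tri.coord T i x * a (T.points i) := by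
  simp [interp, Fin.sum_univ_three, mul_comm]

theorem interp_points (T : Tri) (a : Plane → ℝ) (i : Fin 3) :
    interp T a (T.points i) = a (T.points i) := by
  rw [interp_apply]
  simp [Tri.coord_points]

/-- A boundary point of `Ω` in a triangle only involves vertices on the boundary. -/
theorem interp_eq_zero (hΩ : IsConvexPolygon Ω) {T : Tri} (hT : T ∈ M.elems) {a : Plane → ℝ}
    (ha : ∀ x ∈ closure Ω, x ∉ Ω → a x = 0) {x : Plane} (hxT : x ∈ Tri.carrier T) (hx : x ∉ Ω) :
    interp T a x = 0 := by
  obtain ⟨f, hf⟩ := geometric_hahn_banach_open_point hΩ.convex hΩ.isOpen hx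
  have hfc : ∀ z ∈ closure Ω, f z ≤ f x := fun z hz =>
    closure_minimal (fun z hz => (hf z hz).le) (isClosed_le f.continuous continuous_const) hz
  have hpt : ∀ i, T.points i ∈ closure Ω := fun i =>
    M.carrier_subset hT (Tri.points_mem_carrier T i)
  have h0 : ∑ i : Fin 3, Tri.coord T i x * (f x - f (T.points i)) = 0 := by
    have h1 : f x = ∑ i : Fin 3, Tri.coord T i x * f (T.points i) := by
      conv_lhs => rw [← Tri.sum_coord_smul T x]
      simp
    have h2 := Tri.sum_coord T x
    simp only [mul_sub, Finset.sum_sub_distrib]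
    rw [← Finset.sum_mul, h2, one_mul, ← h1, sub_self]
  have hnn := (Tri.mem_carrier_iff T).1 hxT
  have h1 := (Finset.sum_eq_zero_iff_of_nonneg fun i _ =>
    mul_nonneg (hnn i) (sub_nonneg.2 (hfc _ (hpt i)))).1 h0
  rw [interp_apply]
  refine Finset.sum_eq_zero fun i hi => ?_
  rcases mul_eq_zero.1 (h1 i hi) with h2 | h2
  · rw [h2, zero_mul]
  · rw [ha _ (hpt i), mul_zero]
    intro hin
    have := hf _ hin
    linarith

theorem interp_eq_interp {T T' : Tri} (hT : T ∈ M.elems) (hT' : T' ∈ M.elems) (a : Plane → ℝ)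
    {x : Plane} (hx : x ∈ Tri.carrier T) (hx' : x ∈ Tri.carrier T') :
    interp T a x = interp T' a x := by
  by_cases hne : T = T'
  · rw [hne]
  have h1 : x ∈ convexHull ℝ (range T.points ∩ range T'.points) := by
    rw [← (M.conforming T hT T' hT' hne).2]
    exact ⟨hx, hx'⟩
  have h2 : convexHull ℝ (range T.points ∩ range T'.points) ⊆
      (interp T a - interp T' a : Plane →ᵃ[ℝ] ℝ) ⁻¹' {0} := by
    refine convexHull_min ?_ ((convex_singleton _).affine_preimage _)
    rintro z ⟨⟨i, hi⟩, ⟨j, hj⟩⟩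
    have e1 : interp T a z = a z := by
      rw [← hi]
      exact interp_points T a i
    have e2 : interp T' a z = a z := by
      rw [← hj]
      exact interp_points T' a j
    simp [e1, e2]
  have h3 := h2 h1
  simp only [mem_preimage, AffineMap.coe_sub, Pi.sub_apply, mem_singleton_iff] at h3
  linarith

/-- The nodal interpolant of values that vanish at the boundary vertices. -/
theorem exists_interpolant (hΩ : IsConvexPolygon Ω) {a : Plane → ℝ}
    (ha : ∀ x ∈ closure Ω, x ∉ Ω → a x = 0) :
    ∃ v, M.MemV v ∧ ∀ T ∈ M.elems, ∀ x ∈ Tri.carrier T, v x = interp T a x := by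
  classical
  let v : Plane → ℝ := fun x =>
    if h : ∃ T ∈ M.elems, x ∈ Tri.carrier T then interp h.choose a x else 0
  have hv : ∀ T ∈ M.elems, ∀ x ∈ Tri.carrier T, v x = interp T a x := by
    intro T hT x hx
    have h : ∃ T ∈ M.elems, x ∈ Tri.carrier T := ⟨T, hT, hx⟩
    simp only [v, dif_pos h]
    exact interp_eq_interp h.choose_spec.1 hT a h.choose_spec.2 hx
  have hv0 : ∀ x, x ∉ Ω → v x = 0 := by
    intro x hx
    by_cases h : ∃ T ∈ M.elems, x ∈ Tri.carrier T
    · obtain ⟨T, hT, hxT⟩ := h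
      rw [hv T hT x hxT]
      exact interp_eq_zero hΩ hT ha hxT hx
    · simp only [v, dif_neg h]
  refine ⟨v, ⟨?_, hv0, fun T hT => ⟨interp T a, hv T hT⟩⟩, hv⟩
  refine (locallyFinite_of_finite _).continuous (iUnion_option_eq_univ (M := M))
    (isClosed_option hΩ) fun o => ?_
  cases o with
  | none => exact continuousOn_const.congr fun x hx => hv0 x hx
  | some T => exact (continuous_affine (interp T.1 a)).continuousOn.congr fun x hx => hv T.1 T.2 x hx

end Triangulation

/-! ### The bilinear forms -/

/-- The form `a` in terms of functions and their gradients. -/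
def gradForm (Ω : Set Plane) (ε : Plane → ℝ) (ζ : Plane → Plane) (γ : Plane → ℝ)
    (f : Plane → ℝ) (F : Plane → Plane) (g : Plane → ℝ) (G : Plane → Plane) : ℝ :=
  (∫ x in Ω, inner ℝ (ε x • F x + f x • ζ x) (G x)) + ∫ x in Ω, γ x * f x * g x

section Form

variable {Ω : Set Plane} {ε : Plane → ℝ} {ζ : Plane → Plane} {γ : Plane → ℝ}
variable {f g f' g' : Plane → ℝ} {F G F' G' : Plane → Plane}

theorem formA_eq_gradForm (hΩ : IsOpen Ω) (hf : IsH1 Ω f F) (hg : IsH1 Ω g G) :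
    formA Ω ε ζ γ f g = gradForm Ω ε ζ γ f F g G := by
  rw [formA, gradForm]
  congr 1
  refine integral_congr_ae ?_
  filter_upwards [hf.weakGrad_ae hΩ, hg.weakGrad_ae hΩ] with x h1 h2
  rw [h1, h2]

theorem memLp_flux (hε : MemLp ε ⊤ (volume.restrict Ω)) (hζ : MemLp ζ ⊤ (volume.restrict Ω))
    (hf : IsH1 Ω f F) : MemLp (fun x => ε x • F x + f x • ζ x) 2 (volume.restrict Ω) :=
  (memLp_two_smul hε hf.2.1).add (memLp_two_smul_top hf.1 hζ)

theorem integrable_reaction (hγ : MemLp γ ⊤ (volume.restrict Ω))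
    (hf : MemLp f 2 (volume.restrict Ω)) (hg : MemLp g 2 (volume.restrict Ω)) :
    IntegrableOn (fun x => γ x * f x * g x) Ω :=
  integrable_mul_of_memLp_two (memLp_two_mul hγ hf) hg

theorem gradForm_sub_left (hε : MemLp ε ⊤ (volume.restrict Ω))
    (hζ : MemLp ζ ⊤ (volume.restrict Ω)) (hγ : MemLp γ ⊤ (volume.restrict Ω))
    (hf : IsH1 Ω f F) (hf' : IsH1 Ω f' F') (hg : IsH1 Ω g G) :
    gradForm Ω ε ζ γ (fun x => f x - f' x) (fun x => F x - F' x) g G =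
      gradForm Ω ε ζ γ f F g G - gradForm Ω ε ζ γ f' F' g G := by
  have i1 := integrable_inner_of_memLp_two (memLp_flux hε hζ hf) hg.2.1
  have i2 := integrable_inner_of_memLp_two (memLp_flux hε hζ hf') hg.2.1
  have j1 := integrable_reaction hγ hf.1 hg.1
  have j2 := integrable_reaction hγ hf'.1 hg.1
  have e1 := integral_sub i1 i2
  have e2 := integral_sub j1 j2
  simp only [gradForm]
  have h1 : ∫ x in Ω, inner ℝ (ε x • (F x - F' x) + (f x - f' x) • ζ x) (G x) =
      ∫ x in Ω, (inner ℝ (ε x • F x + f x • ζ x) (G x) -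
        inner ℝ (ε x • F' x + f' x • ζ x) (G x)) := by
    congr 1
    ext x
    rw [← inner_sub_left]
    congr 1
    module
  have h2 : ∫ x in Ω, γ x * (f x - f' x) * g x =
      ∫ x in Ω, (γ x * f x * g x - γ x * f' x * g x) := by
    congr 1
    ext x
    ring
  rw [h1, h2, e1, e2]
  ring

theorem gradForm_sub_right (hε : MemLp ε ⊤ (volume.restrict Ω))
    (hζ : MemLp ζ ⊤ (volume.restrict Ω)) (hγ : MemLp γ ⊤ (volume.restrict Ω))
    (hf : IsH1 Ω f F) (hg : IsH1 Ω g G) (hg' : IsH1 Ω g' G') :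
    gradForm Ω ε ζ γ f F (fun x => g x - g' x) (fun x => G x - G' x) =
      gradForm Ω ε ζ γ f F g G - gradForm Ω ε ζ γ f F g' G' := by
  have i1 := integrable_inner_of_memLp_two (memLp_flux hε hζ hf) hg.2.1
  have i2 := integrable_inner_of_memLp_two (memLp_flux hε hζ hf) hg'.2.1
  have j1 := integrable_reaction hγ hf.1 hg.1
  have j2 := integrable_reaction hγ hf.1 hg'.1
  have e1 := integral_sub i1 i2
  have e2 := integral_sub j1 j2
  simp only [gradForm, inner_sub_right, mul_sub]
  rw [e1, e2]
  ring

theorem integrableOn_energy (hf : IsH1 Ω f F) :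
    IntegrableOn (fun x => f x ^ 2 + ‖F x‖ ^ 2) Ω :=
  hf.1.integrable_sq.add (integrable_norm_sq hf.2.1)

theorem integral_energy (hf : IsH1 Ω f F) :
    ∫ x in Ω, (f x ^ 2 + ‖F x‖ ^ 2) = energy Ω f F :=
  integral_add hf.1.integrable_sq (integrable_norm_sq hf.2.1)

theorem mul_le_young {a b c d t : ℝ} (ht : 0 < t) :
    (a + b) * (c + d) ≤ t⁻¹ * (a ^ 2 + b ^ 2) + t * (c ^ 2 + d ^ 2) := by
  have h1 : t⁻¹ * (a ^ 2 + b ^ 2) + t * (c ^ 2 + d ^ 2) - (a + b) * (c + d) =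
      t⁻¹ * ((a + b - t * (c + d)) ^ 2 / 2 + (a - b) ^ 2 / 2 + t ^ 2 * ((c - d) ^ 2 / 2)) := by
    field_simp
    ring
  have h2 : 0 ≤ t⁻¹ * ((a + b - t * (c + d)) ^ 2 / 2 + (a - b) ^ 2 / 2 +
      t ^ 2 * ((c - d) ^ 2 / 2)) := by
    positivity
  linarith

/-- Boundedness of the form on `H¹`, with a free parameter in Young's inequality. -/
theorem exists_abs_gradForm_le (hε : MemLp ε ⊤ (volume.restrict Ω))
    (hζ : MemLp ζ ⊤ (volume.restrict Ω)) (hγ : MemLp γ ⊤ (volume.restrict Ω)) :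
    ∃ K : ℝ, 0 < K ∧ ∀ (f : Plane → ℝ) (F : Plane → Plane) (g : Plane → ℝ) (G : Plane → Plane),
      IsH1 Ω f F → IsH1 Ω g G → ∀ t : ℝ, 0 < t →
        |gradForm Ω ε ζ γ f F g G| ≤ K * (t⁻¹ * energy Ω f F + t * energy Ω g G) := by
  obtain ⟨A, hA0, hA⟩ := exists_ae_norm_le hε
  obtain ⟨B, hB0, hB⟩ := exists_ae_norm_le hζ
  obtain ⟨C, hC0, hC⟩ := exists_ae_norm_le hγ
  refine ⟨A + B + C + 1, by positivity, fun f F g G hf hg t ht => ?_⟩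
  have i1 := integrable_inner_of_memLp_two (memLp_flux hε hζ hf) hg.2.1
  have j1 := integrable_reaction hγ hf.1 hg.1
  rw [gradForm, ← integral_add i1 j1, ← Real.norm_eq_abs]
  have hint : IntegrableOn (fun x => (A + B + C + 1) * (t⁻¹ * (f x ^ 2 + ‖F x‖ ^ 2) +
      t * (g x ^ 2 + ‖G x‖ ^ 2))) Ω :=
    (((integrableOn_energy hf).const_mul _).add ((integrableOn_energy hg).const_mul _)).const_mul _
  refine (norm_integral_le_of_norm_le hint ?_).trans_eq ?_
  · filter_upwards [hA, hB, hC] with x h1 h2 h3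
    have b1 : ‖(inner ℝ (ε x • F x + f x • ζ x) (G x) : ℝ)‖ ≤ (A * ‖F x‖ + |f x| * B) * ‖G x‖ := by
      refine (norm_inner_le_norm _ _).trans (mul_le_mul_of_nonneg_right
        ((norm_add_le _ _).trans ?_) (norm_nonneg _))
      rw [norm_smul, norm_smul, Real.norm_eq_abs (f x)]
      gcongr
    have b2 : ‖γ x * f x * g x‖ ≤ C * |f x| * |g x| := by
      rw [norm_mul, norm_mul, Real.norm_eq_abs (f x), Real.norm_eq_abs (g x)]
      gcongr
    have h4 := mul_le_young (a := |f x|) (b := ‖F x‖) (c := |g x|) (d := ‖G x‖) ht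
    rw [sq_abs, sq_abs] at h4
    refine (norm_add_le _ _).trans ((add_le_add b1 b2).trans ?_)
    have n1 := norm_nonneg (F x)
    have n2 := norm_nonneg (G x)
    have n3 := abs_nonneg (f x)
    have n4 := abs_nonneg (g x)
    have p1 := mul_nonneg n1 n2
    have p2 := mul_nonneg n3 n2
    have p3 := mul_nonneg n3 n4
    have p4 := mul_nonneg n1 n4
    calc (A * ‖F x‖ + |f x| * B) * ‖G x‖ + C * |f x| * |g x|
        ≤ (A + B + C + 1) * ((|f x| + ‖F x‖) * (|g x| + ‖G x‖)) := by
          have e : (A + B + C + 1) * ((|f x| + ‖F x‖) * (|g x| + ‖G x‖)) -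
            ((A * ‖F x‖ + |f x| * B) * ‖G x‖ + C * |f x| * |g x|) =
            (B + C + 1) * (‖F x‖ * ‖G x‖) + (A + C + 1) * (|f x| * ‖G x‖) +
            (A + B + 1) * (|f x| * |g x|) + (A + B + C + 1) * (‖F x‖ * |g x|) := by ring
          have : 0 ≤ (B + C + 1) * (‖F x‖ * ‖G x‖) + (A + C + 1) * (|f x| * ‖G x‖) +
            (A + B + 1) * (|f x| * |g x|) + (A + B + C + 1) * (‖F x‖ * |g x|) := by positivity
          linarith
      _ ≤ _ := mul_le_mul_of_nonneg_left h4 (by positivity)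
  · rw [integral_const_mul, integral_add ((integrableOn_energy hf).const_mul _)
      ((integrableOn_energy hg).const_mul _), integral_const_mul, integral_const_mul,
      integral_energy hf, integral_energy hg]

theorem memLp_vector_of_memW1Inf (hζ : ∀ i : Fin 2, MemW1Inf Ω (fun x => ζ x i)) :
    MemLp ζ ⊤ (volume.restrict Ω) :=
  MemLp.of_eval_piLp fun i => (hζ i).1

theorem memLp_weakDiv (hζ : ∀ i : Fin 2, MemW1Inf Ω (fun x => ζ x i)) :
    MemLp (weakDiv Ω ζ) ⊤ (volume.restrict Ω) := by
  have := memLp_finsetSum (μ := volume.restrict Ω) (p := ⊤) Finset.univ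
    (f := fun i : Fin 2 => weakPartial Ω i fun z => ζ z i) fun i _ => ((hζ i).2 i).2
  exact this

/-- The convection term against the function itself is `-½ ∫ (∇·ζ) v²`: for test functions this is
the definition of the weak divergence, tested with `v²`. -/
theorem integral_convection_self (hΩ : IsOpen Ω) (hb : Bornology.IsBounded Ω)
    (hζ : ∀ i : Fin 2, MemW1Inf Ω (fun x => ζ x i)) {v : Plane → ℝ} (hv : MemH10 Ω v) :
    ∫ x in Ω, inner ℝ (v x • ζ x) (weakGrad Ω v x) =
      -∫ x in Ω, (1 / 2 * weakDiv Ω ζ x * v x) * v x := by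
  obtain ⟨φ, hφ, h0, h1⟩ := hv.exists_tendsto hΩ hb
  have hvH := hv.1.isH1
  have hζm := memLp_vector_of_memW1Inf hζ
  have hdm : MemLp (fun x => 1 / 2 * weakDiv Ω ζ x) ⊤ (volume.restrict Ω) :=
    (memLp_weakDiv hζ).const_mul _
  have hC1 : ∀ n, ContDiff ℝ 1 (φ n) := fun n => (hφ n).1.of_le (by norm_num)
  have hφH : ∀ n, IsH1 Ω (φ n) (gradient (φ n)) := fun n => isH1_of_contDiff hb (hC1 n)
  have hmulL : ∀ {c : Plane → ℝ}, MemLp c ⊤ (volume.restrict Ω) →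
      Tendsto (fun n => ∫ x in Ω, ‖c x * φ n x - c x * v x‖ ^ 2) atTop (𝓝 0) := by
    intro c hc
    obtain ⟨B, hB0, hB⟩ := exists_ae_norm_le hc
    have h2 := h0.const_mul (B ^ 2)
    rw [mul_zero] at h2
    refine squeeze_zero (fun n => integral_nonneg fun _ => sq_nonneg _) (fun n => ?_) h2
    rw [← integral_const_mul]
    refine integral_mono_ae (integrable_norm_sq ((memLp_two_mul hc (hφH n).1).sub
      (memLp_two_mul hc hvH.1))) ((integrable_norm_sq ((hφH n).1.sub hvH.1)).const_mul _) ?_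
    filter_upwards [hB] with x hx
    rw [← mul_sub, norm_mul, mul_pow]
    gcongr
  have hsmulL : Tendsto (fun n => ∫ x in Ω, ‖φ n x • ζ x - v x • ζ x‖ ^ 2) atTop (𝓝 0) := by
    obtain ⟨B, hB0, hB⟩ := exists_ae_norm_le hζm
    have h2 := h0.const_mul (B ^ 2)
    rw [mul_zero] at h2
    refine squeeze_zero (fun n => integral_nonneg fun _ => sq_nonneg _) (fun n => ?_) h2
    rw [← integral_const_mul]
    refine integral_mono_ae (integrable_norm_sq ((memLp_two_smul_top (hφH n).1 hζm).sub
      (memLp_two_smul_top hvH.1 hζm))) ((integrable_norm_sq ((hφH n).1.sub hvH.1)).const_mul _) ?_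
    filter_upwards [hB] with x hx
    rw [← sub_smul, norm_smul, mul_pow, mul_comm]
    gcongr
  have t1 := tendsto_integral_inner (fun n => memLp_two_smul_top (hφH n).1 hζm)
    (fun n => (hφH n).2.1) (memLp_two_smul_top hvH.1 hζm) hvH.2.1 hsmulL h1
  have t2 := tendsto_integral_inner (fun n => memLp_two_mul hdm (hφH n).1)
    (fun n => (hφH n).1) (memLp_two_mul hdm hvH.1) hvH.1 (hmulL hdm) h0
  have key : ∀ n, ∫ x in Ω, inner ℝ (φ n x • ζ x) (gradient (φ n) x) =
      -∫ x in Ω, inner ℝ (1 / 2 * weakDiv Ω ζ x * φ n x) (φ n x) := by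
    intro n
    have htest : IsTest Ω fun x => φ n x * φ n x :=
      ⟨(hφ n).1.mul (hφ n).1, (hφ n).2.1.mul_left, (tsupport_mul_subset_left).trans (hφ n).2.2⟩
    have hd : ∀ x e, fderiv ℝ (fun x => φ n x * φ n x) x e = 2 * (φ n x * fderiv ℝ (φ n) x e) := by
      intro x e
      have hx := (hφ n).1.differentiable (by norm_num) x
      rw [fderiv_fun_mul hx hx]
      simp only [_root_.add_apply, _root_.smul_apply, smul_eq_mul]
      ring
    have hi : ∀ i : Fin 2, ∫ x in Ω, ζ x i * (φ n x * gradient (φ n) x i) =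
        -∫ x in Ω, 1 / 2 * (weakPartial Ω i (fun z => ζ z i) x * (φ n x * φ n x)) := by
      intro i
      have hw := (weakPartial_spec ((hζ i).2 i).1).2.2 _ htest
      rw [integral_const_mul]
      have e1 : ∫ x in Ω, ζ x i * fderiv ℝ (fun x => φ n x * φ n x) x (EuclideanSpace.single i 1) =
          2 * ∫ x in Ω, ζ x i * (φ n x * gradient (φ n) x i) := by
        rw [← integral_const_mul]
        congr 1
        ext x
        rw [hd, gradient_apply]
        ring
      rw [e1] at hw
      linarith
    have hint : ∀ i : Fin 2, IntegrableOn (fun x => ζ x i * (φ n x * gradient (φ n) x i)) Ω := by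
      intro i
      have := integrable_mul_of_memLp_two (memLp_two_mul (hζ i).1 (hφH n).1)
        ((hφH n).2.1.eval_piLp i)
      refine this.congr (Eventually.of_forall fun x => ?_)
      simp only
      ring
    have hint2 : ∀ i : Fin 2, IntegrableOn
        (fun x => 1 / 2 * (weakPartial Ω i (fun z => ζ z i) x * (φ n x * φ n x))) Ω := by
      intro i
      refine Integrable.const_mul ?_ _
      have := integrable_mul_of_memLp_two (memLp_two_mul ((hζ i).2 i).2 (hφH n).1) (hφH n).1
      refine this.congr (Eventually.of_forall fun x => ?_)
      simp only
      ring
    have e2 : ∫ x in Ω, inner ℝ (φ n x • ζ x) (gradient (φ n) x) =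
        ∑ i : Fin 2, ∫ x in Ω, ζ x i * (φ n x * gradient (φ n) x i) := by
      rw [← integral_finsetSum _ fun i _ => hint i]
      congr 1
      ext x
      rw [PiLp.inner_apply]
      refine Finset.sum_congr rfl fun i _ => ?_
      simp only [PiLp.smul_apply, smul_eq_mul, RCLike.inner_apply, conj_trivial]
      ring
    have e3 : ∫ x in Ω, inner ℝ (1 / 2 * weakDiv Ω ζ x * φ n x) (φ n x) =
        ∑ i : Fin 2, ∫ x in Ω, 1 / 2 * (weakPartial Ω i (fun z => ζ z i) x * (φ n x * φ n x)) := by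
      rw [← integral_finsetSum _ fun i _ => hint2 i]
      congr 1
      ext x
      rw [weakDiv, ← Finset.mul_sum, ← Finset.sum_mul]
      simp only [RCLike.inner_apply, conj_trivial]
      ring
    rw [e2, e3, ← Finset.sum_neg_distrib]
    exact Finset.sum_congr rfl fun i _ => hi i
  have t3 := tendsto_nhds_unique (t1.congr key) t2.neg
  rw [t3]
  congr 2
  ext x
  simp only [RCLike.inner_apply, conj_trivial]
  ring

/-- Coercivity of the form on `H¹₀`. -/
theorem formA_self_ge (hΩ : IsOpen Ω) (hb : Bornology.IsBounded Ω) {ε₀ γ₀ : ℝ}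
    (hε : MemLp ε ⊤ (volume.restrict Ω)) (hε_low : ∀ᵐ x ∂(volume.restrict Ω), ε₀ ≤ ε x)
    (hζ : ∀ i : Fin 2, MemW1Inf Ω (fun x => ζ x i)) (hγ : MemLp γ ⊤ (volume.restrict Ω))
    (hγζ : ∀ᵐ x ∂(volume.restrict Ω), γ₀ ≤ γ x - 1 / 2 * weakDiv Ω ζ x)
    {v : Plane → ℝ} (hv : MemH10 Ω v) :
    min ε₀ γ₀ * energy Ω v (weakGrad Ω v) ≤ formA Ω ε ζ γ v v := by
  have hvH := hv.1.isH1
  have hζm := memLp_vector_of_memW1Inf hζ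
  have hdm : MemLp (fun x => 1 / 2 * weakDiv Ω ζ x) ⊤ (volume.restrict Ω) :=
    (memLp_weakDiv hζ).const_mul _
  have hconv := integral_convection_self hΩ hb hζ hv
  have i1 := integrable_inner_of_memLp_two (memLp_two_smul hε hvH.2.1) hvH.2.1
  have i2 := integrable_inner_of_memLp_two (memLp_two_smul_top hvH.1 hζm) hvH.2.1
  have i3 := integrable_reaction hγ hvH.1 hvH.1
  have i4 := integrable_reaction hdm hvH.1 hvH.1
  have e1 : formA Ω ε ζ γ v v = (∫ x in Ω, inner ℝ (ε x • weakGrad Ω v x) (weakGrad Ω v x)) +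
      ((∫ x in Ω, γ x * v x * v x) - ∫ x in Ω, 1 / 2 * weakDiv Ω ζ x * v x * v x) := by
    rw [formA]
    simp only [inner_add_left]
    rw [integral_add i1 i2, hconv]
    ring
  have e2 := integral_add i1 (i3.sub i4)
  simp only [Pi.sub_apply] at e2
  rw [e1, ← integral_sub i3 i4, ← e2, ← integral_energy hvH,
    ← integral_const_mul]
  refine integral_mono_ae ((integrableOn_energy hvH).const_mul _) (i1.add (i3.sub i4)) ?_
  filter_upwards [hε_low, hγζ] with x h1 h2
  rw [real_inner_smul_left, real_inner_self_eq_norm_sq]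
  have h3 : min ε₀ γ₀ ≤ ε x := (min_le_left _ _).trans h1
  have h4 : min ε₀ γ₀ ≤ γ x - 1 / 2 * weakDiv Ω ζ x := (min_le_right _ _).trans h2
  have h5 := mul_le_mul_of_nonneg_right h3 (sq_nonneg ‖weakGrad Ω v x‖)
  have h6 := mul_le_mul_of_nonneg_right h4 (sq_nonneg (v x))
  nlinarith

end Form

/-! ### Consistency of the edge-averaged form -/

theorem norm_le_abs_add_abs (v : Plane) : ‖v‖ ≤ |v 0| + |v 1| := by
  rw [EuclideanSpace.norm_eq, Fin.sum_univ_two]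
  refine Real.sqrt_le_iff.2 ⟨by positivity, ?_⟩
  simp only [Real.norm_eq_abs]
  nlinarith [mul_nonneg (abs_nonneg (v 0)) (abs_nonneg (v 1))]

theorem exists_coe_bound {Ω : Set Plane} {g : Plane → ℝ} (hg : MemLp g ⊤ (volume.restrict Ω)) :
    ∃ L : NNReal, ∀ᵐ x ∂(volume.restrict Ω), |g x| ≤ L := by
  obtain ⟨C, hC0, hC⟩ := exists_ae_norm_le hg
  exact ⟨⟨C, hC0⟩, hC⟩

theorem MemW1Inf.exists_lipschitz {Ω : Set Plane} (hΩ : IsOpen Ω) (hc : Convex ℝ Ω)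
    (hb : Bornology.IsBounded Ω) (hne : Ω.Nonempty) {f : Plane → ℝ} (hf : MemW1Inf Ω f) :
    ∃ (L : NNReal) (F : Plane → ℝ), LipschitzWith L F ∧ F =ᵐ[volume.restrict Ω] f := by
  choose L hL using fun i => exists_coe_bound (hf.2 i).2
  obtain ⟨F, hF⟩ := exists_lipschitz_representative hΩ hc hb hne hf.1
    (fun i => weakPartial_spec (hf.2 i).1) (L := L 0 + L 1) (by
      intro i
      filter_upwards [hL i] with x hx
      refine hx.trans ?_
      push_cast
      fin_cases i
      · simp
      · simp)
  exact ⟨_, F, hF⟩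

theorem exists_lipschitz_vector_representative {Ω : Set Plane} (hΩ : IsOpen Ω) (hc : Convex ℝ Ω)
    (hb : Bornology.IsBounded Ω) (hne : Ω.Nonempty) {ζ : Plane → Plane}
    (hζ : ∀ i : Fin 2, MemW1Inf Ω (fun x => ζ x i)) :
    ∃ (L : ℝ) (z : Plane → Plane), 0 ≤ L ∧ Continuous z ∧ (∀ x y, ‖z x - z y‖ ≤ L * ‖x - y‖) ∧
      z =ᵐ[volume.restrict Ω] ζ := by
  choose L F hF hFζ using fun i => (hζ i).exists_lipschitz hΩ hc hb hne
  refine ⟨L 0 + L 1, fun x => WithLp.toLp 2 fun i => F i x, by positivity, ?_, ?_, ?_⟩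
  · exact (PiLp.continuous_toLp 2 _).comp (continuous_pi fun i => (hF i).continuous)
  · intro x y
    refine (norm_le_abs_add_abs _).trans ?_
    have h0 := (hF 0).dist_le_mul x y
    have h1 := (hF 1).dist_le_mul x y
    rw [Real.dist_eq, dist_eq_norm] at h0 h1
    simp only [PiLp.sub_apply]
    linarith
  · filter_upwards [hFζ 0, hFζ 1] with x h0 h1
    ext i
    fin_cases i
    · exact h0
    · exact h1

/-- If `ε` is `W^{1,∞}` on the triangles of one triangulation, its weak derivatives on all open
subsets of `Ω` share one bound; so the constants below do not depend on the mesh. -/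
theorem exists_uniform_weakPartial_bound {Ω : Set Plane} (hΩ : IsConvexPolygon Ω)
    {ε : Plane → ℝ} (M : Triangulation Ω)
    (hM : ∀ T ∈ M.elems, MemW1Inf (interior (Tri.carrier T)) ε) :
    ∃ L : NNReal, ∀ U : Set Plane, IsOpen U → U ⊆ Ω → ∀ (i : Fin 2) (g : Plane → ℝ),
      HasWeakPartial U i ε g → ∀ᵐ x ∂(volume.restrict U), |g x| ≤ L := by
  classical
  choose! C hC using fun (T : Tri) (hT : T ∈ M.elems) (i : Fin 2) =>
    exists_coe_bound ((hM T hT).2 i).2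
  refine ⟨∑ T ∈ M.elems, ∑ i, C T i, fun U hU hUΩ i g hg => ?_⟩
  have h1 := ae_restrict_of_ae_restrict_of_subset hUΩ (M.ae_exists_mem_interior hΩ)
  have h2 : ∀ T ∈ M.elems, ∀ᵐ x ∂(volume : Measure Plane), x ∈ U → x ∈ interior (Tri.carrier T) →
      |g x| ≤ C T i := by
    intro T hT
    have hI : IsOpen (U ∩ interior (Tri.carrier T)) := hU.inter isOpen_interior
    have e1 := (hg.mono inter_subset_left).ae_unique hI
      ((weakPartial_spec ((hM T hT).2 i).1).mono inter_subset_right)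
    have e2 := ae_restrict_of_ae_restrict_of_subset
      (inter_subset_right : U ∩ interior (Tri.carrier T) ⊆ _) (hC T hT i)
    rw [EventuallyEq, ae_restrict_iff' hI.measurableSet] at e1
    rw [ae_restrict_iff' hI.measurableSet] at e2
    filter_upwards [e1, e2] with x h1 h2 hx hx'
    rw [h1 ⟨hx, hx'⟩]
    exact h2 ⟨hx, hx'⟩
  have h3 : ∀ᵐ x ∂(volume : Measure Plane), ∀ T ∈ M.elems, x ∈ U → x ∈ interior (Tri.carrier T) →
      |g x| ≤ C T i := (ae_ball_iff M.elems.countable_toSet).2 h2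
  filter_upwards [h1, ae_restrict_of_ae h3, ae_restrict_mem hU.measurableSet] with x hx h hxU
  obtain ⟨T, hT, hxT⟩ := hx
  refine (h T hT hxU hxT).trans ?_
  norm_cast
  calc C T i ≤ ∑ i, C T i :=
        Finset.single_le_sum (f := fun i => C T i) (fun _ _ => zero_le) (Finset.mem_univ i)
    _ ≤ _ := Finset.single_le_sum (f := fun T => ∑ i, C T i) (fun _ _ => zero_le) hT

/-- Continuous representatives of the coefficients on the triangles, with Lipschitz constants that do
not depend on the triangulation. -/
theorem exists_uniform_representatives {Ω : Set Plane} (hΩ : IsConvexPolygon Ω)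
    {ε : Plane → ℝ} {ζ : Plane → Plane} {ε₀ : ℝ} (hε₀ : 0 < ε₀)
    (hε_low : ∀ᵐ x ∂(volume.restrict Ω), ε₀ ≤ ε x)
    (hζ : ∀ i : Fin 2, MemW1Inf Ω (fun x => ζ x i)) (M₀ : Triangulation Ω)
    (hM₀ : ∀ T ∈ M₀.elems, MemW1Inf (interior (Tri.carrier T)) ε) :
    ∃ (Le Lz Z : ℝ) (z : Plane → Plane), 0 ≤ Le ∧ 0 ≤ Lz ∧ 0 ≤ Z ∧ Continuous z ∧
      (∀ x y, ‖z x - z y‖ ≤ Lz * ‖x - y‖) ∧ (∀ x ∈ closure Ω, ‖z x‖ ≤ Z) ∧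
      z =ᵐ[volume.restrict Ω] ζ ∧
      ∀ M : Triangulation Ω, (∀ T ∈ M.elems, MemW1Inf (interior (Tri.carrier T)) ε) →
        ∀ T ∈ M.elems, EqOn (contRep (Tri.carrier T) ζ) z (Tri.carrier T) ∧
          ∃ e : Plane → ℝ, Continuous e ∧ (∀ x, 0 < e x) ∧ (∀ x y, |e x - e y| ≤ Le * ‖x - y‖) ∧
            EqOn (contRep (Tri.carrier T) ε) e (Tri.carrier T) ∧
            e =ᵐ[volume.restrict (Tri.carrier T)] ε := by
  obtain ⟨Lz, z, hLz, hz, hzL, hzζ⟩ := exists_lipschitz_vector_representative hΩ.isOpen hΩ.convex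
    hΩ.isBounded hΩ.1 hζ
  obtain ⟨L, hL⟩ := exists_uniform_weakPartial_bound hΩ M₀ hM₀
  obtain ⟨Z, hZ⟩ := hΩ.isBounded.isCompact_closure.exists_bound_of_continuousOn hz.continuousOn
  refine ⟨2 * L, Lz, max Z 0, z, by positivity, hLz, le_max_right _ _, hz, hzL,
    fun x hx => (hZ x hx).trans (le_max_left _ _), hzζ, fun M hM T hT => ⟨?_, ?_⟩⟩
  · exact contRep_eqOn (Tri.carrier_subset_closure_interior T) hz.continuousOn
      (M.ae_carrier_of_ae hΩ hT hzζ)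
  · have hsub := M.interior_carrier_subset hΩ hT
    obtain ⟨F, hF, hFε⟩ := exists_lipschitz_representative isOpen_interior
      (Tri.convex_carrier T).interior ((Tri.isCompact_carrier T).isBounded.subset interior_subset)
      (Tri.interior_carrier_nonempty T) (hM T hT).1 (fun i => weakPartial_spec ((hM T hT).2 i).1)
      (L := L) (fun i => hL _ isOpen_interior hsub i _ (weakPartial_spec ((hM T hT).2 i).1))
    -- truncation at `ε₀` keeps the representative positive away from the triangle
    have hFe : (fun x => max (F x) ε₀) =ᵐ[volume.restrict (Tri.carrier T)] ε := by
      rw [Tri.restrict_interior_carrier] at hFε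
      filter_upwards [hFε, M.ae_carrier_of_ae hΩ hT hε_low] with x h1 h2
      rw [h1, max_eq_left h2]
    have hFc : Continuous fun x => max (F x) ε₀ := hF.continuous.max continuous_const
    refine ⟨fun x => max (F x) ε₀, hFc, fun x => lt_max_of_lt_right hε₀, fun x y => ?_, ?_, hFe⟩
    · have h1 := (hF.max_const ε₀).dist_le_mul x y
      rw [Real.dist_eq, dist_eq_norm] at h1
      exact_mod_cast h1
    · exact contRep_eqOn (Tri.carrier_subset_closure_interior T) hFc.continuousOn hFe

/-- The edge-averaged form is a perturbation of order `h` of the exact form on the finite element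
space. The reaction terms coincide, and the parameter `t` comes from Young's inequality. -/
theorem exists_abs_formAh_sub_formA_le {Ω : Set Plane} (hΩ : IsConvexPolygon Ω)
    {ε : Plane → ℝ} {ζ : Plane → Plane} {γ : Plane → ℝ} {ε₀ : ℝ} (hε₀ : 0 < ε₀)
    (hε : MemLp ε ⊤ (volume.restrict Ω)) (hε_low : ∀ᵐ x ∂(volume.restrict Ω), ε₀ ≤ ε x)
    (hζ : ∀ i : Fin 2, MemW1Inf Ω (fun x => ζ x i)) (M₀ : Triangulation Ω)
    (hM₀ : ∀ T ∈ M₀.elems, MemW1Inf (interior (Tri.carrier T)) ε) (σ : ℝ) :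
    ∃ C : ℝ, 0 < C ∧ ∀ M : Triangulation Ω, M.ShapeRegular σ →
      (∀ T ∈ M.elems, MemW1Inf (interior (Tri.carrier T)) ε) →
      ∀ w v : Plane → ℝ, M.MemV w → M.MemV v → ∀ t : ℝ, 0 < t →
        |M.formAh ε ζ γ w v - formA Ω ε ζ γ w v| ≤
          C * M.meshSize * (t⁻¹ * energy Ω w (gradient w) + t * energy Ω v (gradient v)) := by
  obtain ⟨Le, Lz, Z, z, hLe, hLz, hZ0, hz, hzL, hZ, hzζ, hrep⟩ :=
    exists_uniform_representatives hΩ hε₀ hε_low hζ M₀ hM₀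
  -- the summand `1` only makes the constant positive
  refine ⟨3 * σ ^ 2 * (Le + Z + Lz) + 1, by positivity, fun M hσ hM w v hw hv t ht => ?_⟩
  have hζm := memLp_vector_of_memW1Inf hζ
  have hwH := hw.isH1 hΩ
  have hvH := hv.isH1 hΩ
  set H := M.meshSize with hH
  have hH0 : 0 ≤ H := M.meshSize_nonneg
  have hfi : IntegrableOn (fun x => inner ℝ (ε x • gradient w x + w x • ζ x) (gradient v x)) Ω :=
    integrable_inner_of_memLp_two (memLp_flux hε hζm hwH) hvH.2.1
  set Q : Plane → ℝ := fun x => t⁻¹ * (w x ^ 2 + ‖gradient w x‖ ^ 2) +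
    t * (v x ^ 2 + ‖gradient v x‖ ^ 2) with hQ
  have hQi : IntegrableOn Q Ω :=
    ((integrableOn_energy hwH).const_mul _).add ((integrableOn_energy hvH).const_mul _)
  have hQint : ∫ x in Ω, Q x = t⁻¹ * energy Ω w (gradient w) + t * energy Ω v (gradient v) := by
    simp only [hQ]
    rw [integral_add ((integrableOn_energy hwH).const_mul _)
      ((integrableOn_energy hvH).const_mul _), integral_const_mul, integral_const_mul,
      integral_energy hwH, integral_energy hvH]
  rw [formA_eq_gradForm hΩ.isOpen hwH hvH, gradForm, Triangulation.formAh, add_sub_add_right_eq_sub,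
    M.setIntegral_eq_sum hΩ hfi, ← Finset.sum_sub_distrib, ← hQint, M.setIntegral_eq_sum hΩ hQi,
    Finset.mul_sum]
  refine (Finset.abs_sum_le_sum_abs _ _).trans (Finset.sum_le_sum fun T hT => ?_)
  obtain ⟨hζz, e, he, hpos, heL, hεe, heε⟩ := hrep M hM T hT
  obtain ⟨c, r, hr, hball, hdiam⟩ := hσ T hT
  obtain ⟨gw, hgw⟩ := hw.2.2 T hT
  obtain ⟨gv, hgv⟩ := hv.2.2 T hT
  have h1 := abs_localForm_sub_le hr hball hdiam hLe hLz
    (fun x hx => hZ x (M.carrier_subset hT hx)) hεe hζz he hz hpos heL hzL hgw hgv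
  have hgrad : ∀ᵐ x ∂(volume.restrict (Tri.carrier T)),
      gradient w x = affGrad gw ∧ gradient v x = affGrad gv ∧ w x = gw x := by
    rw [← Tri.restrict_interior_carrier]
    filter_upwards [ae_restrict_mem isOpen_interior.measurableSet] with x hx
    exact ⟨Triangulation.MemV.gradient_eq hgw hx, Triangulation.MemV.gradient_eq hgv hx,
      hgw x (interior_subset hx)⟩
  have h2 : ∫ x in Tri.carrier T, inner ℝ (ε x • gradient w x + w x • ζ x) (gradient v x) =
      ∫ x in Tri.carrier T, inner ℝ (e x • affGrad gw + gw x • z x) (affGrad gv) := by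
    refine integral_congr_ae ?_
    filter_upwards [hgrad, heε, M.ae_carrier_of_ae hΩ hT hzζ] with x hx h3 h4
    rw [hx.1, hx.2.1, hx.2.2, h3, h4]
  rw [h2]
  refine h1.trans ?_
  rw [← integral_const_mul]
  have hQT : IntegrableOn (fun x => ((3 * σ ^ 2 * (Le + Z + Lz) + 1) * H) * Q x) (Tri.carrier T) :=
    (M.integrableOn_carrier hΩ hT hQi).const_mul _
  refine integral_mono_ae ?_ hQT ?_
  · refine (Continuous.continuousOn ?_).integrableOn_compact (Tri.isCompact_carrier T)
    have := (continuous_affine gw).abs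
    fun_prop
  · filter_upwards [hgrad] with x hx
    have hd := M.diam_le_meshSize hT
    have hd0 : 0 ≤ Metric.diam (Tri.carrier T) := Metric.diam_nonneg
    have h5 := mul_le_young (a := |w x|) (b := ‖gradient w x‖) (c := |v x|) (d := ‖gradient v x‖) ht
    rw [sq_abs, sq_abs] at h5
    have n1 := norm_nonneg (gradient w x)
    have n2 := norm_nonneg (gradient v x)
    have n3 := abs_nonneg (w x)
    have n4 := abs_nonneg (v x)
    rw [← hx.1, ← hx.2.1, ← hx.2.2]
    have h6 : ‖gradient v x‖ * ((Le + Z) * ‖gradient w x‖ + Lz * |w x|) ≤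
        (Le + Z + Lz) * Q x := by
      refine le_trans ?_ (mul_le_mul_of_nonneg_left h5 (by positivity))
      have e : (Le + Z + Lz) * ((|w x| + ‖gradient w x‖) * (|v x| + ‖gradient v x‖)) -
          ‖gradient v x‖ * ((Le + Z) * ‖gradient w x‖ + Lz * |w x|) =
          (Le + Z + Lz) * ((|w x| + ‖gradient w x‖) * |v x|) + (Le + Z) * (|w x| * ‖gradient v x‖) +
          Lz * (‖gradient w x‖ * ‖gradient v x‖) := by ring
      have : 0 ≤ (Le + Z + Lz) * ((|w x| + ‖gradient w x‖) * |v x|) +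
          (Le + Z) * (|w x| * ‖gradient v x‖) + Lz * (‖gradient w x‖ * ‖gradient v x‖) := by
        positivity
      linarith
    have hQ0 : 0 ≤ Q x := by
      simp only [hQ]
      positivity
    calc 3 * σ ^ 2 * Metric.diam (Tri.carrier T) *
          (‖gradient v x‖ * ((Le + Z) * ‖gradient w x‖ + Lz * |w x|))
        ≤ 3 * σ ^ 2 * H * ((Le + Z + Lz) * Q x) := by gcongr
      _ ≤ ((3 * σ ^ 2 * (Le + Z + Lz) + 1) * H) * Q x := by
          have : 0 ≤ H * Q x := by positivity
          linarith

/-! ### The discrete saddle-point problem -/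

namespace Triangulation

variable {Ω : Set Plane} {M : Triangulation Ω} {ε : Plane → ℝ} {ζ : Plane → Plane}
  {γ yd : Plane → ℝ}

theorem localForm_add_left (T : Tri) (y y' v : Plane → ℝ) :
    localForm ε ζ T (y + y') v = localForm ε ζ T y v + localForm ε ζ T y' v := by
  simp only [localForm, edgeDelta, Pi.add_apply, ← Finset.sum_add_distrib]
  exact Finset.sum_congr rfl fun i _ => by ring

theorem localForm_add_right (T : Tri) (y v v' : Plane → ℝ) :
    localForm ε ζ T y (v + v') = localForm ε ζ T y v + localForm ε ζ T y v' := by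
  simp only [localForm, edgeDelta, Pi.add_apply, ← Finset.sum_add_distrib]
  exact Finset.sum_congr rfl fun i _ => by ring

theorem localForm_smul_left (T : Tri) (c : ℝ) (y v : Plane → ℝ) :
    localForm ε ζ T (c • y) v = c * localForm ε ζ T y v := by
  simp only [localForm, edgeDelta, Pi.smul_apply, smul_eq_mul, Finset.mul_sum]
  exact Finset.sum_congr rfl fun i _ => by ring

theorem localForm_smul_right (T : Tri) (c : ℝ) (y v : Plane → ℝ) :
    localForm ε ζ T y (c • v) = c * localForm ε ζ T y v := by
  simp only [localForm, edgeDelta, Pi.smul_apply, smul_eq_mul, Finset.mul_sum]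
  exact Finset.sum_congr rfl fun i _ => by ring

theorem formAh_add_left (hγ : MemLp γ ⊤ (volume.restrict Ω)) {y y' v : Plane → ℝ}
    (hy : MemLp y 2 (volume.restrict Ω)) (hy' : MemLp y' 2 (volume.restrict Ω))
    (hv : MemLp v 2 (volume.restrict Ω)) :
    M.formAh ε ζ γ (y + y') v = M.formAh ε ζ γ y v + M.formAh ε ζ γ y' v := by
  have h := integral_add (integrable_reaction hγ hy hv) (integrable_reaction hγ hy' hv)
  simp only [formAh, localForm_add_left, Finset.sum_add_distrib, Pi.add_apply, mul_add, add_mul]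
  rw [h]
  ring

theorem formAh_add_right (hγ : MemLp γ ⊤ (volume.restrict Ω)) {y v v' : Plane → ℝ}
    (hy : MemLp y 2 (volume.restrict Ω)) (hv : MemLp v 2 (volume.restrict Ω))
    (hv' : MemLp v' 2 (volume.restrict Ω)) :
    M.formAh ε ζ γ y (v + v') = M.formAh ε ζ γ y v + M.formAh ε ζ γ y v' := by
  have h := integral_add (integrable_reaction hγ hy hv) (integrable_reaction hγ hy hv')
  simp only [formAh, localForm_add_right, Finset.sum_add_distrib, Pi.add_apply, mul_add]
  rw [h]
  ring

theorem formAh_smul_left (c : ℝ) (y v : Plane → ℝ) :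
    M.formAh ε ζ γ (c • y) v = c * M.formAh ε ζ γ y v := by
  simp only [formAh, localForm_smul_left, ← Finset.mul_sum, Pi.smul_apply, smul_eq_mul, mul_add]
  rw [← integral_const_mul]
  congr 2
  ext x
  ring

theorem formAh_smul_right (c : ℝ) (y v : Plane → ℝ) :
    M.formAh ε ζ γ y (c • v) = c * M.formAh ε ζ γ y v := by
  simp only [formAh, localForm_smul_right, ← Finset.mul_sum, Pi.smul_apply, smul_eq_mul, mul_add]
  rw [← integral_const_mul]
  congr 2
  ext x
  ring

theorem innerL2_add_left {f f' g : Plane → ℝ} (hf : MemLp f 2 (volume.restrict Ω))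
    (hf' : MemLp f' 2 (volume.restrict Ω)) (hg : MemLp g 2 (volume.restrict Ω)) :
    innerL2 Ω (f + f') g = innerL2 Ω f g + innerL2 Ω f' g := by
  have h := integral_add (integrable_mul_of_memLp_two hf hg) (integrable_mul_of_memLp_two hf' hg)
  simp only [innerL2, Pi.add_apply, add_mul]
  exact h

theorem innerL2_comm (f g : Plane → ℝ) : innerL2 Ω f g = innerL2 Ω g f := by
  simp only [innerL2, mul_comm]

theorem innerL2_add_right {f g g' : Plane → ℝ} (hf : MemLp f 2 (volume.restrict Ω))
    (hg : MemLp g 2 (volume.restrict Ω)) (hg' : MemLp g' 2 (volume.restrict Ω)) :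
    innerL2 Ω f (g + g') = innerL2 Ω f g + innerL2 Ω f g' := by
  rw [innerL2_comm, innerL2_add_left hg hg' hf, innerL2_comm g, innerL2_comm g']

theorem innerL2_smul_left (c : ℝ) (f g : Plane → ℝ) :
    innerL2 Ω (c • f) g = c * innerL2 Ω f g := by
  simp only [innerL2, Pi.smul_apply, smul_eq_mul, mul_assoc]
  exact integral_const_mul _ _

theorem innerL2_smul_right (c : ℝ) (f g : Plane → ℝ) :
    innerL2 Ω f (c • g) = c * innerL2 Ω f g := by
  rw [innerL2_comm, innerL2_smul_left, innerL2_comm]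

theorem MemV.memL2 (hΩ : IsConvexPolygon Ω) {v : Plane → ℝ} (hv : M.MemV v) :
    MemLp v 2 (volume.restrict Ω) := (hv.memLp hΩ).restrict Ω

variable (M) in
/-- The discrete saddle-point form as a bilinear map on `V_h × V_h`. -/
def saddleMap (hΩ : IsConvexPolygon Ω) (ε : Plane → ℝ) (ζ : Plane → Plane)
    (hγ : MemLp γ ⊤ (volume.restrict Ω)) :
    (M.femSpace × M.femSpace) →ₗ[ℝ] (M.femSpace × M.femSpace) →ₗ[ℝ] ℝ :=
  have L : ∀ v : M.femSpace, MemLp v.1 2 (volume.restrict Ω) := fun v =>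
    (mem_femSpace.1 v.2).memL2 hΩ
  LinearMap.mk₂ ℝ (fun u w => saddleForm Ω (M.formAh ε ζ γ) u.1 u.2 w.1 w.2)
    (fun u u' w => by
      simp only [saddleForm, Prod.fst_add, Prod.snd_add, Submodule.coe_add]
      rw [formAh_add_right hγ (L _) (L _) (L _), formAh_add_left hγ (L _) (L _) (L _),
        innerL2_add_left (L _) (L _) (L _), innerL2_add_left (L _) (L _) (L _)]
      ring)
    (fun c u w => by
      simp only [saddleForm, Prod.smul_fst, Prod.smul_snd, Submodule.coe_smul,
        formAh_smul_right, formAh_smul_left, innerL2_smul_left, smul_eq_mul]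
      ring)
    (fun u w w' => by
      simp only [saddleForm, Prod.fst_add, Prod.snd_add, Submodule.coe_add]
      rw [formAh_add_right hγ (L _) (L _) (L _), formAh_add_left hγ (L _) (L _) (L _),
        innerL2_add_right (L _) (L _) (L _), innerL2_add_right (L _) (L _) (L _)]
      ring)
    (fun c u w => by
      simp only [saddleForm, Prod.smul_fst, Prod.smul_snd, Submodule.coe_smul,
        formAh_smul_right, formAh_smul_left, innerL2_smul_right, smul_eq_mul]
      ring)

theorem MemV.eq_zero_of_energy (hΩ : IsConvexPolygon Ω) {v : Plane → ℝ} (hv : M.MemV v)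
    (h : energy Ω v (gradient v) ≤ 0) : v = 0 := by
  have hH := hv.isH1 hΩ
  have h1 : ∫ x in Ω, v x ^ 2 = 0 := by
    have a1 : 0 ≤ ∫ x in Ω, v x ^ 2 := integral_nonneg fun _ => sq_nonneg _
    have a2 : 0 ≤ ∫ x in Ω, ‖gradient v x‖ ^ 2 := integral_nonneg fun _ => sq_nonneg _
    rw [energy] at h
    linarith
  rw [integral_eq_zero_iff_of_nonneg (fun _ => sq_nonneg _) hH.1.integrable_sq] at h1
  have h2 : v =ᵐ[volume.restrict Ω] fun _ => 0 := by
    filter_upwards [h1] with x hx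
    simpa using hx
  have h3 := Measure.eqOn_of_ae_eq h2 hv.1.continuousOn continuousOn_const
    (by rw [hΩ.isOpen.interior_eq]; exact subset_closure)
  ext x
  by_cases hx : x ∈ Ω
  · exact h3 hx
  · exact hv.2.1 x hx

/-- Testing with `(p, -y)` turns the saddle-point form into the sum of the two diagonal terms. -/
theorem saddleForm_self_neg (p y : Plane → ℝ) :
    saddleForm Ω (M.formAh ε ζ γ) p y p ((-1 : ℝ) • y) =
      M.formAh ε ζ γ p p + M.formAh ε ζ γ y y := by
  rw [saddleForm, formAh_smul_right, innerL2_smul_right, innerL2_comm p y]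
  ring

/-- If the discrete form is coercive, the discrete saddle-point problem has exactly one solution. -/
theorem existsUnique_isDiscreteSolution (hΩ : IsConvexPolygon Ω)
    (hγ : MemLp γ ⊤ (volume.restrict Ω)) (hyd : MemLp yd 2 (volume.restrict Ω)) {α : ℝ}
    (hα : 0 < α)
    (hcoer : ∀ v, M.MemV v → α * energy Ω v (gradient v) ≤ M.formAh ε ζ γ v v) :
    ∃! w : (Plane → ℝ) × (Plane → ℝ), M.IsDiscreteSolution ε ζ γ yd w.1 w.2 := by
  have hL : ∀ v : M.femSpace, MemLp v.1 2 (volume.restrict Ω) := fun v =>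
    (mem_femSpace.1 v.2).memL2 hΩ
  set B := M.saddleMap hΩ ε ζ hγ with hB
  have hinj : Function.Injective B := by
    refine (injective_iff_map_eq_zero B).2 fun u hu => ?_
    have h1 : B u (u.1, (-1 : ℝ) • u.2) = 0 := by rw [hu]; rfl
    have h2 : saddleForm Ω (M.formAh ε ζ γ) u.1 u.2 u.1 ((-1 : ℝ) • (u.2 : Plane → ℝ)) = 0 := h1
    rw [saddleForm_self_neg] at h2
    have c1 := hcoer u.1 u.1.2
    have c2 := hcoer u.2 u.2.2
    have n1 := mul_nonneg hα.le (energy_nonneg Ω u.1 (gradient u.1.1))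
    have n2 := mul_nonneg hα.le (energy_nonneg Ω u.2 (gradient u.2.1))
    have z1 : energy Ω u.1.1 (gradient u.1.1) ≤ 0 := by
      by_contra! h
      have := mul_pos hα h
      linarith
    have z2 : energy Ω u.2.1 (gradient u.2.1) ≤ 0 := by
      by_contra! h
      have := mul_pos hα h
      linarith
    refine Prod.ext (Subtype.ext ?_) (Subtype.ext ?_)
    · exact MemV.eq_zero_of_energy hΩ u.1.2 z1
    · exact MemV.eq_zero_of_energy hΩ u.2.2 z2
  have hsurj : Function.Surjective B :=
    (LinearMap.injective_iff_surjective_of_finrank_eq_finrank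
      (Subspace.dual_finrank_eq (K := ℝ) (V := M.femSpace × M.femSpace)).symm).1 hinj
  let rhs : (M.femSpace × M.femSpace) →ₗ[ℝ] ℝ :=
    { toFun := fun w => -innerL2 Ω yd w.1
      map_add' := fun w w' => by
        simp only [Prod.fst_add, Submodule.coe_add]
        rw [innerL2_add_right hyd (hL _) (hL _)]
        ring
      map_smul' := fun c w => by
        simp only [Prod.smul_fst, Submodule.coe_smul, innerL2_smul_right, RingHom.id_apply,
          smul_eq_mul]
        ring }
  have hiff : ∀ u : M.femSpace × M.femSpace,
      M.IsDiscreteSolution ε ζ γ yd u.1 u.2 ↔ B u = rhs := by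
    intro u
    constructor
    · rintro ⟨-, -, h⟩
      exact LinearMap.ext fun w => h w.1 w.2 w.1.2 w.2.2
    · intro h
      exact ⟨u.1.2, u.2.2, fun q z hq hz => LinearMap.congr_fun h (⟨q, hq⟩, ⟨z, hz⟩)⟩
  obtain ⟨u, hu⟩ := hsurj rhs
  refine ⟨(u.1, u.2), (hiff u).2 hu, ?_⟩
  rintro ⟨p, y⟩ h
  have h1 := (hiff (⟨p, h.1⟩, ⟨y, h.2.1⟩)).1 h
  have h2 := hinj (h1.trans hu.symm)
  rw [← h2]

end Triangulation

/-! ### Taylor remainders and interpolation of smooth functions -/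

/-- The squared Frobenius norm of the Hessian. -/
def hessSq (φ : Plane → ℝ) (x : Plane) : ℝ := ∑ i, ∑ j, pd j (pd i φ) x ^ 2

/-- The first-order Taylor remainder of `φ` at the point `a`, expanded around `x`. -/
def taylorRem (φ : Plane → ℝ) (a x : Plane) : ℝ := φ a - φ x - inner ℝ (gradient φ x) (a - x)

theorem hessSq_nonneg (φ : Plane → ℝ) (x : Plane) : 0 ≤ hessSq φ x :=
  Finset.sum_nonneg fun _ _ => Finset.sum_nonneg fun _ _ => sq_nonneg _

theorem continuous_hessSq {φ : Plane → ℝ} (hφ : ContDiff ℝ ∞ φ) : Continuous (hessSq φ) :=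
  continuous_finsetSum _ fun i _ => continuous_finsetSum _ fun j _ =>
    (contDiff_pd (contDiff_pd hφ i) j).continuous.pow 2

theorem continuous_taylorRem {φ : Plane → ℝ} (hφ : ContDiff ℝ ∞ φ) (a : Plane) :
    Continuous (taylorRem φ a) := by
  have h1 := hφ.continuous
  have h2 := continuous_gradient (hφ.of_le (m := 1) (by norm_num))
  unfold taylorRem
  exact (continuous_const.sub h1).sub (h2.inner (continuous_const.sub continuous_id))

theorem fderiv_apply_eq_pd (φ : Plane → ℝ) (x v : Plane) :
    fderiv ℝ φ x v = v 0 * pd 0 φ x + v 1 * pd 1 φ x := by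
  have e : v = v 0 • EuclideanSpace.single 0 (1 : ℝ) + v 1 • EuclideanSpace.single 1 (1 : ℝ) := by
    ext i
    fin_cases i <;> simp
  conv_lhs => rw [e]
  simp [pd]

theorem hasDerivAt_along {φ : Plane → ℝ} (hφ : ContDiff ℝ ∞ φ) (x v : Plane) (t : ℝ) :
    HasDerivAt (fun t : ℝ => φ (x + t • v)) (fderiv ℝ φ (x + t • v) v) t := by
  have h1 : HasDerivAt (fun t : ℝ => x + t • v) v t := by
    simpa using ((hasDerivAt_id t).smul_const v).const_add x
  exact (hφ.differentiable (by norm_num) (x + t • v)).hasFDerivAt.comp_hasDerivAt t h1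

theorem taylorRem_eq_integral {φ : Plane → ℝ} (hφ : ContDiff ℝ ∞ φ) (a x : Plane) :
    taylorRem φ a x = ∫ t in (0 : ℝ)..1, (1 - t) *
      ((a - x) 0 * fderiv ℝ (pd 0 φ) (x + t • (a - x)) (a - x) +
        (a - x) 1 * fderiv ℝ (pd 1 φ) (x + t • (a - x)) (a - x)) := by
  set v := a - x with hv
  have hline : Continuous fun t : ℝ => x + t • v := by fun_prop
  have hD : ∀ t, HasDerivAt (fun t : ℝ => fderiv ℝ φ (x + t • v) v)
      (v 0 * fderiv ℝ (pd 0 φ) (x + t • v) v + v 1 * fderiv ℝ (pd 1 φ) (x + t • v) v) t := by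
    intro t
    have e : (fun t : ℝ => fderiv ℝ φ (x + t • v) v) =
        fun t => v 0 * pd 0 φ (x + t • v) + v 1 * pd 1 φ (x + t • v) :=
      funext fun t => fderiv_apply_eq_pd φ _ v
    rw [e]
    exact ((hasDerivAt_along (contDiff_pd hφ 0) x v t).const_mul (v 0)).add
      ((hasDerivAt_along (contDiff_pd hφ 1) x v t).const_mul (v 1))
  have hG : ∀ t, HasDerivAt (fun t : ℝ => φ (x + t • v) + (1 - t) * fderiv ℝ φ (x + t • v) v)
      ((1 - t) * (v 0 * fderiv ℝ (pd 0 φ) (x + t • v) v +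
        v 1 * fderiv ℝ (pd 1 φ) (x + t • v) v)) t := by
    intro t
    have h1 : HasDerivAt (fun t : ℝ => 1 - t) (-1) t := by
      simpa using (hasDerivAt_id t).const_sub 1
    refine ((hasDerivAt_along hφ x v t).add (h1.mul (hD t))).congr_deriv ?_
    ring
  have hc : ∀ i, Continuous fun t : ℝ => fderiv ℝ (pd i φ) (x + t • v) v := fun i =>
    (((contDiff_pd hφ i).continuous_fderiv (by norm_num)).comp hline).clm_apply continuous_const
  have hcont : Continuous fun t : ℝ => (1 - t) * (v 0 * fderiv ℝ (pd 0 φ) (x + t • v) v +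
        v 1 * fderiv ℝ (pd 1 φ) (x + t • v) v) :=
    (continuous_const.sub continuous_id).mul
      ((continuous_const.mul (hc 0)).add (continuous_const.mul (hc 1)))
  rw [intervalIntegral.integral_eq_sub_of_hasDerivAt (fun t _ => hG t)
    (hcont.intervalIntegrable 0 1)]
  simp only [one_smul, sub_self, zero_mul, add_zero, zero_smul, sub_zero, one_mul]
  rw [taylorRem, ← fderiv_eq_inner_gradient, ← hv]
  have : x + v = a := by simp [hv]
  rw [this]
  ring

theorem sq_second_derivative_le (φ : Plane → ℝ) (z v : Plane) :
    (v 0 * fderiv ℝ (pd 0 φ) z v + v 1 * fderiv ℝ (pd 1 φ) z v) ^ 2 ≤ ‖v‖ ^ 4 * hessSq φ z := by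
  have h1 : ‖v‖ ^ 4 = (v 0 ^ 2 + v 1 ^ 2) ^ 2 := by
    have : ‖v‖ ^ 2 = v 0 ^ 2 + v 1 ^ 2 := by
      rw [EuclideanSpace.norm_sq_eq, Fin.sum_univ_two]
      simp
    rw [← this]
    ring
  rw [h1, fderiv_apply_eq_pd, fderiv_apply_eq_pd]
  simp only [hessSq, Fin.sum_univ_two]
  set p := v 0
  set q := v 1
  set A := pd 0 (pd 0 φ) z
  set B := pd 1 (pd 0 φ) z
  set C := pd 0 (pd 1 φ) z
  set D := pd 1 (pd 1 φ) z
  -- the Cauchy-Schwarz inequality in the four products of coordinates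
  have e : (p ^ 2 + q ^ 2) ^ 2 * (A ^ 2 + B ^ 2 + (C ^ 2 + D ^ 2)) -
      (p * (p * A + q * B) + q * (p * C + q * D)) ^ 2 =
      (p * p * B - p * q * A) ^ 2 + (p * p * C - p * q * A) ^ 2 + (p * p * D - q * q * A) ^ 2 +
      (p * q * C - p * q * B) ^ 2 + (p * q * D - q * q * B) ^ 2 + (p * q * D - q * q * C) ^ 2 := by
    ring
  have h2 : 0 ≤ (p * p * B - p * q * A) ^ 2 + (p * p * C - p * q * A) ^ 2 +
      (p * p * D - q * q * A) ^ 2 + (p * q * C - p * q * B) ^ 2 + (p * q * D - q * q * B) ^ 2 +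
      (p * q * D - q * q * C) ^ 2 := by positivity
  linarith

theorem enorm_intervalIntegral_sq_le {f : ℝ → ℝ} (hf : Continuous f) :
    ‖∫ t in (0 : ℝ)..1, f t‖ₑ ^ 2 ≤ ∫⁻ t in Ioc (0 : ℝ) 1, ENNReal.ofReal (f t ^ 2) := by
  rw [intervalIntegral.integral_of_le zero_le_one]
  have h1 := sq_lintegral_le (volume.restrict (Ioc (0 : ℝ) 1)) (g := fun t => ‖f t‖ₑ)
    hf.measurable.enorm.aemeasurable
  have h2 : (volume.restrict (Ioc (0 : ℝ) 1)) univ = 1 := by simp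
  rw [h2, one_mul] at h1
  refine le_trans ?_ (h1.trans_eq ?_)
  · gcongr
    exact enorm_integral_le_lintegral_enorm _
  · congr 1
    ext t
    rw [← ofReal_norm, ← ENNReal.ofReal_pow (norm_nonneg _), Real.norm_eq_abs, sq_abs]

/-- On a set that is star-shaped with respect to `a`, the Taylor remainder at `a` is bounded in `L²`
by the Hessian. The weight `1 - t` of the remainder and the Jacobian `(1 - t)²` of the contraction
towards `a` cancel exactly in two dimensions. -/
theorem lintegral_taylorRem_sq_le {φ : Plane → ℝ} (hφ : ContDiff ℝ ∞ φ) {a : Plane} {K : Set Plane}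
    (hK : MeasurableSet K) {d : ℝ} (hd : ∀ x ∈ K, ‖a - x‖ ≤ d)
    (hstar : ∀ x ∈ K, ∀ t ∈ Ioo (0 : ℝ) 1, x + t • (a - x) ∈ K) :
    ∫⁻ x in K, ENNReal.ofReal (taylorRem φ a x ^ 2) ≤
      ENNReal.ofReal (d ^ 4) * ∫⁻ x in K, ENNReal.ofReal (hessSq φ x) := by
  have hHc := continuous_hessSq hφ
  have hpt : ∀ x ∈ K, ENNReal.ofReal (taylorRem φ a x ^ 2) ≤ ∫⁻ t in Ioc (0 : ℝ) 1,
      ENNReal.ofReal (d ^ 4) * ENNReal.ofReal ((1 - t) ^ 2 * hessSq φ (x + t • (a - x))) := by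
    intro x hx
    have hline : Continuous fun t : ℝ => x + t • (a - x) := by fun_prop
    have hc : ∀ i, Continuous fun t : ℝ => fderiv ℝ (pd i φ) (x + t • (a - x)) (a - x) := fun i =>
      (((contDiff_pd hφ i).continuous_fderiv (by norm_num)).comp hline).clm_apply continuous_const
    have hcont : Continuous fun t : ℝ => (1 - t) *
        ((a - x) 0 * fderiv ℝ (pd 0 φ) (x + t • (a - x)) (a - x) +
          (a - x) 1 * fderiv ℝ (pd 1 φ) (x + t • (a - x)) (a - x)) :=
      (continuous_const.sub continuous_id).mul
        ((continuous_const.mul (hc 0)).add (continuous_const.mul (hc 1)))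
    have h1 := enorm_intervalIntegral_sq_le hcont
    have h2 := taylorRem_eq_integral hφ a x
    have h3 : ENNReal.ofReal (taylorRem φ a x ^ 2) = ‖taylorRem φ a x‖ₑ ^ 2 := by
      rw [← ofReal_norm, ← ENNReal.ofReal_pow (norm_nonneg _), Real.norm_eq_abs, sq_abs]
    rw [h3, h2]
    refine h1.trans (lintegral_mono fun t => ?_)
    rw [← ENNReal.ofReal_mul (by positivity)]
    refine ENNReal.ofReal_le_ofReal ?_
    have h4 := sq_second_derivative_le φ (x + t • (a - x)) (a - x)
    have h5 : ‖a - x‖ ^ 4 ≤ d ^ 4 := pow_le_pow_left₀ (norm_nonneg _) (hd x hx) 4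
    have h6 := h4.trans (mul_le_mul_of_nonneg_right h5 (hessSq_nonneg φ (x + t • (a - x))))
    have h7 := mul_le_mul_of_nonneg_left h6 (sq_nonneg (1 - t))
    rw [mul_pow]
    linarith
  calc ∫⁻ x in K, ENNReal.ofReal (taylorRem φ a x ^ 2)
      ≤ ∫⁻ x in K, ∫⁻ t in Ioc (0 : ℝ) 1, ENNReal.ofReal (d ^ 4) *
          ENNReal.ofReal ((1 - t) ^ 2 * hessSq φ (x + t • (a - x))) := setLIntegral_mono' hK hpt
    _ = ∫⁻ t in Ioc (0 : ℝ) 1, ∫⁻ x in K, ENNReal.ofReal (d ^ 4) *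
          ENNReal.ofReal ((1 - t) ^ 2 * hessSq φ (x + t • (a - x))) := by
        refine lintegral_lintegral_swap (Measurable.aemeasurable ?_)
        have : Continuous fun p : Plane × ℝ =>
            (1 - p.2) ^ 2 * hessSq φ (p.1 + p.2 • (a - p.1)) := by fun_prop
        exact this.measurable.ennreal_ofReal.const_mul _
    _ ≤ ∫⁻ t in Ioc (0 : ℝ) 1, ENNReal.ofReal (d ^ 4) * ∫⁻ x in K, ENNReal.ofReal (hessSq φ x) := by
        rw [← restrict_Ioo_eq_restrict_Ioc]
        refine setLIntegral_mono' measurableSet_Ioo fun t ht => ?_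
        rw [lintegral_const_mul' _ _ (by simp)]
        refine mul_le_mul' le_rfl ?_
        have ht1 : 0 < 1 - t := sub_pos.2 ht.2
        have hm : Measurable (K.indicator fun z => ENNReal.ofReal (hessSq φ z)) :=
          hHc.measurable.ennreal_ofReal.indicator hK
        have hcv := lintegral_comp_smul_sub (s := 1 - t) _ hm ht1.ne' (-(t • a))
        rw [lintegral_indicator hK] at hcv
        calc ∫⁻ x in K, ENNReal.ofReal ((1 - t) ^ 2 * hessSq φ (x + t • (a - x)))
            ≤ ∫⁻ x in K, ENNReal.ofReal ((1 - t) ^ 2) *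
                K.indicator (fun z => ENNReal.ofReal (hessSq φ z)) ((1 - t) • x - -(t • a)) := by
              refine setLIntegral_mono' hK fun x hx => ?_
              have e : (1 - t) • x - -(t • a) = x + t • (a - x) := by module
              rw [e, indicator_of_mem (hstar x hx t ht), ENNReal.ofReal_mul (sq_nonneg _)]
          _ ≤ ∫⁻ x, ENNReal.ofReal ((1 - t) ^ 2) *
                K.indicator (fun z => ENNReal.ofReal (hessSq φ z)) ((1 - t) • x - -(t • a)) :=
              setLIntegral_le_lintegral _ _
          _ = ∫⁻ x in K, ENNReal.ofReal (hessSq φ x) := by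
              rw [lintegral_const_mul' _ _ (by simp), hcv, ← mul_assoc,
                ← ENNReal.ofReal_mul (sq_nonneg _), mul_inv_cancel₀ (by positivity),
                ENNReal.ofReal_one, one_mul]
    _ = _ := by
        rw [setLIntegral_const]
        simp

theorem integrableOn_of_continuous_of_bounded {K : Set Plane} (hK : Bornology.IsBounded K)
    {f : Plane → ℝ} (hf : Continuous f) : IntegrableOn f K :=
  (hf.continuousOn.integrableOn_compact hK.isCompact_closure).mono_set subset_closure

theorem integral_taylorRem_sq_le {φ : Plane → ℝ} (hφ : ContDiff ℝ ∞ φ) {a : Plane} {K : Set Plane}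
    (hK : MeasurableSet K) (hKb : Bornology.IsBounded K) {d : ℝ} (hd : ∀ x ∈ K, ‖a - x‖ ≤ d)
    (hstar : ∀ x ∈ K, ∀ t ∈ Ioo (0 : ℝ) 1, x + t • (a - x) ∈ K) :
    ∫ x in K, taylorRem φ a x ^ 2 ≤ d ^ 4 * ∫ x in K, hessSq φ x := by
  have h := lintegral_taylorRem_sq_le hφ hK hd hstar
  have i1 : IntegrableOn (fun x => taylorRem φ a x ^ 2) K :=
    integrableOn_of_continuous_of_bounded hKb ((continuous_taylorRem hφ a).pow 2)
  have i2 : IntegrableOn (hessSq φ) K :=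
    integrableOn_of_continuous_of_bounded hKb (continuous_hessSq hφ)
  rw [← ofReal_integral_eq_lintegral_ofReal i1 (Eventually.of_forall fun _ => sq_nonneg _),
    ← ofReal_integral_eq_lintegral_ofReal i2 (Eventually.of_forall fun x => hessSq_nonneg φ x),
    ← ENNReal.ofReal_mul (by positivity)] at h
  refine (ENNReal.ofReal_le_ofReal_iff ?_).1 h
  exact mul_nonneg (by positivity) (integral_nonneg fun x => hessSq_nonneg φ x)

theorem sq_sum_three_le (a b c : ℝ) : (a + b + c) ^ 2 ≤ 3 * (a ^ 2 + b ^ 2 + c ^ 2) := by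
  nlinarith [sq_nonneg (a - b), sq_nonneg (b - c), sq_nonneg (a - c)]

namespace Tri

theorem interp_sub_eq (T : Tri) (φ : Plane → ℝ) (x : Plane) :
    Triangulation.interp T φ x - φ x = ∑ i : Fin 3, coord T i x * taylorRem φ (T.points i) x := by
  have h1 := sum_coord T x
  have h2 := sum_coord_smul T x
  have h3 : ∑ i : Fin 3, coord T i x * inner ℝ (gradient φ x) (T.points i - x) = (0 : ℝ) := by
    have : ∑ i : Fin 3, coord T i x * (inner ℝ (gradient φ x) (T.points i - x) : ℝ) =
        inner ℝ (gradient φ x) (∑ i : Fin 3, coord T i x • T.points i) -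
          (∑ i, coord T i x) * inner ℝ (gradient φ x) x := by
      rw [inner_sum, Finset.sum_mul, ← Finset.sum_sub_distrib]
      refine Finset.sum_congr rfl fun i _ => ?_
      rw [inner_sub_right, real_inner_smul_right]
      ring
    rw [this, h1, h2, one_mul, sub_self]
  rw [Triangulation.interp_apply]
  simp only [taylorRem, mul_sub, Finset.sum_sub_distrib] at *
  rw [← Finset.sum_mul, h1, h3, one_mul, sub_zero]

theorem affGrad_interp (T : Tri) (φ : Plane → ℝ) :
    affGrad (Triangulation.interp T φ) = ∑ i : Fin 3, φ (T.points i) • bgrad T i := by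
  rw [affGrad_eq_sum T]
  simp only [Triangulation.interp_points]

theorem affGrad_interp_sub_eq (T : Tri) (φ : Plane → ℝ) (x : Plane) :
    affGrad (Triangulation.interp T φ) - gradient φ x =
      ∑ i : Fin 3, taylorRem φ (T.points i) x • bgrad T i := by
  have h1 := sum_bgrad T
  have h2 := sum_inner_points_smul_bgrad T (gradient φ x)
  have h3 : ∑ i : Fin 3, taylorRem φ (T.points i) x • bgrad T i =
      ∑ i : Fin 3, φ (T.points i) • bgrad T i -
        ∑ i : Fin 3, (inner ℝ (gradient φ x) (T.points i) : ℝ) • bgrad T i +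
        (inner ℝ (gradient φ x) x - φ x : ℝ) • ∑ i, bgrad T i := by
    rw [Finset.smul_sum, ← Finset.sum_sub_distrib, ← Finset.sum_add_distrib]
    refine Finset.sum_congr rfl fun i _ => ?_
    rw [taylorRem, inner_sub_right]
    module
  rw [h3, h1, h2, smul_zero, add_zero, affGrad_interp]

/-- The interpolation error of a smooth function on one triangle. The gradients of the barycentric
coordinates, of size `1 / h_T`, cost one of the two powers of `h_T` in the Taylor remainders. -/
theorem integral_interp_sub_le (T : Tri) {φ : Plane → ℝ} (hφ : ContDiff ℝ ∞ φ) {σ r : ℝ}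
    {c : Plane} (hr : 0 < r) (hball : Metric.closedBall c r ⊆ carrier T)
    (hσ : Metric.diam (carrier T) ≤ σ * (2 * r)) {h : ℝ} (hh : Metric.diam (carrier T) ≤ h)
    (hh1 : h ≤ 1) :
    ∫ x in carrier T, ((Triangulation.interp T φ x - φ x) ^ 2 +
      ‖affGrad (Triangulation.interp T φ) - gradient φ x‖ ^ 2) ≤
      9 * (1 + σ ^ 2) * h ^ 2 * ∫ x in carrier T, hessSq φ x := by
  set K := carrier T with hK
  set d := Metric.diam K with hd
  have hd0 : 0 ≤ d := Metric.diam_nonneg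
  have hKc := isCompact_carrier T
  have hKm := measurableSet_carrier T
  set I := ∫ x in K, hessSq φ x with hI
  have hI0 : 0 ≤ I := integral_nonneg fun x => hessSq_nonneg φ x
  have hR : ∀ i : Fin 3, ∫ x in K, taylorRem φ (T.points i) x ^ 2 ≤ d ^ 4 * I := by
    intro i
    refine integral_taylorRem_sq_le hφ hKm hKc.isBounded
      (fun x hx => norm_sub_le_diam T (points_mem_carrier T i) hx) fun x hx t ht => ?_
    exact (convex_carrier T).add_smul_sub_mem hx (points_mem_carrier T i) ⟨ht.1.le, ht.2.le⟩
  have hRi : ∀ i : Fin 3, IntegrableOn (fun x => taylorRem φ (T.points i) x ^ 2) K := fun i =>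
    integrableOn_of_continuous_of_bounded hKc.isBounded ((continuous_taylorRem hφ _).pow 2)
  set B : Fin 3 → ℝ := fun i => 3 * (1 + ‖bgrad T i‖ ^ 2) with hB
  have hBd : ∀ i, B i * d ^ 4 ≤ 3 * (1 + σ ^ 2) * h ^ 2 := by
    intro i
    have h1 : ‖bgrad T i‖ * d ≤ σ := by
      calc ‖bgrad T i‖ * d ≤ 1 / (2 * r) * (σ * (2 * r)) :=
            mul_le_mul (norm_bgrad_le T hr hball i) hσ hd0 (by positivity)
        _ = σ := by field_simp
    have h2 : (‖bgrad T i‖ * d) ^ 2 ≤ σ ^ 2 := pow_le_pow_left₀ (by positivity) h1 2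
    have h3 : d ^ 2 ≤ h ^ 2 := pow_le_pow_left₀ hd0 hh 2
    have h4 : d ^ 2 ≤ 1 := pow_le_one₀ hd0 (hh.trans hh1)
    calc B i * d ^ 4 = 3 * (d ^ 2 + (‖bgrad T i‖ * d) ^ 2) * d ^ 2 := by
          simp only [hB]
          ring
      _ ≤ 3 * (1 + σ ^ 2) * h ^ 2 := by gcongr
  have hpt : ∀ x ∈ K, (Triangulation.interp T φ x - φ x) ^ 2 +
      ‖affGrad (Triangulation.interp T φ) - gradient φ x‖ ^ 2 ≤
      B 0 * taylorRem φ (T.points 0) x ^ 2 + B 1 * taylorRem φ (T.points 1) x ^ 2 +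
        B 2 * taylorRem φ (T.points 2) x ^ 2 := by
    intro x hx
    rw [interp_sub_eq, affGrad_interp_sub_eq, Fin.sum_univ_three, Fin.sum_univ_three]
    have hco : ∀ i : Fin 3, (coord T i x * taylorRem φ (T.points i) x) ^ 2 ≤
        taylorRem φ (T.points i) x ^ 2 := by
      intro i
      rw [mul_pow]
      have h1 := pow_le_one₀ (n := 2) ((mem_carrier_iff T).1 hx i) (coord_le_one T hx i)
      exact mul_le_of_le_one_left (sq_nonneg _) h1
    have h1 := sq_sum_three_le (coord T 0 x * taylorRem φ (T.points 0) x)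
      (coord T 1 x * taylorRem φ (T.points 1) x) (coord T 2 x * taylorRem φ (T.points 2) x)
    have h2 : ‖taylorRem φ (T.points 0) x • bgrad T 0 + taylorRem φ (T.points 1) x • bgrad T 1 +
        taylorRem φ (T.points 2) x • bgrad T 2‖ ≤ |taylorRem φ (T.points 0) x| * ‖bgrad T 0‖ +
        |taylorRem φ (T.points 1) x| * ‖bgrad T 1‖ +
        |taylorRem φ (T.points 2) x| * ‖bgrad T 2‖ := by
      refine norm_add₃_le.trans_eq ?_
      rw [norm_smul, norm_smul, norm_smul]
      rfl
    have h3 := (pow_le_pow_left₀ (norm_nonneg _) h2 2).trans (sq_sum_three_le _ _ _)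
    simp only [mul_pow, sq_abs] at h3
    have c0 := hco 0
    have c1 := hco 1
    have c2 := hco 2
    simp only [hB]
    linarith
  have i1 : IntegrableOn (fun x => (Triangulation.interp T φ x - φ x) ^ 2 +
      ‖affGrad (Triangulation.interp T φ) - gradient φ x‖ ^ 2) K := by
    refine integrableOn_of_continuous_of_bounded hKc.isBounded ?_
    have h1 := hφ.continuous
    have h2 := continuous_gradient (hφ.of_le (m := 1) (by norm_num))
    have h3 := continuous_affine (Triangulation.interp T φ)
    exact ((h3.sub h1).pow 2).add ((continuous_const.sub h2).norm.pow 2)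
  have j := fun i : Fin 3 => (hRi i).const_mul (B i)
  have j2 : IntegrableOn (fun x => B 0 * taylorRem φ (T.points 0) x ^ 2 +
      B 1 * taylorRem φ (T.points 1) x ^ 2) K := (j 0).add (j 1)
  have j3 : IntegrableOn (fun x => B 0 * taylorRem φ (T.points 0) x ^ 2 +
      B 1 * taylorRem φ (T.points 1) x ^ 2 + B 2 * taylorRem φ (T.points 2) x ^ 2) K :=
    j2.add (j 2)
  calc _ ≤ ∫ x in K, (B 0 * taylorRem φ (T.points 0) x ^ 2 + B 1 * taylorRem φ (T.points 1) x ^ 2 +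
        B 2 * taylorRem φ (T.points 2) x ^ 2) :=
        setIntegral_mono_on i1 j3 hKm hpt
    _ = B 0 * (∫ x in K, taylorRem φ (T.points 0) x ^ 2) +
        B 1 * (∫ x in K, taylorRem φ (T.points 1) x ^ 2) +
        B 2 * ∫ x in K, taylorRem φ (T.points 2) x ^ 2 := by
        rw [integral_add j2 (j 2), integral_add (j 0) (j 1), integral_const_mul, integral_const_mul, integral_const_mul]
    _ ≤ B 0 * (d ^ 4 * I) + B 1 * (d ^ 4 * I) + B 2 * (d ^ 4 * I) := by
        have hB0 : ∀ i, 0 ≤ B i := fun i => by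
          simp only [hB]
          positivity
        have a0 := mul_le_mul_of_nonneg_left (hR 0) (hB0 0)
        have a1 := mul_le_mul_of_nonneg_left (hR 1) (hB0 1)
        have a2 := mul_le_mul_of_nonneg_left (hR 2) (hB0 2)
        linarith
    _ ≤ 9 * (1 + σ ^ 2) * h ^ 2 * I := by
        have a0 := mul_le_mul_of_nonneg_right (hBd 0) hI0
        have a1 := mul_le_mul_of_nonneg_right (hBd 1) hI0
        have a2 := mul_le_mul_of_nonneg_right (hBd 2) hI0
        linarith

end Tri

/-! ### Point values of functions in `H²` -/

/-- The pointwise Sobolev inequality in the plane: the Taylor formula expresses `ψ a` through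
values near `x` and a remainder, and averaging over `x` bounds the remainder by the Hessian. -/
theorem sq_mul_volume_le {Ω : Set Plane} (hΩ : IsOpen Ω) (hc : Convex ℝ Ω)
    (hb : Bornology.IsBounded Ω) {D : ℝ} {a : Plane} (ha : a ∈ closure Ω)
    (hD : ∀ x ∈ Ω, ‖a - x‖ ≤ D) {ψ : Plane → ℝ} (hψ : ContDiff ℝ ∞ ψ) :
    ψ a ^ 2 * volume.real Ω ≤ 3 * (D ^ 4 * ∫ x in Ω, hessSq ψ x) +
      3 * (∫ x in Ω, ψ x ^ 2) + 3 * (D ^ 2 * ∫ x in Ω, ‖gradient ψ x‖ ^ 2) := by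
  have h1 := integral_taylorRem_sq_le hψ hΩ.measurableSet hb hD fun x hx t ht => by
    have := hc.combo_interior_closure_mem_interior (x := x) (y := a) (a := 1 - t) (b := t)
      (by rwa [hΩ.interior_eq]) ha (by linarith [ht.2]) ht.1.le (by ring)
    rw [hΩ.interior_eq] at this
    convert this using 1
    module
  have cg := continuous_gradient (hψ.of_le (m := 1) (by norm_num))
  have i1 : IntegrableOn (fun x => taylorRem ψ a x ^ 2) Ω :=
    integrableOn_of_continuous_of_bounded hb ((continuous_taylorRem hψ a).pow 2)
  have i2 : IntegrableOn (fun x => ψ x ^ 2) Ω :=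
    integrableOn_of_continuous_of_bounded hb (hψ.continuous.pow 2)
  have i3 : IntegrableOn (fun x => ‖gradient ψ x‖ ^ 2) Ω :=
    integrableOn_of_continuous_of_bounded hb (cg.norm.pow 2)
  have j2 : IntegrableOn (fun x => 3 * taylorRem ψ a x ^ 2 + 3 * ψ x ^ 2) Ω :=
    (i1.const_mul 3).add (i2.const_mul 3)
  have j3 : IntegrableOn (fun x => 3 * taylorRem ψ a x ^ 2 + 3 * ψ x ^ 2 +
      3 * D ^ 2 * ‖gradient ψ x‖ ^ 2) Ω := j2.add (i3.const_mul (3 * D ^ 2))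
  have h2 : ∫ _ in Ω, ψ a ^ 2 ≤ ∫ x in Ω, (3 * taylorRem ψ a x ^ 2 + 3 * ψ x ^ 2 +
      3 * D ^ 2 * ‖gradient ψ x‖ ^ 2) := by
    refine setIntegral_mono_on (integrableOn_const hb.measure_lt_top.ne) j3 hΩ.measurableSet
      fun x hx => ?_
    have e : ψ a = taylorRem ψ a x + ψ x + inner ℝ (gradient ψ x) (a - x) := by
      rw [taylorRem]
      ring
    have h3 : |(inner ℝ (gradient ψ x) (a - x) : ℝ)| ≤ ‖gradient ψ x‖ * D :=
      (abs_real_inner_le_norm _ _).trans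
        (mul_le_mul_of_nonneg_left (hD x hx) (norm_nonneg _))
    have h4 := sq_le_sq' (neg_le_of_abs_le h3) (le_of_abs_le h3)
    have h5 := sq_sum_three_le (taylorRem ψ a x) (ψ x) (inner ℝ (gradient ψ x) (a - x))
    rw [← e] at h5
    linarith
  rw [setIntegral_const, integral_add j2 (i3.const_mul _),
    integral_add (i1.const_mul 3) (i2.const_mul 3), integral_const_mul, integral_const_mul,
    integral_const_mul, smul_eq_mul] at h2
  linarith

/-- A smooth approximation in `H²` converges uniformly up to the boundary, so a function in `H²` has
a continuous representative there. -/
theorem exists_tendstoUniformlyOn {Ω : Set Plane} (hΩ : IsOpen Ω) (hc : Convex ℝ Ω)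
    (hb : Bornology.IsBounded Ω) (hne : Ω.Nonempty) {u : Plane → ℝ} (hu : MemH2 Ω u)
    {φ : ℕ → Plane → ℝ} (hφ : ∀ n, ContDiff ℝ ∞ (φ n))
    (h0 : Tendsto (fun n => ∫ x in Ω, ‖φ n x - u x‖ ^ 2) atTop (𝓝 0))
    (h1 : ∀ i, Tendsto (fun n => ∫ x in Ω, ‖pd i (φ n) x - weakPartial Ω i u x‖ ^ 2) atTop (𝓝 0))
    (h2 : ∀ i j, Tendsto (fun n => ∫ x in Ω, ‖pd j (pd i (φ n)) x -
        weakPartial Ω j (weakPartial Ω i u) x‖ ^ 2) atTop (𝓝 0)) :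
    ∃ û : Plane → ℝ, ContinuousOn û (closure Ω) ∧ TendstoUniformlyOn φ û atTop (closure Ω) ∧
      û =ᵐ[volume.restrict Ω] u := by
  set D := Metric.diam (closure Ω) with hD
  have hDle : ∀ a ∈ closure Ω, ∀ x ∈ Ω, ‖a - x‖ ≤ D := fun a ha x hx => by
    rw [← dist_eq_norm]
    exact Metric.dist_le_diam_of_mem hb.closure ha (subset_closure hx)
  have hvol : 0 < volume.real Ω :=
    ENNReal.toReal_pos (hΩ.measure_pos volume hne).ne' hb.measure_lt_top.ne
  have mS : ∀ {f : Plane → ℝ}, Continuous f → MemLp f 2 (volume.restrict Ω) :=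
    fun hf => memLp_two_of_continuous_of_bounded hb hf
  have hpdc : ∀ n i, Continuous (pd i (φ n)) := fun n i => (contDiff_pd (hφ n) i).continuous
  have hpddc : ∀ n i j, Continuous (pd j (pd i (φ n))) := fun n i j =>
    (contDiff_pd (contDiff_pd (hφ n) i) j).continuous
  set Q : ℕ → ℝ := fun n => 3 * (D ^ 4 * ∑ i : Fin 2, ∑ j : Fin 2,
      ∫ x in Ω, ‖pd j (pd i (φ n)) x - weakPartial Ω j (weakPartial Ω i u) x‖ ^ 2) +
    3 * (∫ x in Ω, ‖φ n x - u x‖ ^ 2) +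
    3 * (D ^ 2 * ∑ i : Fin 2, ∫ x in Ω, ‖pd i (φ n) x - weakPartial Ω i u x‖ ^ 2) with hQ
  have hQ0 : Tendsto Q atTop (𝓝 0) := by
    have e1 := tendsto_finsetSum Finset.univ fun i (_ : i ∈ Finset.univ) =>
      tendsto_finsetSum Finset.univ fun j (_ : j ∈ Finset.univ) => h2 i j
    have e2 := tendsto_finsetSum Finset.univ fun i (_ : i ∈ Finset.univ) => h1 i
    have := (((e1.const_mul (D ^ 4)).const_mul 3).add (h0.const_mul 3)).add
      ((e2.const_mul (D ^ 2)).const_mul 3)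
    simpa only [mul_zero, add_zero, Finset.sum_const_zero] using this
  -- the difference of two members of the sequence is split at the limit
  have split : ∀ {f g w : Plane → ℝ}, MemLp f 2 (volume.restrict Ω) →
      MemLp g 2 (volume.restrict Ω) → MemLp w 2 (volume.restrict Ω) →
      ∫ x in Ω, (f x - g x) ^ 2 ≤ 2 * (∫ x in Ω, ‖f x - w x‖ ^ 2) +
        2 * ∫ x in Ω, ‖g x - w x‖ ^ 2 := by
    intro f g w hf hg hw
    have := integral_sq_add_le (hf.sub hw) (hw.sub hg)
    simp only [Pi.sub_apply, sub_add_sub_cancel, Real.norm_eq_abs, sq_abs] at this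
    have e : ∀ x, (w x - g x) ^ 2 = (g x - w x) ^ 2 := fun x => by ring
    simp only [e] at this
    simpa [Real.norm_eq_abs, sq_abs] using this
  have key : ∀ n m, ∀ a ∈ closure Ω, (φ n a - φ m a) ^ 2 * volume.real Ω ≤ 2 * Q n + 2 * Q m := by
    intro n m a ha
    have hψ : ContDiff ℝ ∞ (fun x => φ n x - φ m x) := (hφ n).sub (hφ m)
    have hpd : ∀ i, pd i (fun x => φ n x - φ m x) = fun x => pd i (φ n) x - pd i (φ m) x := by
      intro i
      ext x
      simp only [pd]
      rw [fderiv_fun_sub ((hφ n).differentiable (by norm_num) x)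
        ((hφ m).differentiable (by norm_num) x)]
      rfl
    have hpd2 : ∀ i j, pd j (pd i (fun x => φ n x - φ m x)) =
        fun x => pd j (pd i (φ n)) x - pd j (pd i (φ m)) x := by
      intro i j
      rw [hpd]
      ext x
      change fderiv ℝ (fun y => pd i (φ n) y - pd i (φ m) y) x _ = _
      rw [fderiv_fun_sub ((contDiff_pd (hφ n) i).differentiable (by norm_num) x)
        ((contDiff_pd (hφ m) i).differentiable (by norm_num) x)]
      rfl
    have b := sq_mul_volume_le hΩ hc hb ha (hDle a ha) hψ
    have s0 := split (mS (hφ n).continuous) (mS (hφ m).continuous) hu.1.1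
    have s1 : ∫ x in Ω, ‖gradient (fun x => φ n x - φ m x) x‖ ^ 2 ≤
        2 * (∑ i : Fin 2, ∫ x in Ω, ‖pd i (φ n) x - weakPartial Ω i u x‖ ^ 2) +
        2 * ∑ i : Fin 2, ∫ x in Ω, ‖pd i (φ m) x - weakPartial Ω i u x‖ ^ 2 := by
      have e : ∀ x, ‖gradient (fun x => φ n x - φ m x) x‖ ^ 2 =
          ∑ i : Fin 2, (pd i (φ n) x - pd i (φ m) x) ^ 2 := by
        intro x
        rw [EuclideanSpace.norm_sq_eq]
        refine Finset.sum_congr rfl fun i _ => ?_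
        have := congrFun (hpd i) x
        rw [gradient_apply, ← this, Real.norm_eq_abs, sq_abs]
        rfl
      simp only [e]
      have hi : ∀ i, IntegrableOn (fun x => (pd i (φ n) x - pd i (φ m) x) ^ 2) Ω := fun i =>
        integrableOn_of_continuous_of_bounded hb (((hpdc n i).sub (hpdc m i)).pow 2)
      rw [integral_finsetSum _ fun i _ => hi i,
        Finset.mul_sum, Finset.mul_sum, ← Finset.sum_add_distrib]
      exact Finset.sum_le_sum fun i _ => split (mS (hpdc n i)) (mS (hpdc m i)) (hu.1.2 i).2
    have s2 : ∫ x in Ω, hessSq (fun x => φ n x - φ m x) x ≤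
        2 * (∑ i : Fin 2, ∑ j : Fin 2, ∫ x in Ω, ‖pd j (pd i (φ n)) x -
          weakPartial Ω j (weakPartial Ω i u) x‖ ^ 2) +
        2 * ∑ i : Fin 2, ∑ j : Fin 2, ∫ x in Ω, ‖pd j (pd i (φ m)) x -
          weakPartial Ω j (weakPartial Ω i u) x‖ ^ 2 := by
      simp only [hessSq, hpd2]
      have hi : ∀ i j, IntegrableOn
          (fun x => (pd j (pd i (φ n)) x - pd j (pd i (φ m)) x) ^ 2) Ω := fun i j =>
        integrableOn_of_continuous_of_bounded hb (((hpddc n i j).sub (hpddc m i j)).pow 2)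
      rw [integral_finsetSum _ fun i _ => integrable_finsetSum _ fun j _ => hi i j,
        Finset.mul_sum, Finset.mul_sum, ← Finset.sum_add_distrib]
      refine Finset.sum_le_sum fun i _ => ?_
      rw [integral_finsetSum _ fun j _ => hi i j,
        Finset.mul_sum, Finset.mul_sum, ← Finset.sum_add_distrib]
      exact Finset.sum_le_sum fun j _ =>
        split (mS (hpddc n i j)) (mS (hpddc m i j)) ((hu.2 i).2 j).2
    have t1 := mul_le_mul_of_nonneg_left s1 (sq_nonneg D)
    have t2 := mul_le_mul_of_nonneg_left s2 (pow_nonneg (Metric.diam_nonneg (s := closure Ω)) 4)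
    rw [← hD] at t2
    simp only [hQ]
    linarith
  have hC : UniformCauchySeqOn φ atTop (closure Ω) := by
    rw [Metric.uniformCauchySeqOn_iff]
    intro r hr
    have hp : 0 < r ^ 2 * volume.real Ω / 4 := by positivity
    obtain ⟨N, hN⟩ := eventually_atTop.1 (hQ0.eventually (gt_mem_nhds hp))
    refine ⟨N, fun m hm n hn a ha => ?_⟩
    have k := key m n a ha
    have k1 := hN m hm
    have k2 := hN n hn
    have k3 : (φ m a - φ n a) ^ 2 * volume.real Ω < r ^ 2 * volume.real Ω := by linarith
    have k4 := lt_of_mul_lt_mul_right k3 hvol.le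
    rw [Real.dist_eq]
    exact abs_lt_of_sq_lt_sq k4 hr.le
  have hpt : ∀ a, ∃ l, a ∈ closure Ω → Tendsto (fun n => φ n a) atTop (𝓝 l) := by
    intro a
    by_cases ha : a ∈ closure Ω
    · obtain ⟨l, hl⟩ := cauchySeq_tendsto_of_complete (hC.cauchySeq ha)
      exact ⟨l, fun _ => hl⟩
    · exact ⟨0, fun h => absurd h ha⟩
  choose û hû using hpt
  have hU := hC.tendstoUniformlyOn_of_tendsto fun a ha => hû a ha
  refine ⟨û, hU.continuousOn (Frequently.of_forall fun n => (hφ n).continuous.continuousOn),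
    hU, ?_⟩
  have hm : ∀ n, MemLp (fun x => φ n x - u x) 2 (volume.restrict Ω) := fun n =>
    (mS (hφ n).continuous).sub hu.1.1
  have e1 := (tendsto_integral_sq_iff hm).1 h0
  have e2 : TendstoInMeasure (volume.restrict Ω) φ atTop u :=
    tendstoInMeasure_of_tendsto_eLpNorm (by norm_num)
      (fun n => (hφ n).continuous.aestronglyMeasurable) hu.1.1.1 e1
  obtain ⟨ns, hns, hae⟩ := e2.exists_seq_tendsto_ae
  filter_upwards [hae, ae_restrict_mem hΩ.measurableSet] with x hx hxΩ
  exact tendsto_nhds_unique ((hû x (subset_closure hxΩ)).comp hns.tendsto_atTop) hx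

/-! ### The trace of a function in `H¹₀` -/

/-- A one-directional Poincaré inequality: where the translate by `v` leaves the support, the
fundamental theorem of calculus recovers `φ` from its gradient along the segment. -/
theorem lintegral_sq_le_of_translate {φ : Plane → ℝ} (hφ : ContDiff ℝ ∞ φ) {A N : Set Plane}
    (hA : MeasurableSet A) (hN : MeasurableSet N) {v : Plane} (h0 : ∀ x ∈ A, φ (x + v) = 0)
    (hseg : ∀ x ∈ A, ∀ t ∈ Ioc (0 : ℝ) 1, x + t • v ∈ N) :
    ∫⁻ x in A, ENNReal.ofReal (φ x ^ 2) ≤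
      ENNReal.ofReal (‖v‖ ^ 2) * ∫⁻ x in N, ENNReal.ofReal (‖gradient φ x‖ ^ 2) := by
  have cg := continuous_gradient (hφ.of_le (m := 1) (by norm_num))
  have hpt : ∀ x ∈ A, ENNReal.ofReal (φ x ^ 2) ≤ ∫⁻ t in Ioc (0 : ℝ) 1,
      ENNReal.ofReal (‖v‖ ^ 2) * ENNReal.ofReal (‖gradient φ (x + t • v)‖ ^ 2) := by
    intro x hx
    have hline : Continuous fun t : ℝ => x + t • v := by fun_prop
    have hcont : Continuous fun t : ℝ => fderiv ℝ φ (x + t • v) v :=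
      ((hφ.continuous_fderiv (by norm_num)).comp hline).clm_apply continuous_const
    have h1 := intervalIntegral.integral_eq_sub_of_hasDerivAt
      (fun t _ => hasDerivAt_along hφ x v t) (hcont.intervalIntegrable 0 1)
    simp only [one_smul, zero_smul, add_zero, h0 x hx, zero_sub] at h1
    have h2 : ENNReal.ofReal (φ x ^ 2) = ‖∫ t in (0 : ℝ)..1, fderiv ℝ φ (x + t • v) v‖ₑ ^ 2 := by
      rw [h1, ← ofReal_norm, ← ENNReal.ofReal_pow (norm_nonneg _), Real.norm_eq_abs, sq_abs,
        neg_sq]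
    rw [h2]
    refine (enorm_intervalIntegral_sq_le hcont).trans (lintegral_mono fun t => ?_)
    rw [← ENNReal.ofReal_mul (by positivity)]
    refine ENNReal.ofReal_le_ofReal ?_
    rw [fderiv_eq_inner_gradient]
    have h3 := abs_real_inner_le_norm (gradient φ (x + t • v)) v
    have h4 := sq_le_sq' (neg_le_of_abs_le h3) (le_of_abs_le h3)
    rw [mul_pow] at h4
    linarith
  calc ∫⁻ x in A, ENNReal.ofReal (φ x ^ 2)
      ≤ ∫⁻ x in A, ∫⁻ t in Ioc (0 : ℝ) 1,
          ENNReal.ofReal (‖v‖ ^ 2) * ENNReal.ofReal (‖gradient φ (x + t • v)‖ ^ 2) :=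
        setLIntegral_mono' hA hpt
    _ = ∫⁻ t in Ioc (0 : ℝ) 1, ∫⁻ x in A,
          ENNReal.ofReal (‖v‖ ^ 2) * ENNReal.ofReal (‖gradient φ (x + t • v)‖ ^ 2) := by
        refine lintegral_lintegral_swap (Measurable.aemeasurable ?_)
        have : Continuous fun p : Plane × ℝ => ‖gradient φ (p.1 + p.2 • v)‖ ^ 2 := by fun_prop
        exact this.measurable.ennreal_ofReal.const_mul _
    _ ≤ ∫⁻ t in Ioc (0 : ℝ) 1,
          ENNReal.ofReal (‖v‖ ^ 2) * ∫⁻ x in N, ENNReal.ofReal (‖gradient φ x‖ ^ 2) := by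
        refine setLIntegral_mono' measurableSet_Ioc fun t ht => ?_
        rw [lintegral_const_mul' _ _ (by simp)]
        refine mul_le_mul' le_rfl ?_
        calc ∫⁻ x in A, ENNReal.ofReal (‖gradient φ (x + t • v)‖ ^ 2)
            ≤ ∫⁻ x in A, N.indicator (fun z => ENNReal.ofReal (‖gradient φ z‖ ^ 2)) (x + t • v) := by
              refine setLIntegral_mono' hA fun x hx => ?_
              rw [indicator_of_mem (hseg x hx t ht)]
          _ ≤ ∫⁻ x, N.indicator (fun z => ENNReal.ofReal (‖gradient φ z‖ ^ 2)) (x + t • v) :=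
              setLIntegral_le_lintegral _ _
          _ = ∫⁻ x in N, ENNReal.ofReal (‖gradient φ x‖ ^ 2) := by
              rw [lintegral_add_right_eq_self
                (fun z => N.indicator (fun z => ENNReal.ofReal (‖gradient φ z‖ ^ 2)) z) (t • v),
                lintegral_indicator hN]
    _ = _ := by
        rw [setLIntegral_const]
        simp

theorem gradient_eq_zero_of_isTest {U : Set Plane} {φ : Plane → ℝ} (h : IsTest U φ) {x : Plane}
    (hx : x ∉ U) : gradient φ x = 0 := by
  have h1 : fderiv ℝ φ x = 0 := by
    by_contra hne
    exact hx (h.2.2 (support_fderiv_subset ℝ hne))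
  rw [gradient, h1, map_zero]

theorem IsTest.integral_sq_le_of_translate {Ω : Set Plane} (hΩ : IsOpen Ω)
    (hb : Bornology.IsBounded Ω) {φ : Plane → ℝ} (hφ : IsTest Ω φ) {A N : Set Plane}
    (hA : MeasurableSet A) (hAΩ : A ⊆ Ω) (hN : MeasurableSet N) {v : Plane}
    (h0 : ∀ x ∈ A, x + v ∉ Ω) (hseg : ∀ x ∈ A, ∀ t ∈ Ioc (0 : ℝ) 1, x + t • v ∈ N) :
    ∫ x in A, φ x ^ 2 ≤ ‖v‖ ^ 2 * ∫ x in N ∩ Ω, ‖gradient φ x‖ ^ 2 := by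
  have h := lintegral_sq_le_of_translate hφ.1 hA hN
    (fun x hx => image_eq_zero_of_notMem_tsupport fun h' => h0 x hx (hφ.2.2 h')) hseg
  have cg := continuous_gradient (hφ.1.of_le (m := 1) (by norm_num))
  have e : ∫⁻ x in N, ENNReal.ofReal (‖gradient φ x‖ ^ 2) =
      ∫⁻ x in N ∩ Ω, ENNReal.ofReal (‖gradient φ x‖ ^ 2) := by
    rw [← lintegral_indicator hN, ← lintegral_indicator (hN.inter hΩ.measurableSet)]
    congr 1
    ext x
    by_cases hx : x ∈ N
    · by_cases hx' : x ∈ Ω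
      · rw [indicator_of_mem hx, indicator_of_mem (show x ∈ N ∩ Ω from ⟨hx, hx'⟩)]
      · rw [indicator_of_mem hx, indicator_of_notMem (show x ∉ N ∩ Ω from fun h' => hx' h'.2),
          gradient_eq_zero_of_isTest hφ hx']
        simp
    · rw [indicator_of_notMem hx, indicator_of_notMem (show x ∉ N ∩ Ω from fun h' => hx h'.1)]
  have i1 : IntegrableOn (fun x => φ x ^ 2) A :=
    integrableOn_of_continuous_of_bounded (hb.subset hAΩ) (hφ.1.continuous.pow 2)
  have i2 : IntegrableOn (fun x => ‖gradient φ x‖ ^ 2) (N ∩ Ω) :=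
    integrableOn_of_continuous_of_bounded (hb.subset inter_subset_right) (cg.norm.pow 2)
  rw [e, ← ofReal_integral_eq_lintegral_ofReal i1 (Eventually.of_forall fun _ => sq_nonneg _),
    ← ofReal_integral_eq_lintegral_ofReal i2 (Eventually.of_forall fun x => sq_nonneg _),
    ← ENNReal.ofReal_mul (by positivity)] at h
  exact (ENNReal.ofReal_le_ofReal_iff
    (mul_nonneg (by positivity) (integral_nonneg fun x => sq_nonneg _))).1 h

/-- The factor `4` comes from splitting squares in the passage to the limit. -/
theorem MemH10.integral_sq_le_of_translate {Ω : Set Plane} (hΩ : IsOpen Ω)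
    (hb : Bornology.IsBounded Ω) {u : Plane → ℝ} (hu : MemH10 Ω u) {A N : Set Plane}
    (hA : MeasurableSet A) (hAΩ : A ⊆ Ω) (hN : MeasurableSet N) {v : Plane}
    (h0 : ∀ x ∈ A, x + v ∉ Ω) (hseg : ∀ x ∈ A, ∀ t ∈ Ioc (0 : ℝ) 1, x + t • v ∈ N) :
    ∫ x in A, u x ^ 2 ≤ 4 * ‖v‖ ^ 2 * ∫ x in N ∩ Ω, ‖weakGrad Ω u x‖ ^ 2 := by
  obtain ⟨φ, hφ, t0, t1⟩ := hu.exists_tendsto hΩ hb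
  have hH := hu.1.isH1
  have hC : ∀ n, IsH1 Ω (φ n) (gradient (φ n)) := fun n =>
    isH1_of_contDiff hb ((hφ n).1.of_le (by norm_num))
  have hlim : Tendsto (fun n => 2 * (∫ x in Ω, ‖φ n x - u x‖ ^ 2) + 2 * (‖v‖ ^ 2 *
      (2 * (∫ x in Ω, ‖gradient (φ n) x - weakGrad Ω u x‖ ^ 2) +
        2 * ∫ x in N ∩ Ω, ‖weakGrad Ω u x‖ ^ 2))) atTop
      (𝓝 (2 * 0 + 2 * (‖v‖ ^ 2 * (2 * 0 + 2 * ∫ x in N ∩ Ω, ‖weakGrad Ω u x‖ ^ 2)))) :=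
    (t0.const_mul 2).add ((((t1.const_mul 2).add tendsto_const_nhds).const_mul _).const_mul 2)
  refine (ge_of_tendsto' hlim fun n => ?_).trans_eq (by ring)
  have hNΩ : N ∩ Ω ⊆ Ω := inter_subset_right
  have r : ∀ {E : Type} [NormedAddCommGroup E] {f : Plane → E} {S : Set Plane}, S ⊆ Ω →
      MemLp f 2 (volume.restrict Ω) → MemLp f 2 (volume.restrict S) :=
    fun hS hf => hf.mono_measure (Measure.restrict_mono hS le_rfl)
  have m0 : ∀ {f : Plane → ℝ} {S : Set Plane}, S ⊆ Ω → IntegrableOn f Ω → (∀ x, 0 ≤ f x) →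
      ∫ x in S, f x ≤ ∫ x in Ω, f x := fun hS hf hp =>
    setIntegral_mono_set hf (Eventually.of_forall hp) hS.eventuallyLE
  have a1 := integral_sq_add_le (r hAΩ (hH.1.sub (hC n).1)) (r hAΩ (hC n).1)
  have a2 := integral_sq_add_le (r hNΩ ((hC n).2.1.sub hH.2.1)) (r hNΩ hH.2.1)
  have a3 := (hφ n).integral_sq_le_of_translate hΩ hb hA hAΩ hN h0 hseg
  have a4 := m0 hAΩ (integrable_norm_sq ((hC n).1.sub hH.1)) fun x => sq_nonneg _
  have a5 := m0 hNΩ (integrable_norm_sq ((hC n).2.1.sub hH.2.1)) fun x => sq_nonneg _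
  simp only [Pi.sub_apply, sub_add_cancel] at a1 a2 a4 a5
  have e1 : ∀ x, ‖u x - φ n x‖ ^ 2 = ‖φ n x - u x‖ ^ 2 := fun x => by rw [norm_sub_rev]
  simp only [e1] at a1
  have e2 : ∀ f : Plane → ℝ, ∫ x in A, ‖f x‖ ^ 2 = ∫ x in A, f x ^ 2 := fun f => by
    simp only [Real.norm_eq_abs, sq_abs]
  rw [e2 u, e2 (φ n)] at a1
  have a6 : ‖v‖ ^ 2 * ∫ x in N ∩ Ω, ‖gradient (φ n) x‖ ^ 2 ≤ ‖v‖ ^ 2 *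
      (2 * (∫ x in Ω, ‖gradient (φ n) x - weakGrad Ω u x‖ ^ 2) +
        2 * ∫ x in N ∩ Ω, ‖weakGrad Ω u x‖ ^ 2) :=
    mul_le_mul_of_nonneg_left (by linarith) (sq_nonneg _)
  linarith

/-- A continuous representative of a function in `H¹₀` of a convex set vanishes on the boundary. Near
a boundary point `b`, discs of radius comparable to their distance from `b` are translated out of
`Ω` by a vector of the same length; the Poincaré inequality there beats the area of the disc. -/
theorem MemH10.eq_zero_of_notMem {Ω : Set Plane} (hΩ : IsOpen Ω) (hc : Convex ℝ Ω)
    (hb : Bornology.IsBounded Ω) (hne : Ω.Nonempty) {u û : Plane → ℝ} (hu : MemH10 Ω u)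
    (hû : ContinuousOn û (closure Ω)) (hae : û =ᵐ[volume.restrict Ω] u) {b : Plane}
    (hbc : b ∈ closure Ω) (hbΩ : b ∉ Ω) : û b = 0 := by
  by_contra hne0
  obtain ⟨x₀, hx₀⟩ := hne
  obtain ⟨r, hr, hball⟩ := Metric.isOpen_iff.1 hΩ x₀ hx₀
  set d := b - x₀ with hd
  set R := ‖d‖ + r with hR
  set c := |û b| / 2 with hcdef
  have hc0 : 0 < c := by
    have := abs_pos.2 hne0
    positivity
  set δ : ℕ → ℝ := fun n => 1 / ((n : ℝ) + 1) with hδ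
  have hδ0 : ∀ n, 0 < δ n := fun n => by
    simp only [hδ]
    positivity
  have hδ1 : ∀ n, δ n ≤ 1 := fun n => by
    simp only [hδ]
    rw [div_le_one (by positivity)]
    linarith [n.cast_nonneg (α := ℝ)]
  have hδlim : Tendsto δ atTop (𝓝 0) := tendsto_one_div_add_atTop_nhds_zero_nat
  set A : ℕ → Set Plane := fun n => Metric.ball (b - (δ n / 2) • d) (δ n / 2 * r) with hA
  set N : ℕ → Set Plane := fun n => Metric.closedBall b (δ n * R) with hN
  -- `A n` is the image of a disc in `Ω` under the contraction by `δ n / 2` towards `b`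
  have hAΩ : ∀ n, A n ⊆ Ω := by
    intro n x hx
    have hδn := hδ0 n
    have hx' : ‖x - (b - (δ n / 2) • d)‖ < δ n / 2 * r := by
      rwa [← dist_eq_norm]
    have hy : x₀ + (2 / δ n) • (x - (b - (δ n / 2) • d)) ∈ interior Ω := by
      rw [hΩ.interior_eq]
      refine hball ?_
      rw [Metric.mem_ball, dist_eq_norm, add_sub_cancel_left, norm_smul, Real.norm_eq_abs,
        abs_of_pos (by positivity)]
      calc 2 / δ n * ‖x - (b - (δ n / 2) • d)‖ < 2 / δ n * (δ n / 2 * r) := by gcongr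
        _ = r := by field_simp
    have := hc.combo_closure_interior_mem_interior hbc hy (a := 1 - δ n / 2) (b := δ n / 2)
      (by linarith [hδ1 n]) (by positivity) (by ring)
    rw [hΩ.interior_eq] at this
    convert this using 1
    rw [smul_add, smul_smul, show δ n / 2 * (2 / δ n) = 1 by field_simp, hd]
    module
  have hout : ∀ n, ∀ x ∈ A n, x + δ n • d ∉ Ω := by
    intro n x hx hxd
    -- the reflection of `x + δ d` in `b` lies in the same disc
    have hy : b - (δ n / 2) • d - (x - (b - (δ n / 2) • d)) ∈ A n := by
      have hx' : ‖x - (b - (δ n / 2) • d)‖ < δ n / 2 * r := by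
        rwa [← dist_eq_norm]
      rw [hA, Metric.mem_ball, dist_eq_norm]
      rwa [show b - (δ n / 2) • d - (x - (b - (δ n / 2) • d)) - (b - (δ n / 2) • d) =
        -(x - (b - (δ n / 2) • d)) by abel, norm_neg]
    have := hc hxd (hAΩ n hy) (a := 1 / 2) (b := 1 / 2) (by norm_num) (by norm_num) (by norm_num)
    refine hbΩ ?_
    convert this using 1
    module
  have hseg : ∀ n, ∀ x ∈ A n, ∀ t ∈ Icc (0 : ℝ) 1, x + t • δ n • d ∈ N n := by
    intro n x hx t ht
    have hx' : ‖x - (b - (δ n / 2) • d)‖ < δ n / 2 * r := by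
      rwa [← dist_eq_norm]
    have hδn := hδ0 n
    rw [hN, Metric.mem_closedBall, dist_eq_norm,
      show x + t • δ n • d - b = (x - (b - (δ n / 2) • d)) + ((t - 1 / 2) * δ n) • d by module]
    refine (norm_add_le _ _).trans ?_
    rw [norm_smul, Real.norm_eq_abs, abs_mul, abs_of_pos hδn]
    have h1 : |t - 1 / 2| ≤ 1 := abs_le.2 ⟨by linarith [ht.1], by linarith [ht.2]⟩
    have h2 : |t - 1 / 2| * δ n * ‖d‖ ≤ 1 * δ n * ‖d‖ := by gcongr
    have h3 : δ n / 2 * r ≤ δ n * r := by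
      have := mul_pos hδn hr
      linarith
    rw [hR]
    linarith
  set I : ℕ → ℝ := fun n => ∫ x in N n ∩ Ω, ‖weakGrad Ω u x‖ ^ 2 with hI
  have hH := hu.1.isH1
  have hIlim : Tendsto I atTop (𝓝 0) := by
    have hint : IntegrableOn (fun x => ‖weakGrad Ω u x‖ ^ 2) Ω := integrable_norm_sq hH.2.1
    have hR0 : 0 < R := by positivity
    have h := tendsto_setIntegral_of_antitone (μ := volume) (s := fun n => N n ∩ Ω)
      (f := fun x => ‖weakGrad Ω u x‖ ^ 2)
      (fun n => Metric.isClosed_closedBall.measurableSet.inter hΩ.measurableSet)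
      (fun m n hmn => inter_subset_inter_left _ (Metric.closedBall_subset_closedBall
        (mul_le_mul_of_nonneg_right (one_div_le_one_div_of_le (by positivity)
          (by exact_mod_cast Nat.succ_le_succ hmn)) hR0.le)))
      ⟨0, hint.mono_set inter_subset_right⟩
    have he : ⋂ n, N n ∩ Ω = ∅ := by
      refine eq_empty_of_forall_notMem fun x hx => ?_
      have h1 := fun n => (mem_iInter.1 hx n).1
      have h2 : dist x b ≤ 0 * R :=
        ge_of_tendsto' (hδlim.mul_const R) fun n => Metric.mem_closedBall.1 (h1 n)
      rw [zero_mul] at h2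
      have h3 : x = b := dist_le_zero.1 h2
      exact hbΩ (h3 ▸ (mem_iInter.1 hx 0).2)
    rw [he] at h
    simpa using h
  -- the areas of the discs are `(δ r / 2)² θ`, so that both sides below scale like `δ²`
  set θ := volume.real (Metric.ball (0 : Plane) 1) with hθ
  have hθ0 : 0 < θ :=
    ENNReal.toReal_pos (Metric.measure_ball_pos volume _ one_pos).ne' measure_ball_lt_top.ne
  have hvolA : ∀ n, volume.real (A n) = (δ n / 2 * r) ^ 2 * θ := by
    intro n
    have hδn := hδ0 n
    rw [Measure.real, hA, Measure.addHaar_ball _ _ (by positivity), ENNReal.toReal_mul,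
      ENNReal.toReal_ofReal (by positivity), hθ, Measure.real]
    simp
  obtain ⟨η, hη, hηc⟩ := Metric.continuousOn_iff.1 hû b hbc c hc0
  have hlow : ∀ᶠ n in atTop, c ^ 2 * (r ^ 2 * θ) ≤ 16 * ‖d‖ ^ 2 * I n := by
    have hlim : Tendsto (fun n => δ n * R) atTop (𝓝 0) := by
      simpa using hδlim.mul_const R
    filter_upwards [hlim.eventually (gt_mem_nhds hη)] with n hn
    have hδn := hδ0 n
    have hP := hu.integral_sq_le_of_translate hΩ hb (A := A n) (N := N n) (v := δ n • d)
      Metric.isOpen_ball.measurableSet (hAΩ n) Metric.isClosed_closedBall.measurableSet (hout n)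
      (fun x hx t ht => hseg n x hx t ⟨ht.1.le, ht.2⟩)
    have hge : c ^ 2 * volume.real (A n) ≤ ∫ x in A n, u x ^ 2 := by
      have h1 : ∫ _ in A n, c ^ 2 = c ^ 2 * volume.real (A n) := by
        rw [setIntegral_const, smul_eq_mul, mul_comm]
      rw [← h1]
      have hAe : û =ᵐ[volume.restrict (A n)] u := ae_restrict_of_ae_restrict_of_subset (hAΩ n) hae
      have hm : ∀ᵐ x ∂(volume.restrict (A n)), x ∈ A n :=
        ae_restrict_mem Metric.isOpen_ball.measurableSet
      refine integral_mono_ae (integrableOn_const measure_ball_lt_top.ne) ?_ ?_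
      · have := integrable_norm_sq hH.1
        simp only [Real.norm_eq_abs, sq_abs] at this
        exact IntegrableOn.mono_set (t := Ω) this (hAΩ n)
      filter_upwards [hAe, hm] with x hx hxA
      have h2 : dist x b < η := by
        have := hseg n x hxA 0 ⟨le_rfl, zero_le_one⟩
        rw [zero_smul, add_zero] at this
        exact (Metric.mem_closedBall.1 this).trans_lt hn
      have h3 := hηc x (subset_closure (hAΩ n hxA)) h2
      rw [Real.dist_eq] at h3
      have h4 : c ≤ |û x| := by
        have h5 : |û b| ≤ |û x| + |û x - û b| := by
          rw [abs_sub_comm]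
          have := abs_add_le (û x) (û b - û x)
          simpa using this
        have h6 : |û b| = 2 * c := by
          rw [hcdef]
          ring
        linarith
      rw [← hx, ← sq_abs (û x)]
      exact pow_le_pow_left₀ hc0.le h4 2
    rw [hvolA n] at hge
    rw [norm_smul, Real.norm_eq_abs, abs_of_pos hδn] at hP
    have h7 := hge.trans hP
    have h8 : (δ n) ^ 2 * (c ^ 2 * (r ^ 2 * θ)) ≤ (δ n) ^ 2 * (16 * ‖d‖ ^ 2 * I n) := by
      have e1 : c ^ 2 * ((δ n / 2 * r) ^ 2 * θ) = (δ n) ^ 2 * (c ^ 2 * (r ^ 2 * θ)) / 4 := by ring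
      rw [e1] at h7
      simp only [hI]
      linarith
    exact le_of_mul_le_mul_left h8 (by positivity)
  have hfin : c ^ 2 * (r ^ 2 * θ) ≤ 16 * ‖d‖ ^ 2 * 0 :=
    ge_of_tendsto (hIlim.const_mul _) hlow
  have : 0 < c ^ 2 * (r ^ 2 * θ) := by positivity
  linarith

/-! ### Interpolation of functions in `H² ∩ H¹₀` -/

theorem energy_sub_gradient_eq {Ω : Set Plane} (hb : Bornology.IsBounded Ω) {u φ : Plane → ℝ}
    (hu : MemH1 Ω u) (hφ : ContDiff ℝ ∞ φ) :
    energy Ω (fun x => u x - φ x) (fun x => weakGrad Ω u x - gradient φ x) =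
      (∫ x in Ω, ‖φ x - u x‖ ^ 2) + ∑ i : Fin 2, ∫ x in Ω, ‖pd i φ x - weakPartial Ω i u x‖ ^ 2 := by
  have hi : ∀ i, IntegrableOn (fun x => ‖pd i φ x - weakPartial Ω i u x‖ ^ 2) Ω := fun i =>
    integrable_norm_sq
      ((memLp_two_of_continuous_of_bounded hb (contDiff_pd hφ i).continuous).sub (hu.2 i).2)
  rw [energy, ← integral_finsetSum _ fun i _ => hi i]
  congr 1
  · refine integral_congr_ae (Eventually.of_forall fun x => ?_)
    simp only [Real.norm_eq_abs, sq_abs]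
    ring
  · refine integral_congr_ae (Eventually.of_forall fun x => ?_)
    simp only [EuclideanSpace.norm_sq_eq]
    refine Finset.sum_congr rfl fun i _ => ?_
    rw [← norm_neg]
    congr 2
    rw [PiLp.sub_apply, gradient_apply]
    simp [weakGrad, pd]

theorem Tri.interp_energy_sub_le (T : Tri) {a b : Plane → ℝ} {η : ℝ}
    (h : ∀ i, |a (T.points i) - b (T.points i)| ≤ η) {x : Plane} (hx : x ∈ Tri.carrier T) :
    (Triangulation.interp T a x - Triangulation.interp T b x) ^ 2 +
      ‖affGrad (Triangulation.interp T a) - affGrad (Triangulation.interp T b)‖ ^ 2 ≤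
      η ^ 2 * (1 + (∑ i, ‖Tri.bgrad T i‖) ^ 2) := by
  have hη : 0 ≤ η := (abs_nonneg _).trans (h 0)
  have h1 : |Triangulation.interp T a x - Triangulation.interp T b x| ≤ η := by
    rw [Triangulation.interp_apply, Triangulation.interp_apply, ← Finset.sum_sub_distrib]
    calc |∑ i, (Tri.coord T i x * a (T.points i) - Tri.coord T i x * b (T.points i))|
        ≤ ∑ i, |Tri.coord T i x * a (T.points i) - Tri.coord T i x * b (T.points i)| :=
          Finset.abs_sum_le_sum_abs _ _
      _ ≤ ∑ i, Tri.coord T i x * η := by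
          refine Finset.sum_le_sum fun i _ => ?_
          rw [← mul_sub, abs_mul, abs_of_nonneg ((Tri.mem_carrier_iff T).1 hx i)]
          exact mul_le_mul_of_nonneg_left (h i) ((Tri.mem_carrier_iff T).1 hx i)
      _ = η := by rw [← Finset.sum_mul, Tri.sum_coord, one_mul]
  have h2 : ‖affGrad (Triangulation.interp T a) - affGrad (Triangulation.interp T b)‖ ≤
      η * ∑ i, ‖Tri.bgrad T i‖ := by
    rw [Tri.affGrad_interp, Tri.affGrad_interp, ← Finset.sum_sub_distrib, Finset.mul_sum]
    refine norm_sum_le_of_le _ fun i _ => ?_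
    rw [← sub_smul, norm_smul]
    exact mul_le_mul_of_nonneg_right (h i) (norm_nonneg _)
  have h3 := sq_le_sq' (neg_le_of_abs_le h1) (le_of_abs_le h1)
  have h4 := pow_le_pow_left₀ (norm_nonneg _) h2 2
  rw [mul_pow] at h4
  linarith

theorem add_sq_add_norm_add_sq_le (a b : ℝ) (A B : Plane) :
    (a + b) ^ 2 + ‖A + B‖ ^ 2 ≤ 2 * (a ^ 2 + ‖A‖ ^ 2) + 2 * (b ^ 2 + ‖B‖ ^ 2) := by
  have h1 := pow_le_pow_left₀ (norm_nonneg _) (norm_add_le A B) 2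
  nlinarith [sq_nonneg (a - b), sq_nonneg (‖A‖ - ‖B‖)]

/-- The error of a finite element function whose nodal values are within `η` of those of a smooth
function. -/
theorem Triangulation.energy_sub_le {Ω : Set Plane} (hΩ : IsConvexPolygon Ω) (M : Triangulation Ω)
    {σ : ℝ} (hM : M.ShapeRegular σ) (hh : M.meshSize ≤ 1) {φ : Plane → ℝ} (hφ : ContDiff ℝ ∞ φ)
    {v a : Plane → ℝ} (hv : M.MemV v)
    (hva : ∀ T ∈ M.elems, ∀ x ∈ Tri.carrier T, v x = interp T a x) {η : ℝ}
    (hη : ∀ T ∈ M.elems, ∀ i, |φ (T.points i) - a (T.points i)| ≤ η) :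
    energy Ω (fun x => φ x - v x) (fun x => gradient φ x - gradient v x) ≤
      18 * (1 + σ ^ 2) * M.meshSize ^ 2 * (∫ x in Ω, hessSq φ x) +
        2 * η ^ 2 * ∑ T ∈ M.elems, volume.real (Tri.carrier T) *
          (1 + (∑ i, ‖Tri.bgrad T i‖) ^ 2) := by
  have hH := (isH1_of_contDiff hΩ.isBounded (hφ.of_le (by norm_num))).sub (hv.isH1 hΩ)
  have cg := continuous_gradient (hφ.of_le (m := 1) (by norm_num))
  rw [← integral_energy hH, M.setIntegral_eq_sum hΩ (integrableOn_energy hH),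
    M.setIntegral_eq_sum hΩ (integrableOn_of_continuous_of_bounded hΩ.isBounded
      (continuous_hessSq hφ)), Finset.mul_sum, Finset.mul_sum, ← Finset.sum_add_distrib]
  refine Finset.sum_le_sum fun T hT => ?_
  obtain ⟨c, r, hr, hball, hσ⟩ := hM T hT
  have hI := Tri.integral_interp_sub_le T hφ hr hball hσ (M.diam_le_meshSize hT) hh
  have hKb := (Tri.isCompact_carrier T).isBounded
  have i1 : IntegrableOn (fun x => (interp T φ x - φ x) ^ 2 +
      ‖affGrad (interp T φ) - gradient φ x‖ ^ 2) (Tri.carrier T) := by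
    refine integrableOn_of_continuous_of_bounded hKb ?_
    exact (((continuous_affine _).sub hφ.continuous).pow 2).add
      ((continuous_const.sub cg).norm.pow 2)
  set B := η ^ 2 * (1 + (∑ i, ‖Tri.bgrad T i‖) ^ 2) with hB
  have i2 : IntegrableOn (fun _ : Plane => 2 * B) (Tri.carrier T) :=
    integrableOn_const (Tri.isCompact_carrier T).measure_lt_top.ne
  have hle : ∫ x in Tri.carrier T, ((φ x - v x) ^ 2 + ‖gradient φ x - gradient v x‖ ^ 2) ≤
      ∫ x in Tri.carrier T, (2 * ((interp T φ x - φ x) ^ 2 +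
        ‖affGrad (interp T φ) - gradient φ x‖ ^ 2) + 2 * B) := by
    rw [← Tri.restrict_interior_carrier]
    rw [IntegrableOn, ← Tri.restrict_interior_carrier] at i1 i2
    refine integral_mono_ae ?_ ((i1.const_mul 2).add i2) ?_
    · exact (integrableOn_energy hH).mono_set (M.interior_carrier_subset hΩ hT)
    filter_upwards [ae_restrict_mem isOpen_interior.measurableSet] with x hx
    have hxT := interior_subset hx
    rw [MemV.gradient_eq (hva T hT) hx, hva T hT x hxT]
    have h1 := Tri.interp_energy_sub_le T (hη T hT) hxT
    have h2 := add_sq_add_norm_add_sq_le (φ x - interp T φ x) (interp T φ x - interp T a x)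
      (gradient φ x - affGrad (interp T φ)) (affGrad (interp T φ) - affGrad (interp T a))
    simp only [sub_add_sub_cancel] at h2
    rw [norm_sub_rev (gradient φ x) (affGrad (interp T φ)),
      show (φ x - interp T φ x) ^ 2 = (interp T φ x - φ x) ^ 2 by ring] at h2
    linarith
  rw [integral_add (i1.const_mul 2) i2, integral_const_mul, setIntegral_const, smul_eq_mul] at hle
  have e : volume.real (Tri.carrier T) * (2 * B) = 2 * η ^ 2 * (volume.real (Tri.carrier T) *
      (1 + (∑ i, ‖Tri.bgrad T i‖) ^ 2)) := by
    rw [hB]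
    ring
  linarith

/-- The nodal interpolant of a function in `H² ∩ H¹₀` is accurate to first order in `H¹`. The bound
passes to the limit along a smooth approximation, whose point values converge at the vertices. -/
theorem exists_interpolant_energy_le {Ω : Set Plane} (hΩ : IsConvexPolygon Ω) {u : Plane → ℝ}
    (hu : MemH2 Ω u) (hu0 : MemH10 Ω u) (σ : ℝ) :
    ∃ A : ℝ, 0 ≤ A ∧ ∀ M : Triangulation Ω, M.ShapeRegular σ → M.meshSize ≤ 1 →
      ∃ v, M.MemV v ∧ energy Ω (fun x => u x - v x) (fun x => weakGrad Ω u x - gradient v x) ≤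
        A * M.meshSize ^ 2 := by
  have hb := hΩ.isBounded
  obtain ⟨φ, hφ, h0, h1, h2⟩ := hu.exists_smooth_tendsto hΩ.isOpen hΩ.convex hb hΩ.1
  obtain ⟨û, hûc, hunif, hae⟩ :=
    exists_tendstoUniformlyOn hΩ.isOpen hΩ.convex hb hΩ.1 hu hφ h0 h1 h2
  have hû0 : ∀ x ∈ closure Ω, x ∉ Ω → û x = 0 := fun x hx hx' =>
    hu0.eq_zero_of_notMem hΩ.isOpen hΩ.convex hb hΩ.1 hûc hae hx hx'
  set W := ∑ i : Fin 2, ∑ j : Fin 2, ∫ x in Ω, ‖weakPartial Ω j (weakPartial Ω i u) x‖ ^ 2 with hW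
  have hW0 : 0 ≤ W := Finset.sum_nonneg fun i _ => Finset.sum_nonneg fun j _ =>
    integral_nonneg fun x => sq_nonneg _
  have hess : ∀ᶠ n in atTop, ∫ x in Ω, hessSq (φ n) x ≤ 2 + 2 * W := by
    have e1 := tendsto_finsetSum Finset.univ fun i (_ : i ∈ Finset.univ) =>
      tendsto_finsetSum Finset.univ fun j (_ : j ∈ Finset.univ) => h2 i j
    simp only [Finset.sum_const_zero] at e1
    filter_upwards [e1.eventually (gt_mem_nhds one_pos)] with n hn
    have hc : ∀ i j, Continuous (pd j (pd i (φ n))) := fun i j =>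
      (contDiff_pd (contDiff_pd (hφ n) i) j).continuous
    have hi : ∀ i j, IntegrableOn (fun x => pd j (pd i (φ n)) x ^ 2) Ω := fun i j =>
      integrableOn_of_continuous_of_bounded hb ((hc i j).pow 2)
    have : ∫ x in Ω, hessSq (φ n) x ≤ 2 * (∑ i : Fin 2, ∑ j : Fin 2, ∫ x in Ω,
        ‖pd j (pd i (φ n)) x - weakPartial Ω j (weakPartial Ω i u) x‖ ^ 2) + 2 * W := by
      simp only [hessSq]
      rw [integral_finsetSum _ fun i _ => integrable_finsetSum _ fun j _ => hi i j, hW,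
        Finset.mul_sum, Finset.mul_sum, ← Finset.sum_add_distrib]
      refine Finset.sum_le_sum fun i _ => ?_
      rw [integral_finsetSum _ fun j _ => hi i j,
        Finset.mul_sum, Finset.mul_sum, ← Finset.sum_add_distrib]
      refine Finset.sum_le_sum fun j _ => ?_
      have := integral_sq_add_le ((memLp_two_of_continuous_of_bounded hb (hc i j)).sub
        ((hu.2 i).2 j).2) ((hu.2 i).2 j).2
      simpa [Real.norm_eq_abs, sq_abs] using this
    linarith
  have hE : Tendsto (fun n => energy Ω (fun x => u x - φ n x)
      (fun x => weakGrad Ω u x - gradient (φ n) x)) atTop (𝓝 0) := by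
    have e2 := tendsto_finsetSum Finset.univ fun i (_ : i ∈ Finset.univ) => h1 i
    have := h0.add e2
    simp only [Finset.sum_const_zero, add_zero] at this
    exact this.congr fun n => (energy_sub_gradient_eq hb hu.1 (hφ n)).symm
  refine ⟨36 * (1 + σ ^ 2) * (2 + 2 * W), by positivity, fun M hM hh => ?_⟩
  obtain ⟨v, hv, hva⟩ := M.exists_interpolant hΩ hû0
  refine ⟨v, hv, ?_⟩
  set K := ∑ T ∈ M.elems, volume.real (Tri.carrier T) * (1 + (∑ i, ‖Tri.bgrad T i‖) ^ 2) with hK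
  set m := M.meshSize with hm
  -- the constant `K` depends on the triangulation, but `η` tends to `0` with the triangulation fixed
  have step : ∀ η : ℝ, 0 < η →
      energy Ω (fun x => u x - v x) (fun x => weakGrad Ω u x - gradient v x) ≤
        36 * (1 + σ ^ 2) * (2 + 2 * W) * m ^ 2 + 4 * η ^ 2 * K := by
    intro η hη
    have hlim := (hE.const_mul 2).add_const
      (36 * (1 + σ ^ 2) * (2 + 2 * W) * m ^ 2 + 4 * η ^ 2 * K)
    rw [mul_zero, zero_add] at hlim
    refine ge_of_tendsto hlim ?_
    filter_upwards [hess, Metric.tendstoUniformlyOn_iff.1 hunif η hη] with n hn hnη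
    have a1 := M.energy_sub_le hΩ hM hh (hφ n) hv hva (η := η) fun T hT i => by
      have := hnη _ (M.carrier_subset hT (Tri.points_mem_carrier T i))
      rw [dist_comm, Real.dist_eq] at this
      exact this.le
    have a2 := IsH1.energy_add_le
      (hu.1.isH1.sub (isH1_of_contDiff hb ((hφ n).of_le (m := 1) (by norm_num))))
      ((isH1_of_contDiff hb ((hφ n).of_le (m := 1) (by norm_num))).sub (hv.isH1 hΩ))
    simp only [sub_add_sub_cancel] at a2
    have a3 : 18 * (1 + σ ^ 2) * m ^ 2 * (∫ x in Ω, hessSq (φ n) x) ≤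
        18 * (1 + σ ^ 2) * m ^ 2 * (2 + 2 * W) := mul_le_mul_of_nonneg_left hn (by positivity)
    rw [← hm, ← hK] at a1
    linarith
  have hlim : Tendsto (fun η : ℝ => 36 * (1 + σ ^ 2) * (2 + 2 * W) * m ^ 2 + 4 * η ^ 2 * K)
      (𝓝[>] 0) (𝓝 (36 * (1 + σ ^ 2) * (2 + 2 * W) * m ^ 2 + 4 * 0 ^ 2 * K)) := by
    have : Continuous fun η : ℝ =>
        36 * (1 + σ ^ 2) * (2 + 2 * W) * m ^ 2 + 4 * η ^ 2 * K := by fun_prop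
    exact (this.tendsto 0).mono_left nhdsWithin_le_nhds
  have := ge_of_tendsto hlim (eventually_mem_nhdsWithin.mono fun η hη => step η hη)
  simpa using this

/-! ### The error estimate -/

theorem IsH1.energy_weakGrad {U : Set Plane} (hU : IsOpen U) {f : Plane → ℝ} {G : Plane → Plane}
    (h : IsH1 U f G) : energy U f (weakGrad U f) = energy U f G := by
  rw [energy, energy]
  congr 1
  refine integral_congr_ae ?_
  filter_upwards [h.weakGrad_ae hU] with x hx
  rw [hx]

theorem IsH1.energy_sub_le {U : Set Plane} {f f' : Plane → ℝ} {G G' : Plane → Plane}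
    (h : IsH1 U f G) (h' : IsH1 U f' G') :
    energy U (fun x => f x - f' x) (fun x => G x - G' x) ≤
      2 * energy U f G + 2 * energy U f' G' := by
  have := h.energy_add_le (h'.const_mul (-1))
  simpa [energy, sub_eq_add_neg] using this

theorem abs_innerL2_le {U : Set Plane} {f g : Plane → ℝ} {F G : Plane → Plane} (hf : IsH1 U f F)
    (hg : IsH1 U g G) {t : ℝ} (ht : 0 < t) :
    |innerL2 U f g| ≤ t⁻¹ * energy U f F + t * energy U g G := by
  have i1 := hf.1.integrable_sq
  have i2 := hg.1.integrable_sq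
  have h1 : |innerL2 U f g| ≤ ∫ x in U, (t⁻¹ * f x ^ 2 + t * g x ^ 2) := by
    rw [innerL2, ← Real.norm_eq_abs]
    refine norm_integral_le_of_norm_le ((i1.const_mul _).add (i2.const_mul _))
      (Eventually.of_forall fun x => ?_)
    rw [Real.norm_eq_abs, abs_mul]
    have := mul_le_young (a := |f x|) (b := 0) (c := |g x|) (d := 0) ht
    simpa using this
  rw [integral_add (i1.const_mul _) (i2.const_mul _), integral_const_mul, integral_const_mul] at h1
  have h2 : 0 ≤ t⁻¹ * ∫ x in U, ‖F x‖ ^ 2 :=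
    mul_nonneg (by positivity) (integral_nonneg fun _ => sq_nonneg _)
  have h3 : 0 ≤ t * ∫ x in U, ‖G x‖ ^ 2 :=
    mul_nonneg ht.le (integral_nonneg fun _ => sq_nonneg _)
  rw [energy, energy]
  linarith

namespace Triangulation

variable {Ω : Set Plane} {M : Triangulation Ω} {ε : Plane → ℝ} {ζ : Plane → Plane}
  {γ yd : Plane → ℝ}

theorem meshSize_pos (hΩ : IsConvexPolygon Ω) (M : Triangulation Ω) : 0 < M.meshSize := by
  obtain ⟨x, hx⟩ := hΩ.1
  have h1 : x ∈ ⋃ T ∈ M.elems, Tri.carrier T := by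
    rw [M.cover]
    exact subset_closure hx
  obtain ⟨T, hT, -⟩ := mem_iUnion₂.1 h1
  have h2 : T.points 0 ≠ T.points 1 := T.independent.injective.ne (by decide)
  have h3 := Tri.norm_sub_le_diam T (Tri.points_mem_carrier T 0) (Tri.points_mem_carrier T 1)
  exact (norm_pos_iff.2 (sub_ne_zero.2 h2)).trans_le (h3.trans (M.diam_le_meshSize hT))

/-- The distance of the discrete solution to an arbitrary pair `(P, Y)` of finite element functions.
The test pair `(ph - P, Y - yh)` makes the indefinite saddle-point form coercive; its zeroth-order
couplings cancel. -/
theorem IsDiscreteSolution.energy_sub_le (hΩ : IsConvexPolygon Ω)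
    (hε : MemLp ε ⊤ (volume.restrict Ω)) (hζ : MemLp ζ ⊤ (volume.restrict Ω))
    (hγ : MemLp γ ⊤ (volume.restrict Ω)) {p y ph yh P Y : Plane → ℝ}
    (hpy : IsSaddleSolution Ω ε ζ γ yd p y) (hs : M.IsDiscreteSolution ε ζ γ yd ph yh)
    (hP : M.MemV P) (hY : M.MemV Y) {β C K t : ℝ} (ht : 0 < t) (hβ : t * (K + C + 1) = β / 2)
    (hcoer : ∀ v, M.MemV v → β * energy Ω v (gradient v) ≤ M.formAh ε ζ γ v v)
    (hcons : ∀ w v : Plane → ℝ, M.MemV w → M.MemV v → ∀ t : ℝ, 0 < t →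
      |M.formAh ε ζ γ w v - formA Ω ε ζ γ w v| ≤
        C * M.meshSize * (t⁻¹ * energy Ω w (gradient w) + t * energy Ω v (gradient v)))
    (hbd : ∀ (f : Plane → ℝ) (F : Plane → Plane) (g : Plane → ℝ) (G : Plane → Plane),
      IsH1 Ω f F → IsH1 Ω g G → ∀ t : ℝ, 0 < t →
        |gradForm Ω ε ζ γ f F g G| ≤ K * (t⁻¹ * energy Ω f F + t * energy Ω g G)) :
    β / 2 * (energy Ω (ph - P) (gradient (ph - P)) + energy Ω (Y - yh) (gradient (Y - yh))) ≤
      t⁻¹ * ((K + 1) * (energy Ω (fun x => p x - P x) (fun x => weakGrad Ω p x - gradient P x) +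
          energy Ω (fun x => y x - Y x) (fun x => weakGrad Ω y x - gradient Y x)) +
        C * M.meshSize ^ 2 * (energy Ω P (gradient P) + energy Ω Y (gradient Y))) := by
  obtain ⟨hph, hyh, hsol⟩ := hs
  obtain ⟨hp0, hy0, hcont⟩ := hpy
  have he : M.MemV (ph - P) := M.femSpace.sub_mem hph hP
  have hz : M.MemV (Y - yh) := M.femSpace.sub_mem hY hyh
  set e := ph - P with he_def
  set z := Y - yh with hz_def
  set h := M.meshSize with hh_def
  have hh : 0 < h := M.meshSize_pos hΩ
  have Hp := hp0.1.isH1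
  have Hy := hy0.1.isH1
  have HP := hP.isH1 hΩ
  have HY := hY.isH1 hΩ
  have He := he.isH1 hΩ
  have Hz := hz.isH1 hΩ
  have Hph := hph.isH1 hΩ
  have Hyh := hyh.isH1 hΩ
  have hO := hΩ.isOpen
  have q1 := hsol e z he hz
  have q2 := hcont e z (he.memH10 hΩ) (hz.memH10 hΩ)
  rw [← q2, saddleForm, saddleForm] at q1
  have s1 : M.formAh ε ζ γ e ph = M.formAh ε ζ γ e P + M.formAh ε ζ γ e e := by
    rw [← formAh_add_right hγ He.1 HP.1 He.1, he_def, add_sub_cancel]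
  have s2 : M.formAh ε ζ γ Y z = M.formAh ε ζ γ yh z + M.formAh ε ζ γ z z := by
    rw [← formAh_add_left hγ Hyh.1 Hz.1 Hz.1, hz_def, add_sub_cancel]
  have s3 : innerL2 Ω y e = innerL2 Ω (fun x => y x - Y x) e + innerL2 Ω z e + innerL2 Ω yh e := by
    rw [← innerL2_add_left (Hy.sub HY).1 Hz.1 He.1, ← innerL2_add_left ((Hy.sub HY).1.add Hz.1)
      Hyh.1 He.1]
    congr 1
    ext x
    simp [hz_def]
  have s4 : innerL2 Ω p z + innerL2 Ω e z =
      innerL2 Ω (fun x => p x - P x) z + innerL2 Ω ph z := by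
    rw [← innerL2_add_left Hp.1 He.1 Hz.1, ← innerL2_add_left (Hp.sub HP).1 Hph.1 Hz.1]
    congr 1
    ext x
    simp only [he_def, Pi.add_apply, Pi.sub_apply]
    ring
  have s5 := gradForm_sub_right hε hζ hγ He Hp HP
  have s6 := gradForm_sub_left hε hζ hγ Hy HY Hz
  rw [← formA_eq_gradForm hO He Hp, ← formA_eq_gradForm hO He HP] at s5
  rw [← formA_eq_gradForm hO Hy Hz, ← formA_eq_gradForm hO HY Hz] at s6
  have b1 := le_of_abs_le (hbd _ _ _ _ He (Hp.sub HP) t⁻¹ (by positivity))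
  have b2 := neg_le_of_abs_le (hbd _ _ _ _ (Hy.sub HY) Hz t ht)
  -- with these parameters the consistency error charges `e` and `z` the factor `t` only
  have b3 := neg_le_of_abs_le (hcons e P he hP (h / t) (by positivity))
  have b4 := le_of_abs_le (hcons Y z hY hz (t / h) (by positivity))
  have b5 := neg_le_of_abs_le (abs_innerL2_le (Hy.sub HY) He ht)
  have b6 := neg_le_of_abs_le (abs_innerL2_le (Hp.sub HP) Hz ht)
  have c1 := hcoer e he
  have c2 := hcoer z hz
  rw [innerL2_comm z e] at s3
  rw [inv_inv] at b1
  set E1 := energy Ω e (gradient e)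
  set E2 := energy Ω z (gradient z)
  set Dp := energy Ω (fun x => p x - P x) (fun x => weakGrad Ω p x - gradient P x)
  set Dy := energy Ω (fun x => y x - Y x) (fun x => weakGrad Ω y x - gradient Y x)
  set EP := energy Ω P (gradient P)
  set EY := energy Ω Y (gradient Y)
  have f3 : C * h * ((h / t)⁻¹ * E1 + h / t * EP) = C * (t * E1) + t⁻¹ * (C * h ^ 2 * EP) := by
    field_simp
  have f4 : C * h * ((t / h)⁻¹ * EY + t / h * E2) = C * (t * E2) + t⁻¹ * (C * h ^ 2 * EY) := by
    field_simp
    ring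
  rw [f3] at b3
  rw [f4] at b4
  have key : β * (E1 + E2) ≤ t * (K + C + 1) * (E1 + E2) +
      t⁻¹ * ((K + 1) * (Dp + Dy) + C * h ^ 2 * (EP + EY)) := by
    linarith
  rw [hβ] at key
  linarith

end Triangulation

end EAFE

end

open EAFE MeasureTheory in
theorem theorem4p2
    (Ω : Set EAFE.Plane) (hΩ : EAFE.IsConvexPolygon Ω)
    (ε : EAFE.Plane → ℝ) (ζ : EAFE.Plane → EAFE.Plane) (γ : EAFE.Plane → ℝ)
    (ε₀ γ₀ : ℝ) (hε₀ : 0 < ε₀) (hγ₀ : 0 < γ₀)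
    (hε : MeasureTheory.MemLp ε ⊤ (MeasureTheory.volume.restrict Ω))
    (hε_low : ∀ᵐ x ∂(MeasureTheory.volume.restrict Ω), ε₀ ≤ ε x)
    (hζ : ∀ i : Fin 2, EAFE.MemW1Inf Ω (fun x => ζ x i))
    (hγ : EAFE.MemW1Inf Ω γ)
    (hγ_nonneg : ∀ᵐ x ∂(MeasureTheory.volume.restrict Ω), 0 ≤ γ x)
    (hγζ : ∀ᵐ x ∂(MeasureTheory.volume.restrict Ω), γ₀ ≤ γ x - 1 / 2 * EAFE.weakDiv Ω ζ x)
    (yd : EAFE.Plane → ℝ) (hyd : EAFE.MemL2 Ω yd)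
    (p y : EAFE.Plane → ℝ) (hpy : EAFE.IsSaddleSolution Ω ε ζ γ yd p y)
    (hp : EAFE.MemH2 Ω p) (hy : EAFE.MemH2 Ω y)
    (σ : ℝ) :
    ∃ h₀ : ℝ, 0 < h₀ ∧ ∃ C : ℝ, 0 < C ∧
      ∀ M : EAFE.Triangulation Ω, M.ShapeRegular σ →
        (∀ T ∈ M.elems, EAFE.MemW1Inf (interior (EAFE.Tri.carrier T)) ε) →
        M.meshSize ≤ h₀ →
        (∃! w : (EAFE.Plane → ℝ) × (EAFE.Plane → ℝ),
          M.IsDiscreteSolution ε ζ γ yd w.1 w.2) ∧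
        ∀ ph yh : EAFE.Plane → ℝ, M.IsDiscreteSolution ε ζ γ yd ph yh →
          EAFE.normH1 Ω (fun x => y x - yh x) + EAFE.normH1 Ω (fun x => p x - ph x)
            ≤ C * M.meshSize := by
  have hO := hΩ.isOpen
  have hb := hΩ.isBounded
  by_cases hM₀ : ∃ M₀ : Triangulation Ω, ∀ T ∈ M₀.elems, MemW1Inf (interior (Tri.carrier T)) ε
  swap
  -- without a triangulation adapted to `ε` there is nothing to estimate
  · exact ⟨1, one_pos, 1, one_pos, fun M _ hM _ => absurd ⟨M, hM⟩ hM₀⟩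
  obtain ⟨M₀, hM₀⟩ := hM₀
  have hζm := memLp_vector_of_memW1Inf hζ
  obtain ⟨C₁, hC₁, hcons⟩ :=
    exists_abs_formAh_sub_formA_le (γ := γ) hΩ hε₀ hε hε_low hζ M₀ hM₀ σ
  obtain ⟨K, hK, hbd⟩ := exists_abs_gradForm_le hε hζm hγ.1
  obtain ⟨Ap, hAp, hIp⟩ := exists_interpolant_energy_le hΩ hp hpy.1 σ
  obtain ⟨Ay, hAy, hIy⟩ := exists_interpolant_energy_le hΩ hy hpy.2.1 σ
  set α := min ε₀ γ₀ with hα_def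
  have hα : 0 < α := lt_min hε₀ hγ₀
  set β := α / 2 with hβ_def
  have hβ : 0 < β := by positivity
  -- small enough for the error terms on the right to be absorbed by half of the coercivity
  set t := β / 2 / (K + C₁ + 1) with ht_def
  have ht : 0 < t := by positivity
  have htβ : t * (K + C₁ + 1) = β / 2 := by
    rw [ht_def]
    field_simp
  set Ep := energy Ω p (weakGrad Ω p) with hEp
  set Ey := energy Ω y (weakGrad Ω y) with hEy
  have hEp0 : 0 ≤ Ep := energy_nonneg _ _ _
  have hEy0 : 0 ≤ Ey := energy_nonneg _ _ _
  set Q := t⁻¹ * ((K + 1) * (Ap + Ay) + C₁ * (2 * Ep + 2 * Ap + (2 * Ey + 2 * Ay))) with hQ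
  have hQ0 : 0 ≤ Q := by positivity
  set R := 2 * (Ap + Ay) + 2 * (Q / (β / 2)) + 1 with hR
  have hR0 : 0 < R := by positivity
  -- below this mesh size the consistency error costs at most half of the coercivity of `a`
  refine ⟨min 1 (α / (4 * C₁)), by positivity, 2 * √R, by positivity, fun M hM hMε hMh => ?_⟩
  set h := M.meshSize with hh_def
  have hh0 : 0 ≤ h := M.meshSize_nonneg
  have hh1 : h ≤ 1 := hMh.trans (min_le_left _ _)
  have hh2 : C₁ * h ≤ α / 4 := by
    have := mul_le_mul_of_nonneg_left (hMh.trans (min_le_right _ _)) hC₁.le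
    calc C₁ * h ≤ C₁ * (α / (4 * C₁)) := this
      _ = α / 4 := by field_simp
  have hconsM := hcons M hM hMε
  have hcoer : ∀ v, M.MemV v → β * energy Ω v (gradient v) ≤ M.formAh ε ζ γ v v := by
    intro v hv
    have h1 := formA_self_ge hO hb hε hε_low hζ hγ.1 hγζ (hv.memH10 hΩ)
    rw [(hv.isH1 hΩ).energy_weakGrad hO] at h1
    have h2 := neg_le_of_abs_le (hconsM v v hv hv 1 one_pos)
    have h3 := mul_le_mul_of_nonneg_right hh2 (energy_nonneg Ω v (gradient v))
    rw [inv_one, one_mul] at h2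
    rw [hβ_def]
    linarith
  refine ⟨Triangulation.existsUnique_isDiscreteSolution hΩ hγ.1 hyd hβ hcoer, fun ph yh hs => ?_⟩
  obtain ⟨P, hP, hPe⟩ := hIp M hM hh1
  obtain ⟨Y, hY, hYe⟩ := hIy M hM hh1
  have Hp := hp.1.isH1
  have Hy := hy.1.isH1
  have HP := hP.isH1 hΩ
  have HY := hY.isH1 hΩ
  have He : IsH1 Ω (ph - P) (gradient (ph - P)) :=
    Triangulation.MemV.isH1 hΩ (M.femSpace.sub_mem hs.1 hP)
  have Hz : IsH1 Ω (Y - yh) (gradient (Y - yh)) :=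
    Triangulation.MemV.isH1 hΩ (M.femSpace.sub_mem hY hs.2.1)
  have hsq1 : h ^ 2 ≤ 1 := pow_le_one₀ hh0 hh1
  have hEP : energy Ω P (gradient P) ≤ 2 * Ep + 2 * Ap := by
    have := Hp.energy_sub_le (Hp.sub HP)
    simp only [sub_sub_cancel] at this
    have h2 := mul_le_of_le_one_right hAp hsq1
    exact this.trans (by linarith)
  have hEY : energy Ω Y (gradient Y) ≤ 2 * Ey + 2 * Ay := by
    have := Hy.energy_sub_le (Hy.sub HY)
    simp only [sub_sub_cancel] at this
    have h2 := mul_le_of_le_one_right hAy hsq1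
    exact this.trans (by linarith)
  have hmain := hs.energy_sub_le hΩ hε hζm hγ.1 hpy hP hY ht htβ hcoer hconsM hbd
  have hmain2 : β / 2 * (energy Ω (ph - P) (gradient (ph - P)) +
      energy Ω (Y - yh) (gradient (Y - yh))) ≤ Q * h ^ 2 := by
    refine hmain.trans ?_
    calc t⁻¹ * ((K + 1) * (_ + _) + C₁ * h ^ 2 * (_ + _))
        ≤ t⁻¹ * ((K + 1) * (Ap * h ^ 2 + Ay * h ^ 2) +
          C₁ * h ^ 2 * (2 * Ep + 2 * Ap + (2 * Ey + 2 * Ay))) := by gcongr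
      _ = Q * h ^ 2 := by
        rw [hQ]
        ring
  have hE : energy Ω (ph - P) (gradient (ph - P)) + energy Ω (Y - yh) (gradient (Y - yh)) ≤
      Q / (β / 2) * h ^ 2 := by
    rw [div_mul_eq_mul_div, le_div_iff₀ (by positivity)]
    linarith
  have e1 := energy_nonneg Ω (ph - P) (gradient (ph - P))
  have e2 := energy_nonneg Ω (Y - yh) (gradient (Y - yh))
  have n1 : normH1 Ω (fun x => y x - yh x) ≤ √R * h := by
    have a1 := (Hy.sub HY).add Hz
    have a2 := (Hy.sub HY).energy_add_le Hz
    have a3 := a1.normH1_eq hO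
    have e : (fun x => y x - Y x + (Y - yh) x) = fun x => y x - yh x := by
      ext x
      simp
    rw [e] at a2 a3
    rw [a3, ← Real.sqrt_sq hh0, ← Real.sqrt_mul hR0.le]
    refine Real.sqrt_le_sqrt (a2.trans ?_)
    rw [hR]
    linarith [mul_nonneg hAp (sq_nonneg h), sq_nonneg h]
  have n2 : normH1 Ω (fun x => p x - ph x) ≤ √R * h := by
    have a1 := (Hp.sub HP).sub He
    have a2 := (Hp.sub HP).energy_sub_le He
    have a3 := a1.normH1_eq hO
    have e : (fun x => p x - P x - (ph - P) x) = fun x => p x - ph x := by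
      ext x
      simp
    rw [e] at a2 a3
    rw [a3, ← Real.sqrt_sq hh0, ← Real.sqrt_mul hR0.le]
    refine Real.sqrt_le_sqrt (a2.trans ?_)
    rw [hR]
    linarith [mul_nonneg hAy (sq_nonneg h), sq_nonneg h]
  linarith
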